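/- Let $(X,H,\mu)$ be an abstract Wiener space: $X$ is a separable real Banach space, $\mu$ is a centered Gaussian Borel measure on $X$, and $H\hookrightarrow X$ is its Cameron–Martin space, i.e. a Hilbert space continuously and injectively embedded in $X$ with $\int_X \ell^2\,d\mu=\|\ell|_H\|_{H^*}^2$ for all $\ell\in X^*$. A Borel map $T:X\to X$ is called a.e. linear if it is linear on some Borel linear subspace $E\subset X$ with $\mu(E)=1$. Write $T^N$ for the $N$-fold iterate, and say that $T$ satisfies Strassen's law if for $\mu$-a.e. $x\in X$ the set of limit points, in the topology of $X$, of the sequence $(2\log N)^{-1/2}\,T^N x$ as $N\to\infty$ equals the closed unit ball $\{h\in H:\|h\|_H\le 1\}$ of $H$. (1) Let $S:H\to H$ be a bounded linear operator with $SS^*=I$. Then $S$ has a measure-preserving a.e. linear extension $T$ to $X$, and every a.e. linear extension $T$ of $S$ (with $H\subset E$ and $T|_H=S$) satisfies the following. If $\langle S^N x,y\rangle_H\to 0$ as $N\to\infty$ for all $x,y\in H$, then $T$ satisfies Strassen's law. Conversely, if $T$ satisfies Strassen's law, then $\frac1N\sum_{k=1}^N|\langle S^k x,y\rangle_H|\to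 0$ as $N\to\infty$ for all $x,y\in H$. (2) Let $T:X\to X$ be a measure-preserving a.e. linear map. If $T$ is strongly mixing, i.e. $\mu(A\cap T^{-n}B)\to\mu(A)\mu(B)$ for all Borel sets $A,B$, then $T$ satisfies Strassen's law. Conversely, if $T$ satisfies Strassen's law, then $T$ is ergodic and weakly mixing, the latter meaning that $\frac1n\sum_{k=1}^n|\mu(A\cap T^{-k}B)-\mu(A)\mu(B)|\to0$ for all Borel sets $A,B$. -/

import Mathlib

open MeasureTheory ProbabilityTheory Filter Topology

/-- `(X, H, μ)` is an abstract Wiener space with embedding `ι : H → X`: `μ` is a centered Gaussian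
measure on `X`, and `H` is a Hilbert space, continuously and injectively embedded in `X`, such that
the canonical cylindrical Gaussian of `H` is carried by `ι` to `μ`. That is, the variance under `μ`
of `ℓ ∈ X*` is `‖ι* ℓ‖²`, where `ι* ℓ = ℓ ∘ ι ∈ H*` carries the dual norm. Equivalently,
`ι ι*` is the covariance operator of `μ`, so that `ι H` with the norm of `H` is the Cameron-Martin
space of `μ`. (Compactness of `ι` is a consequence; `μ` need not have full support.) -/
structure IsAbstractWienerSpace {X H : Type*}
    [NormedAddCommGroup X] [NormedSpace ℝ X] [MeasurableSpace X]
    [NormedAddCommGroup H] [InnerProductSpace ℝ H]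
    (ι : H →L[ℝ] X) (μ : Measure X) : Prop where
  isGaussian : IsGaussian μ
  centered : ∀ ℓ : StrongDual ℝ X, ∫ x, ℓ x ∂μ = 0
  injective : Function.Injective ι
  variance_eq : ∀ ℓ : StrongDual ℝ X, Var[ℓ; μ] = ‖ℓ ∘L ι‖ ^ 2

/-- `T` is Borel measurable, and it is linear on the Borel-measurable linear subspace `E`, which has
full measure. The values of `T` off `E` are immaterial. -/
structure IsAELinearOn {X : Type*} [NormedAddCommGroup X] [NormedSpace ℝ X] [MeasurableSpace X]
    (μ : Measure X) (T : X → X) (E : Submodule ℝ X) : Prop where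
  measurable : Measurable T
  measurableSet : MeasurableSet (E : Set X)
  ae_mem : ∀ᵐ x ∂μ, x ∈ E
  map_add : ∀ x ∈ E, ∀ y ∈ E, T (x + y) = T x + T y
  map_smul : ∀ (c : ℝ), ∀ x ∈ E, T (c • x) = c • T x

/-- Measure-preserving a.e. linear maps. -/
def IsMeasurePreservingAELinear {X : Type*}
    [NormedAddCommGroup X] [NormedSpace ℝ X] [MeasurableSpace X]
    (μ : Measure X) (T : X → X) : Prop :=
  (∃ E : Submodule ℝ X, IsAELinearOn μ T E) ∧ MeasurePreserving T μ μ

/-- `T` is a measurable a.e. linear extension to `X` of the operator `S` on `H`. -/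
def IsAELinearExtension {X H : Type*}
    [NormedAddCommGroup X] [NormedSpace ℝ X] [MeasurableSpace X]
    [NormedAddCommGroup H] [InnerProductSpace ℝ H]
    (ι : H →L[ℝ] X) (μ : Measure X) (S : H →L[ℝ] H) (T : X → X) : Prop :=
  ∃ E : Submodule ℝ X, IsAELinearOn μ T E ∧ (∀ h : H, ι h ∈ E) ∧ ∀ h : H, T (ι h) = ι (S h)

/-- Strong mixing of a map `T` of a probability space. -/
def IsStronglyMixing {X : Type*} [MeasurableSpace X] (μ : Measure X) (T : X → X) : Prop :=
  ∀ A B : Set X, MeasurableSet A → MeasurableSet B →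
    Tendsto (fun n : ℕ => μ.real (A ∩ T^[n] ⁻¹' B)) atTop (𝓝 (μ.real A * μ.real B))

/-- Weak mixing of a map `T` of a probability space. -/
def IsWeaklyMixing {X : Type*} [MeasurableSpace X] (μ : Measure X) (T : X → X) : Prop :=
  ∀ A B : Set X, MeasurableSet A → MeasurableSet B →
    Tendsto (fun n : ℕ => (n : ℝ)⁻¹ *
      ∑ k ∈ Finset.Icc 1 n, |μ.real (A ∩ T^[k] ⁻¹' B) - μ.real A * μ.real B|) atTop (𝓝 0)

/-- The set of limit points in `X`, as `N → ∞`, of the sequence `(2 log N)^{-1/2} T^N x`. (The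
finitely many indices with `log N = 0` have no influence.) -/
noncomputable def strassenLimitSet {X : Type*} [NormedAddCommGroup X] [NormedSpace ℝ X]
    (T : X → X) (x : X) : Set X :=
  {y | MapClusterPt y atTop (fun N : ℕ => (√(2 * Real.log N))⁻¹ • T^[N] x)}

/-- For `μ`-almost every `x`, the set of limit points of `(2 log N)^{-1/2} T^N x` is the closed unit
ball of `H`, as a subset of `X`. -/
def HasStrassenLaw {X H : Type*}
    [NormedAddCommGroup X] [NormedSpace ℝ X] [MeasurableSpace X]
    [NormedAddCommGroup H] [InnerProductSpace ℝ H]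
    (ι : H →L[ℝ] X) (μ : Measure X) (T : X → X) : Prop :=
  ∀ᵐ x ∂μ, strassenLimitSet T x = ι '' Metric.closedBall (0 : H) 1

/-! Everything reduces to the Gaussian field indexed by `H`. Each `h` in `H` has an a.e. linear
functional on `X` that extends `⟪h, ·⟫`. It is unique up to null sets: by the Cameron-Martin
formula, sets invariant under shifts by `ι H` have measure 0 or 1, and this kills any a.e. linear
functional vanishing on `H` (`ae_eq_zero`). So if `T` extends a coisometry `S`, then `ℓ ∘ T^N` is
the functional of `V^N (ι* ℓ)`, where `V = S*` is an isometry. Conversely, the Cameron-Martin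
formula shows that a measure-preserving a.e. linear map sends `ι H` into `ι H` and restricts there
to a coisometry, so both halves concern the same maps.

The inclusion of the limit set in the ball needs no mixing. Gaussian tails and Borel-Cantelli bound
`ℓ (T^N x)` by about `‖ι* ℓ‖ √(2 log N)`, and duality turns these bounds into membership of the
ball. Fernique's theorem, applied to quotients by finite-dimensional subspaces, makes the normalized
orbit relatively compact.

For the reverse inclusion, let `h` be a unit vector with `⟪V^N h, h⟫ → 0`. A sparse sample of `n`
times along the orbit gives `n` almost uncorrelated standard Gaussians. The second moment method
shows only that their maximum exceeds `(1 - ε) √(2 log n)` with probability not too small;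
Maurey-Pisier concentration of the maximum then makes it exceed a slightly lower level with
probability tending to 1 (`measureReal_forall_le_le`). A point of the ball on which `h` is nearly 1
must be near `h`, so `ι h` is a limit point. Interior points of the ball are weak limits of unit
vectors.

For the converse, suppose that `V` is not weakly mixing. Cesàro averages of rank-one forms along an
orbit produce a nonzero positive operator `A` of finite trace that commutes with `V`
(`exists_commuting_trace_class`), so some nonzero `A x` has a precompact orbit. Along it the
Gaussian variables are, up to a small error, bounded combinations of finitely many fixed ones, hence
too small on the scale `√(log N)` for Strassen's law.

Mixing of `T` is read off from correlations: those of linear functionals are `⟪S^N x, y⟫`, and those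
of the exponentials `exp ℓ`, which span a dense subspace of `L²`, are controlled by the same inner
products. -/

/-! ## The dual embedding `X* → H` -/

section DualEmbedding

variable {X H : Type*} [NormedAddCommGroup X] [NormedSpace ℝ X]
  [NormedAddCommGroup H] [InnerProductSpace ℝ H] [CompleteSpace H]

/-- The adjoint `ι* : X* → H* ≃ H` of the embedding `ι : H → X`. -/
noncomputable def dualEmbedding (ι : H →L[ℝ] X) : StrongDual ℝ X →ₗ[ℝ] H where
  toFun ℓ := (InnerProductSpace.toDual ℝ H).symm (ℓ ∘L ι)
  map_add' ℓ m := by rw [ContinuousLinearMap.add_comp, map_add]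
  map_smul' c ℓ := by rw [ContinuousLinearMap.smul_comp]; simp

lemma inner_dualEmbedding (ι : H →L[ℝ] X) (ℓ : StrongDual ℝ X) (h : H) :
    inner ℝ (dualEmbedding ι ℓ) h = ℓ (ι h) :=
  InnerProductSpace.toDual_symm_apply

lemma norm_dualEmbedding (ι : H →L[ℝ] X) (ℓ : StrongDual ℝ X) :
    ‖dualEmbedding ι ℓ‖ = ‖ℓ ∘L ι‖ :=
  LinearIsometryEquiv.norm_map (InnerProductSpace.toDual ℝ H).symm (ℓ ∘L ι)

lemma exists_dual_ne_zero {x : X} (hx : x ≠ 0) : ∃ ℓ : StrongDual ℝ X, ℓ x ≠ 0 := by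
  obtain ⟨ℓ, -, h⟩ := exists_dual_vector ℝ x (norm_ne_zero_iff.2 hx)
  exact ⟨ℓ, by rw [h]; simpa using hx⟩

lemma eq_of_forall_dual_eq {x y : X} (h : ∀ ℓ : StrongDual ℝ X, ℓ x = ℓ y) : x = y := by
  by_contra hxy
  obtain ⟨ℓ, hℓ⟩ := exists_dual_ne_zero (sub_ne_zero.2 hxy)
  exact hℓ (by rw [map_sub, h, sub_self])

/-- A vector orthogonal to the range is sent by `ι` to a point on which every functional vanishes,
so injectivity of `ι` makes it zero. -/
lemma dense_range_dualEmbedding {ι : H →L[ℝ] X} (hι : Function.Injective ι) :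
    Dense (LinearMap.range (dualEmbedding ι) : Set H) := by
  rw [Submodule.dense_iff_topologicalClosure_eq_top, Submodule.topologicalClosure_eq_top_iff,
    Submodule.eq_bot_iff]
  intro h hh
  refine hι (eq_of_forall_dual_eq fun ℓ ↦ ?_)
  rw [map_zero, map_zero, ← inner_dualEmbedding]
  exact hh _ ⟨ℓ, rfl⟩

lemma exists_seq_dualEmbedding {ι : H →L[ℝ] X} (hι : Function.Injective ι) (h : H)
    {b : ℕ → ℝ} (hb : ∀ n, 0 < b n) :
    ∃ ℓ : ℕ → StrongDual ℝ X, ∀ n, ‖dualEmbedding ι (ℓ n) - h‖ < b n := by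
  have (n : ℕ) : ∃ ℓ : StrongDual ℝ X, ‖dualEmbedding ι ℓ - h‖ < b n := by
    obtain ⟨y, ⟨ℓ, rfl⟩, hy⟩ := (dense_range_dualEmbedding hι).exists_dist_lt h (hb n)
    exact ⟨ℓ, by rwa [← dist_eq_norm, dist_comm]⟩
  exact ⟨fun n ↦ (this n).choose, fun n ↦ (this n).choose_spec⟩

lemma exists_dualEmbedding_near {ι : H →L[ℝ] X} (hι : Function.Injective ι) (h : H)
    {b : ℝ} (hb : 0 < b) :
    ∃ ℓ : StrongDual ℝ X, ‖dualEmbedding ι ℓ - h‖ < b := by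
  obtain ⟨ℓ, hℓ⟩ := exists_seq_dualEmbedding hι h (fun _ ↦ hb)
  exact ⟨ℓ 0, hℓ 0⟩

/-- A vector of `X` that is dominated by the norm of `H` belongs to a multiple of the unit ball
of `H`. -/
lemma exists_mem_of_forall_dual_le {ι : H →L[ℝ] X} {y : X} {C : ℝ} (hC : 0 ≤ C)
    (hy : ∀ ℓ : StrongDual ℝ X, ℓ y ≤ C * ‖dualEmbedding ι ℓ‖) :
    ∃ h : H, ‖h‖ ≤ C ∧ ι h = y := by
  set D := dualEmbedding ι
  have hy' (ℓ : StrongDual ℝ X) : |ℓ y| ≤ C * ‖D ℓ‖ := by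
    refine abs_le.2 ⟨?_, hy ℓ⟩
    have := hy (-ℓ)
    rw [map_neg, norm_neg] at this
    simp only [neg_apply] at this
    linarith
  let ev : StrongDual ℝ X →ₗ[ℝ] ℝ :=
    { toFun := fun ℓ ↦ ℓ y, map_add' := fun _ _ ↦ rfl, map_smul' := fun _ _ ↦ rfl }
  have hker : LinearMap.ker D ≤ LinearMap.ker ev := by
    intro ℓ hℓ
    have := hy' ℓ
    rw [LinearMap.mem_ker.1 hℓ, norm_zero, mul_zero] at this
    exact abs_nonpos_iff.1 this
  -- The bound makes evaluation at `y` factor through `ι*`. Hahn-Banach extends the factored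
  -- functional to `H` with the same norm, and its Riesz vector is the preimage of `y`.
  let f : LinearMap.range D →ₗ[ℝ] ℝ :=
    (LinearMap.ker D).liftQ ev hker ∘ₗ D.quotKerEquivRange.symm.toLinearMap
  have hf (ℓ : StrongDual ℝ X) : f ⟨D ℓ, ⟨ℓ, rfl⟩⟩ = ℓ y := by
    have : D.quotKerEquivRange.symm ⟨D ℓ, ⟨ℓ, rfl⟩⟩ = (LinearMap.ker D).mkQ ℓ := by
      rw [LinearEquiv.symm_apply_eq]
      rfl
    simp only [f, LinearMap.comp_apply, LinearEquiv.coe_coe]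
    rw [this]
    rfl
  let F : StrongDual ℝ (LinearMap.range D) := f.mkContinuous C (by
    rintro ⟨_, ⟨ℓ, rfl⟩⟩
    rw [hf]
    exact hy' ℓ)
  obtain ⟨G, hG, hGn⟩ := exists_extension_norm_eq (LinearMap.range D) F
  refine ⟨(InnerProductSpace.toDual ℝ H).symm G, ?_, eq_of_forall_dual_eq fun ℓ ↦ ?_⟩
  · rw [LinearIsometryEquiv.norm_map, hGn]
    exact LinearMap.mkContinuous_norm_le _ hC _
  · rw [← inner_dualEmbedding, real_inner_comm, InnerProductSpace.toDual_symm_apply]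
    exact (hG ⟨D ℓ, ⟨ℓ, rfl⟩⟩).trans (hf ℓ)

end DualEmbedding

/-! ## Centered Gaussian random variables -/

section GaussianReal

variable {Ω : Type*} [MeasurableSpace Ω] {P : Measure Ω} {g : Ω → ℝ} {σ : ℝ}

/-- `g` has the centered Gaussian law with standard deviation `|σ|`. -/
def IsCenteredGaussian (P : Measure Ω) (g : Ω → ℝ) (σ : ℝ) : Prop :=
  Measurable g ∧ P.map g = gaussianReal 0 (σ ^ 2).toNNReal

lemma IsCenteredGaussian.mgf_eq (hg : IsCenteredGaussian P g σ) (t : ℝ) :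
    ∫ x, Real.exp (t * g x) ∂P = Real.exp (σ ^ 2 * t ^ 2 / 2) := by
  have := mgf_gaussianReal hg.2 t
  rw [mgf] at this
  rw [this, zero_mul, zero_add, Real.coe_toNNReal _ (sq_nonneg σ)]

lemma IsCenteredGaussian.integral_exp (hg : IsCenteredGaussian P g σ) :
    ∫ x, Real.exp (g x) ∂P = Real.exp (σ ^ 2 / 2) := by
  simpa using hg.mgf_eq 1

lemma IsCenteredGaussian.integrable_exp_mul (hg : IsCenteredGaussian P g σ) (t : ℝ) :
    Integrable (fun x ↦ Real.exp (t * g x)) P := by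
  have h := integrable_exp_mul_gaussianReal (μ := 0) (v := (σ ^ 2).toNNReal) t
  rw [← hg.2] at h
  exact h.comp_measurable hg.1

lemma IsCenteredGaussian.integrable_exp (hg : IsCenteredGaussian P g σ) :
    Integrable (fun x ↦ Real.exp (g x)) P := by
  simpa using hg.integrable_exp_mul 1

lemma IsCenteredGaussian.memLp (hg : IsCenteredGaussian P g σ) {p : ENNReal} (hp : p ≠ ⊤) :
    MemLp g p P := by
  have h := memLp_id_gaussianReal' (μ := 0) (v := (σ ^ 2).toNNReal) p hp
  rw [← hg.2] at h
  exact h.comp_of_map hg.1.aemeasurable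

lemma IsCenteredGaussian.integral_eq_zero (hg : IsCenteredGaussian P g σ) :
    ∫ x, g x ∂P = 0 := by
  have h := integral_id_gaussianReal (μ := 0) (v := (σ ^ 2).toNNReal)
  rwa [← hg.2, integral_map hg.1.aemeasurable (by fun_prop)] at h

lemma IsCenteredGaussian.integral_sq (hg : IsCenteredGaussian P g σ) :
    ∫ x, g x ^ 2 ∂P = σ ^ 2 := by
  have h := variance_fun_id_gaussianReal (μ := 0) (v := (σ ^ 2).toNNReal)
  rw [variance_eq_integral (by fun_prop), integral_id_gaussianReal, ← hg.2,
    integral_map hg.1.aemeasurable (by fun_prop), Real.coe_toNNReal _ (sq_nonneg σ)] at h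
  simpa using h

lemma IsCenteredGaussian.eLpNorm_two (hg : IsCenteredGaussian P g σ) :
    eLpNorm g 2 P = ENNReal.ofReal |σ| := by
  rw [(hg.memLp (by simp)).eLpNorm_eq_integral_rpow_norm (by simp) (by simp)]
  have := hg.integral_sq
  simp only [ENNReal.toReal_ofNat, Real.norm_eq_abs]
  norm_cast
  simp only [sq_abs]
  rw [this, ← one_div, ← Real.sqrt_eq_rpow, Real.sqrt_sq_eq_abs]

/-- The variance proxy `v` may exceed the variance, so that one bound serves a whole family. For `v
= 0` the right side is `exp 0 = 1`, because division by zero is zero. -/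
lemma IsCenteredGaussian.tail (hg : IsCenteredGaussian P g σ) [IsProbabilityMeasure P]
    {v : ℝ} (hv : σ ^ 2 ≤ v) {t : ℝ} (ht : 0 ≤ t) :
    P.real {x | t ≤ g x} ≤ Real.exp (-t ^ 2 / (2 * v)) := by
  have hv0 : 0 ≤ v := (sq_nonneg σ).trans hv
  have h : HasSubgaussianMGF g v.toNNReal P := by
    refine ⟨fun t ↦ hg.integrable_exp_mul t, fun t ↦ ?_⟩
    rw [mgf, hg.mgf_eq, Real.coe_toNNReal _ hv0]
    gcongr
  have := h.measure_ge_le ht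
  rwa [Real.coe_toNNReal _ hv0] at this

lemma IsCenteredGaussian.const_mul (hg : IsCenteredGaussian P g σ) (c : ℝ) :
    IsCenteredGaussian P (fun x ↦ c * g x) (c * σ) := by
  refine ⟨hg.1.const_mul c, ?_⟩
  have := ProbabilityTheory.gaussianReal_const_mul ⟨hg.1.aemeasurable, hg.2⟩ c
  rw [this.map_eq, mul_zero]
  congr 1
  ext
  rw [Real.coe_toNNReal _ (sq_nonneg _)]
  push_cast
  rw [Real.coe_toNNReal _ (sq_nonneg _), mul_pow]

end GaussianReal

/-- A finite measure on a separable Banach space is determined by the Laplace transforms of its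
one-dimensional marginals. -/
lemma measure_ext_of_integral_exp_dual {X : Type*} [NormedAddCommGroup X] [NormedSpace ℝ X]
    [CompleteSpace X] [SecondCountableTopology X] [MeasurableSpace X] [BorelSpace X]
    {μ ν : Measure X} [IsFiniteMeasure μ] [IsFiniteMeasure ν]
    (hμ : ∀ ℓ : StrongDual ℝ X, Integrable (fun x ↦ Real.exp (ℓ x)) μ)
    (h : ∀ ℓ : StrongDual ℝ X, ∫ x, Real.exp (ℓ x) ∂μ = ∫ x, Real.exp (ℓ x) ∂ν) : μ = ν := by
  -- This is why integrability under `ν` is not assumed: a non-integrable exponential has integral 0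
  -- by convention, while under a nonzero measure an integrable one has positive integral.
  have h0 : μ = 0 ↔ ν = 0 := by
    have := h 0
    simp only [zero_apply, Real.exp_zero, integral_const, smul_eq_mul,
      mul_one] at this
    rw [← Measure.measure_univ_eq_zero, ← Measure.measure_univ_eq_zero,
      ← measureReal_eq_zero_iff, this, measureReal_eq_zero_iff]
  refine Measure.ext_of_charFunDual (funext fun ℓ ↦ ?_)
  have hm : mgf ℓ μ = mgf ℓ ν := funext fun t ↦ by
    simpa [mgf] using h (t • ℓ)
  have hs : integrableExpSet ℓ μ = Set.univ := Set.eq_univ_of_forall fun t ↦ by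
    simpa [integrableExpSet] using hμ (t • ℓ)
  -- Analytic continuation from the real axis; the value at `I` is the characteristic function.
  have := eqOn_complexMGF_of_mgf' hm h0 (x := Complex.I) (by simp [hs])
  simpa [charFunDual_apply, complexMGF, mul_comm] using this

set_option linter.unusedSectionVars false

/-- Characteristic functions are bounded by 1, so dominated convergence passes them to the limit
without any uniform integrability. -/
lemma IsCenteredGaussian.of_tendsto {Ω : Type*} [MeasurableSpace Ω] {P : Measure Ω}
    [IsProbabilityMeasure P] {f : ℕ → Ω → ℝ} {g : Ω → ℝ} {σ : ℕ → ℝ} {τ : ℝ}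
    (hf : ∀ n, IsCenteredGaussian P (f n) (σ n)) (hσ : Tendsto σ atTop (𝓝 τ))
    (hg : Measurable g) (hfg : ∀ᵐ x ∂P, Tendsto (fun n ↦ f n x) atTop (𝓝 (g x))) :
    IsCenteredGaussian P g τ := by
  refine ⟨hg, ?_⟩
  have : IsProbabilityMeasure (P.map g) := Measure.isProbabilityMeasure_map hg.aemeasurable
  refine Measure.ext_of_charFun (funext fun t ↦ ?_)
  have h1 (f : Ω → ℝ) (hf : Measurable f) :
      charFun (P.map f) t = ∫ x, Complex.exp (t * f x * Complex.I) ∂P := by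
    rw [charFun_apply_real, integral_map hf.aemeasurable (by fun_prop)]
  have h2 : Tendsto (fun n ↦ charFun (P.map (f n)) t) atTop (𝓝 (charFun (P.map g) t)) := by
    simp_rw [h1 g hg, fun n ↦ h1 (f n) (hf n).1]
    refine tendsto_integral_of_dominated_convergence (fun _ ↦ 1) (fun n ↦ ?_)
      (integrable_const _) (fun n ↦ ae_of_all _ fun x ↦ ?_) ?_
    · have := (hf n).1
      exact Measurable.aestronglyMeasurable (by fun_prop)
    · rw [← Complex.ofReal_mul, Complex.norm_exp_ofReal_mul_I]
    · filter_upwards [hfg] with x hx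
      have : Continuous fun y : ℝ ↦ Complex.exp (t * y * Complex.I) := by fun_prop
      exact (this.tendsto _).comp hx
  refine tendsto_nhds_unique h2 ?_
  simp_rw [fun n ↦ (hf n).2, charFun_gaussianReal]
  have h3 (s : ℝ) : (((s ^ 2).toNNReal : ℝ) : ℂ) = (s : ℂ) ^ 2 := by
    rw [Real.coe_toNNReal _ (sq_nonneg _)]
    push_cast
    rfl
  simp_rw [h3]
  have : Continuous fun s : ℝ ↦
      Complex.exp (t * (0 : ℝ) * Complex.I - (s : ℂ) ^ 2 * t ^ 2 / 2) := by
    fun_prop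
  exact (this.tendsto τ).comp hσ

/-! ### Wiener functionals, the Cameron-Martin formula and the zero-one law. -/

/-- `g` is measurable, and it is linear on the measurable linear subspace `E` of full measure, where
`E` contains `H` and `g` extends the functional `⟪h, ·⟫` on `H`. -/
structure IsWienerFunctionalOn {X H : Type*}
    [NormedAddCommGroup X] [NormedSpace ℝ X] [MeasurableSpace X]
    [NormedAddCommGroup H] [InnerProductSpace ℝ H]
    (ι : H →L[ℝ] X) (μ : Measure X) (h : H) (g : X → ℝ) (E : Submodule ℝ X) : Prop where
  measurable : Measurable g
  measurableSet : MeasurableSet (E : Set X)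
  ae_mem : ∀ᵐ x ∂μ, x ∈ E
  map_add : ∀ x ∈ E, ∀ y ∈ E, g (x + y) = g x + g y
  map_smul : ∀ (c : ℝ), ∀ x ∈ E, g (c • x) = c * g x
  embedding_mem : ∀ k : H, ι k ∈ E
  apply_embedding : ∀ k : H, g (ι k) = inner ℝ h k

/-- `g` is a measurable a.e. linear extension to `X` of the functional `⟪h, ·⟫` on `H`. -/
def IsWienerFunctional {X H : Type*}
    [NormedAddCommGroup X] [NormedSpace ℝ X] [MeasurableSpace X]
    [NormedAddCommGroup H] [InnerProductSpace ℝ H]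
    (ι : H →L[ℝ] X) (μ : Measure X) (h : H) (g : X → ℝ) : Prop :=
  ∃ E : Submodule ℝ X, IsWienerFunctionalOn ι μ h g E

section WienerFunctional

variable {X H : Type*} [NormedAddCommGroup X] [NormedSpace ℝ X] [MeasurableSpace X]
  [NormedAddCommGroup H] [InnerProductSpace ℝ H] {ι : H →L[ℝ] X} {μ : Measure X}

namespace IsWienerFunctional

variable {h k : H} {f g : X → ℝ}

lemma measurable (hg : IsWienerFunctional ι μ h g) : Measurable g := hg.choose_spec.measurable

lemma add (hf : IsWienerFunctional ι μ h f) (hg : IsWienerFunctional ι μ k g) :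
    IsWienerFunctional ι μ (h + k) (fun x ↦ f x + g x) := by
  obtain ⟨E, hE⟩ := hf
  obtain ⟨F, hF⟩ := hg
  refine ⟨E ⊓ F, hE.measurable.add hF.measurable, ?_, ?_, ?_, ?_, ?_, ?_⟩
  · exact hE.measurableSet.inter hF.measurableSet
  · filter_upwards [hE.ae_mem, hF.ae_mem] with x h1 h2 using ⟨h1, h2⟩
  · intro x hx y hy
    rw [hE.map_add x hx.1 y hy.1, hF.map_add x hx.2 y hy.2]
    ring
  · intro c x hx
    rw [hE.map_smul c x hx.1, hF.map_smul c x hx.2]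
    ring
  · exact fun k ↦ ⟨hE.embedding_mem k, hF.embedding_mem k⟩
  · intro v
    rw [hE.apply_embedding, hF.apply_embedding, inner_add_left]

lemma const_mul (hg : IsWienerFunctional ι μ h g) (c : ℝ) :
    IsWienerFunctional ι μ (c • h) (fun x ↦ c * g x) := by
  obtain ⟨E, hE⟩ := hg
  refine ⟨E, hE.measurable.const_mul c, hE.measurableSet, hE.ae_mem, ?_, ?_, hE.embedding_mem, ?_⟩
  · intro x hx y hy
    rw [hE.map_add x hx y hy]
    ring
  · intro d x hx
    rw [hE.map_smul d x hx]
    ring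
  · intro v
    rw [hE.apply_embedding, inner_smul_left]
    rfl

lemma sub (hf : IsWienerFunctional ι μ h f) (hg : IsWienerFunctional ι μ k g) :
    IsWienerFunctional ι μ (h - k) (fun x ↦ f x - g x) := by
  have := hf.add (hg.const_mul (-1))
  simpa [sub_eq_add_neg] using this

variable (ι μ) in
lemma zero : IsWienerFunctional ι μ (0 : H) (fun _ ↦ 0) :=
  ⟨⊤, measurable_const, MeasurableSet.univ, ae_of_all _ fun _ ↦ Submodule.mem_top, by simp,
    by simp, by simp, by simp⟩

lemma sum {κ : Type*} (s : Finset κ) {h : κ → H} {g : κ → X → ℝ}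
    (hg : ∀ i ∈ s, IsWienerFunctional ι μ (h i) (g i)) :
    IsWienerFunctional ι μ (∑ i ∈ s, h i) (fun x ↦ ∑ i ∈ s, g i x) := by
  classical
  induction s using Finset.induction_on with
  | empty => simpa using zero ι μ
  | insert a s ha ih =>
    simp only [Finset.sum_insert ha]
    exact (hg a (Finset.mem_insert_self a s)).add
      (ih fun i hi ↦ hg i (Finset.mem_insert_of_mem hi))

lemma dual [CompleteSpace H] [BorelSpace X] (ℓ : StrongDual ℝ X) :
    IsWienerFunctional ι μ (dualEmbedding ι ℓ) ℓ :=
  ⟨⊤, ℓ.continuous.measurable, MeasurableSet.univ, ae_of_all _ fun _ ↦ Submodule.mem_top, by simp,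
    by simp, by simp, fun k ↦ (inner_dualEmbedding ι ℓ k).symm⟩

end IsWienerFunctional

variable [CompleteSpace X] [SecondCountableTopology X] [BorelSpace X] [CompleteSpace H]

namespace IsAbstractWienerSpace

lemma isProbabilityMeasure (hW : IsAbstractWienerSpace ι μ) : IsProbabilityMeasure μ :=
  have := hW.isGaussian
  inferInstance

lemma isCenteredGaussian_dual (hW : IsAbstractWienerSpace ι μ) (ℓ : StrongDual ℝ X) :
    IsCenteredGaussian μ ℓ ‖dualEmbedding ι ℓ‖ := by
  have := hW.isGaussian
  refine ⟨ℓ.continuous.measurable, ?_⟩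
  rw [IsGaussian.map_eq_gaussianReal, hW.centered, hW.variance_eq, norm_dualEmbedding]

/-- Every `h` in `H` has a Wiener functional that is an a.e. limit of continuous functionals. -/
lemma exists_isWienerFunctional_tendsto (hW : IsAbstractWienerSpace ι μ) (h : H) :
    ∃ (g : X → ℝ) (ℓ : ℕ → StrongDual ℝ X), IsWienerFunctional ι μ h g ∧
      Tendsto (fun n ↦ dualEmbedding ι (ℓ n)) atTop (𝓝 h) ∧
      ∀ᵐ x ∂μ, Tendsto (fun n ↦ ℓ n x) atTop (𝓝 (g x)) := by
  -- With this tolerance, terms of index at least `N` differ by less than `(1/2)^N` in `L²`, and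
  -- summability of these bounds gives a.e. convergence of the whole sequence.
  obtain ⟨ℓ, hℓ⟩ := exists_seq_dualEmbedding hW.injective h (b := fun n ↦ (1 / 2) ^ n / 2)
    (fun n ↦ by positivity)
  have hlim : Tendsto (fun n ↦ dualEmbedding ι (ℓ n)) atTop (𝓝 h) := by
    rw [tendsto_iff_norm_sub_tendsto_zero]
    refine squeeze_zero (fun _ ↦ norm_nonneg _) (fun n ↦ (hℓ n).le) ?_
    simpa using (tendsto_pow_atTop_nhds_zero_of_lt_one (r := (1 / 2 : ℝ)) (by norm_num)
      (by norm_num)).div_const 2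
  have hconv : ∀ᵐ x ∂μ, ∃ c, Tendsto (fun n ↦ ℓ n x) atTop (𝓝 c) := by
    refine Lp.ae_tendsto_of_cauchy_eLpNorm (p := 2) (f := fun n ↦ ℓ n)
      (B := fun n ↦ ENNReal.ofReal ((1 / 2) ^ n))
      (fun n ↦ (ℓ n).continuous.measurable.aestronglyMeasurable) (by norm_num) ?_ ?_
    · rw [← ENNReal.ofReal_tsum_of_nonneg (fun n ↦ by positivity)
        (summable_geometric_of_lt_one (by norm_num) (by norm_num))]
      exact ENNReal.ofReal_ne_top
    · intro N n m hn hm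
      have h1 : (ℓ n : X → ℝ) - ℓ m = (ℓ n - ℓ m : StrongDual ℝ X) := rfl
      rw [h1, (hW.isCenteredGaussian_dual _).eLpNorm_two, abs_norm, map_sub,
        ENNReal.ofReal_lt_ofReal_iff (by positivity)]
      have hb (j : ℕ) (hj : N ≤ j) : ‖dualEmbedding ι (ℓ j) - h‖ < (1 / 2) ^ N / 2 := by
        refine (hℓ j).trans_le ?_
        have := pow_le_pow_of_le_one (a := (1 / 2 : ℝ)) (by norm_num) (by norm_num) hj
        linarith
      calc ‖dualEmbedding ι (ℓ n) - dualEmbedding ι (ℓ m)‖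
          = ‖(dualEmbedding ι (ℓ n) - h) - (dualEmbedding ι (ℓ m) - h)‖ := by congr 1; abel
        _ ≤ ‖dualEmbedding ι (ℓ n) - h‖ + ‖dualEmbedding ι (ℓ m) - h‖ := norm_sub_le _ _
        _ < (1 / 2) ^ N := by linarith [hb n hn, hb m hm]
  -- The set of convergence is a measurable subspace, and it contains `ι H` because `ℓ n (ι k) = ⟪ι*
  -- (ℓ n), k⟫`, which tends to `⟪h, k⟫`.
  let E : Submodule ℝ X :=
    { carrier := {x | ∃ c, Tendsto (fun n ↦ ℓ n x) atTop (𝓝 c)}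
      add_mem' := by
        rintro x y ⟨c, hc⟩ ⟨d, hd⟩
        exact ⟨c + d, by simpa using hc.add hd⟩
      zero_mem' := ⟨0, by simp⟩
      smul_mem' := by
        rintro a x ⟨c, hc⟩
        exact ⟨a * c, by simpa using hc.const_mul a⟩ }
  have hEm : MeasurableSet (E : Set X) :=
    measurableSet_exists_tendsto fun n ↦ (ℓ n).continuous.measurable
  classical
  let g : X → ℝ := fun x ↦ if hx : x ∈ E then hx.choose else 0
  have hg (x : X) (hx : x ∈ E) : Tendsto (fun n ↦ ℓ n x) atTop (𝓝 (g x)) := by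
    simp only [g, dif_pos hx]
    exact hx.choose_spec
  have hgm : Measurable g := by
    refine measurable_of_tendsto_metrizable
      (f := fun n ↦ (E : Set X).indicator (ℓ n)) (fun n ↦ ?_) ?_
    · exact (ℓ n).continuous.measurable.indicator hEm
    · rw [tendsto_pi_nhds]
      intro x
      by_cases hx : x ∈ E
      · simpa [Set.indicator_of_mem (show x ∈ (E : Set X) from hx)] using hg x hx
      · simp [Set.indicator_of_notMem (show x ∉ (E : Set X) from hx), g, dif_neg hx]
  have hι (k : H) : Tendsto (fun n ↦ ℓ n (ι k)) atTop (𝓝 (inner ℝ h k)) := by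
    simp_rw [← inner_dualEmbedding]
    exact hlim.inner tendsto_const_nhds
  refine ⟨g, ℓ, ⟨E, hgm, hEm, hconv, ?_, ?_, fun k ↦ ⟨_, hι k⟩, ?_⟩, hlim, ?_⟩
  · intro x hx y hy
    refine tendsto_nhds_unique (hg _ (E.add_mem hx hy)) ?_
    simpa using (hg x hx).add (hg y hy)
  · intro c x hx
    refine tendsto_nhds_unique (hg _ (E.smul_mem c hx)) ?_
    simpa using (hg x hx).const_mul c
  · intro k
    exact tendsto_nhds_unique (hg _ ⟨_, hι k⟩) (hι k)
  · filter_upwards [hconv] with x hx using hg x hx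

lemma integral_exp_dual (hW : IsAbstractWienerSpace ι μ) (ℓ : StrongDual ℝ X) :
    ∫ x, Real.exp (ℓ x) ∂μ = Real.exp (‖dualEmbedding ι ℓ‖ ^ 2 / 2) :=
  (hW.isCenteredGaussian_dual ℓ).integral_exp

/-- Supplies the Laplace transform of the density in the Cameron-Martin formula, where `m` is the
test functional. -/
lemma isCenteredGaussian_dual_add_of_tendsto (hW : IsAbstractWienerSpace ι μ) {h : H} {g : X → ℝ}
    {ℓ : ℕ → StrongDual ℝ X} (hg : Measurable g)
    (hℓ : Tendsto (fun n ↦ dualEmbedding ι (ℓ n)) atTop (𝓝 h))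
    (hlim : ∀ᵐ x ∂μ, Tendsto (fun n ↦ ℓ n x) atTop (𝓝 (g x))) (m : StrongDual ℝ X) :
    IsCenteredGaussian μ (fun x ↦ m x + g x) ‖dualEmbedding ι m + h‖ := by
  have := hW.isProbabilityMeasure
  refine IsCenteredGaussian.of_tendsto (fun n ↦ hW.isCenteredGaussian_dual (m + ℓ n)) ?_
    (m.continuous.measurable.add hg) ?_
  · simp_rw [map_add]
    exact (tendsto_const_nhds.add hℓ).norm
  · filter_upwards [hlim] with x hx
    simpa using tendsto_const_nhds.add hx

/-- The Cameron-Martin formula. -/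
lemma map_add_eq_withDensity_of_tendsto (hW : IsAbstractWienerSpace ι μ) {h : H} {g : X → ℝ}
    {ℓ : ℕ → StrongDual ℝ X} (hg : Measurable g)
    (hℓ : Tendsto (fun n ↦ dualEmbedding ι (ℓ n)) atTop (𝓝 h))
    (hlim : ∀ᵐ x ∂μ, Tendsto (fun n ↦ ℓ n x) atTop (𝓝 (g x))) :
    μ.map (· + ι h) = μ.withDensity fun x ↦ ENNReal.ofReal (Real.exp (g x - ‖h‖ ^ 2 / 2)) := by
  have := hW.isProbabilityMeasure
  have hadd (m : StrongDual ℝ X) :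
      IsCenteredGaussian μ (fun x ↦ m x + g x) ‖dualEmbedding ι m + h‖ :=
    hW.isCenteredGaussian_dual_add_of_tendsto hg hℓ hlim m
  have hgl : IsCenteredGaussian μ g ‖h‖ := by simpa using hadd 0
  have hd : Measurable fun x ↦ Real.exp (g x - ‖h‖ ^ 2 / 2) :=
    (hg.sub_const _).exp
  have hi : Integrable (fun x ↦ Real.exp (g x - ‖h‖ ^ 2 / 2)) μ := by
    simp_rw [Real.exp_sub]
    exact hgl.integrable_exp.div_const _
  have := isFiniteMeasure_withDensity_ofReal hi.2
  have hmt : Measurable fun x ↦ x + ι h := measurable_id.add_const _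
  have : IsProbabilityMeasure (μ.map (· + ι h)) :=
    Measure.isProbabilityMeasure_map hmt.aemeasurable
  -- Both Laplace transforms equal `exp (‖ι* m‖² / 2 + ⟪ι* m, h⟫)`, by expanding `‖ι* m + h‖²`.
  refine measure_ext_of_integral_exp_dual (fun m ↦ ?_) fun m ↦ ?_
  · rw [integrable_map_measure (by fun_prop) hmt.aemeasurable]
    simp only [Function.comp_def, map_add, Real.exp_add]
    exact (hW.isCenteredGaussian_dual m).integrable_exp.mul_const _
  · rw [integral_map hmt.aemeasurable (by fun_prop), integral_withDensity_eq_integral_toReal_smul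
      hd.ennreal_ofReal (ae_of_all _ fun _ ↦ ENNReal.ofReal_lt_top)]
    have h1 (x : X) : (ENNReal.ofReal (Real.exp (g x - ‖h‖ ^ 2 / 2))).toReal • Real.exp (m x)
        = Real.exp (m x + g x) * Real.exp (-(‖h‖ ^ 2 / 2)) := by
      rw [ENNReal.toReal_ofReal (Real.exp_pos _).le, smul_eq_mul, ← Real.exp_add, ← Real.exp_add]
      congr 1
      ring
    simp_rw [h1, map_add, Real.exp_add (m _) (m _)]
    rw [integral_mul_const, integral_mul_const, hW.integral_exp_dual, (hadd m).integral_exp,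
      ← Real.exp_add, ← Real.exp_add, norm_add_sq_real, inner_dualEmbedding]
    congr 1
    ring

/-- A measurable set that is invariant under the translations by `ι H` has measure `0` or `1`. -/
lemma measure_eq_zero_or_one_of_shift_invariant (hW : IsAbstractWienerSpace ι μ) {A : Set X}
    (hA : MeasurableSet A) (hinv : ∀ h : H, ∀ᵐ x ∂μ, x + ι h ∈ A ↔ x ∈ A) :
    μ A = 0 ∨ μ A = 1 := by
  have := hW.isProbabilityMeasure
  -- Invariance under the shift by `ι ι* ℓ` and the Cameron-Martin formula give `∫_A exp ℓ = μ(A) ∫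
  -- exp ℓ` for every `ℓ`. Evaluating the resulting identity of measures at `A` yields `μ(A) =
  -- μ(A)²`.
  have key : μ.restrict A = μ A • μ := by
    have : IsFiniteMeasure (μ A • μ) := Measure.smul_finite μ (measure_ne_top μ A)
    refine measure_ext_of_integral_exp_dual
      (fun ℓ ↦ (hW.isCenteredGaussian_dual ℓ).integrable_exp.restrict) fun ℓ ↦ ?_
    have hmt : Measurable fun x ↦ x + ι (dualEmbedding ι ℓ) := measurable_id.add_const _
    have hcm := congrArg (fun ν : Measure X ↦ ν A) (hW.map_add_eq_withDensity_of_tendsto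
      (ℓ := fun _ ↦ ℓ) ℓ.continuous.measurable tendsto_const_nhds
      (ae_of_all _ fun _ ↦ tendsto_const_nhds))
    have hpre : μ ((· + ι (dualEmbedding ι ℓ)) ⁻¹' A) = μ A :=
      measure_congr (by
        filter_upwards [hinv (dualEmbedding ι ℓ)] with x hx
        exact propext hx)
    have hi : Integrable (fun x ↦ Real.exp (ℓ x)) μ :=
      (hW.isCenteredGaussian_dual ℓ).integrable_exp
    simp only [Real.exp_sub] at hcm
    rw [Measure.map_apply hmt hA, hpre, withDensity_apply _ hA,
      ← ofReal_integral_eq_lintegral_ofReal (hi.restrict.div_const _)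
        (ae_of_all _ fun _ ↦ by positivity), integral_div] at hcm
    have h2 := congrArg ENNReal.toReal hcm
    rw [ENNReal.toReal_ofReal
      (div_nonneg (integral_nonneg fun _ ↦ (Real.exp_pos _).le) (Real.exp_pos _).le),
      eq_div_iff (Real.exp_pos _).ne'] at h2
    rw [integral_smul_measure, hW.integral_exp_dual, smul_eq_mul, ← h2]
  have h1 := congrArg (fun ν : Measure X ↦ ν A) key
  simp only [Measure.restrict_apply_self, Measure.smul_apply, smul_eq_mul] at h1
  by_cases h0 : μ A = 0
  · exact Or.inl h0
  · right
    have := (ENNReal.mul_eq_left h0 (measure_ne_top μ A)).1 h1.symm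
    exact this

/-- The Cameron-Martin formula. -/
lemma exists_map_add_eq_withDensity (hW : IsAbstractWienerSpace ι μ) (h : H) :
    ∃ g : X → ℝ, IsWienerFunctional ι μ h g ∧ IsCenteredGaussian μ g ‖h‖ ∧
      μ.map (· + ι h) = μ.withDensity fun x ↦ ENNReal.ofReal (Real.exp (g x - ‖h‖ ^ 2 / 2)) := by
  obtain ⟨g, ℓ, hg, hℓ, hlim⟩ := hW.exists_isWienerFunctional_tendsto h
  refine ⟨g, hg, ?_, hW.map_add_eq_withDensity_of_tendsto hg.measurable hℓ hlim⟩
  simpa using hW.isCenteredGaussian_dual_add_of_tendsto hg.measurable hℓ hlim 0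

lemma map_neg (hW : IsAbstractWienerSpace ι μ) : μ.map (fun x ↦ -x) = μ := by
  have := hW.isProbabilityMeasure
  have : IsProbabilityMeasure (μ.map (fun x ↦ -x)) :=
    Measure.isProbabilityMeasure_map measurable_neg.aemeasurable
  refine (measure_ext_of_integral_exp_dual
    (fun ℓ ↦ (hW.isCenteredGaussian_dual ℓ).integrable_exp) fun ℓ ↦ ?_).symm
  rw [integral_map measurable_neg.aemeasurable (by fun_prop)]
  have (x : X) : ℓ (-x) = (-ℓ) x := by simp
  simp_rw [this]
  rw [hW.integral_exp_dual, hW.integral_exp_dual, _root_.map_neg, norm_neg]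

/-- An a.e. linear functional that vanishes on `H` vanishes a.e. -/
lemma ae_eq_zero (hW : IsAbstractWienerSpace ι μ) {g : X → ℝ}
    (hg : IsWienerFunctional ι μ (0 : H) g) : ∀ᵐ x ∂μ, g x = 0 := by
  have := hW.isProbabilityMeasure
  obtain ⟨E, hE⟩ := hg
  -- The reflection `x ↦ -x` exchanges these two disjoint sets, so each has measure at most 1/2. The
  -- first is invariant under shifts by `ι H`, so the zero-one law leaves only measure 0.
  let A : Set X := {x | 0 < g x}
  let B : Set X := {x | g x < 0}
  have hA : MeasurableSet A := measurableSet_lt measurable_const hE.measurable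
  have hB : MeasurableSet B := measurableSet_lt hE.measurable measurable_const
  have hAB : μ A = μ B := by
    conv_lhs => rw [← hW.map_neg]
    rw [Measure.map_apply measurable_neg hA]
    refine measure_congr ?_
    filter_upwards [hE.ae_mem] with x hx
    refine propext ?_
    change 0 < g (-x) ↔ g x < 0
    have := hE.map_smul (-1) x hx
    rw [neg_one_smul] at this
    rw [this]
    constructor <;> intro h <;> linarith
  have hle : μ A + μ B ≤ 1 := by
    have hd : Disjoint A B :=
      Set.disjoint_left.2 fun x (h1 : 0 < g x) (h2 : g x < 0) ↦ lt_asymm h1 h2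
    rw [← measure_union hd hB]
    exact prob_le_one
  have hA0 : μ A = 0 := by
    refine (hW.measure_eq_zero_or_one_of_shift_invariant hA fun h ↦ ?_).resolve_right fun h1 ↦ ?_
    · filter_upwards [hE.ae_mem] with x hx
      change 0 < g (x + ι h) ↔ 0 < g x
      rw [hE.map_add x hx _ (hE.embedding_mem h), hE.apply_embedding, inner_zero_left, add_zero]
    · rw [← hAB, h1] at hle
      norm_num at hle
  have hA' : ∀ᵐ x ∂μ, x ∉ A := measure_eq_zero_iff_ae_notMem.1 hA0
  have hB' : ∀ᵐ x ∂μ, x ∉ B := measure_eq_zero_iff_ae_notMem.1 (hAB ▸ hA0)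
  filter_upwards [hA', hB'] with x h1 h2
  exact le_antisymm (not_lt.1 h1) (not_lt.1 h2)

/-- Wiener functionals are unique. -/
lemma ae_eq (hW : IsAbstractWienerSpace ι μ) {h : H} {f g : X → ℝ}
    (hf : IsWienerFunctional ι μ h f) (hg : IsWienerFunctional ι μ h g) : f =ᵐ[μ] g := by
  have := hf.sub hg
  rw [sub_self] at this
  filter_upwards [hW.ae_eq_zero this] with x hx using sub_eq_zero.1 hx

lemma isCenteredGaussian (hW : IsAbstractWienerSpace ι μ) {h : H} {g : X → ℝ}
    (hg : IsWienerFunctional ι μ h g) : IsCenteredGaussian μ g ‖h‖ := by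
  obtain ⟨f, hf, hfl, -⟩ := hW.exists_map_add_eq_withDensity h
  exact ⟨hg.measurable, by rw [← Measure.map_congr (hW.ae_eq hf hg), hfl.2]⟩

lemma exists_isWienerFunctional (hW : IsAbstractWienerSpace ι μ) (h : H) :
    ∃ g : X → ℝ, IsWienerFunctional ι μ h g :=
  (hW.exists_map_add_eq_withDensity h).imp fun _ h ↦ h.1

/-- The covariance of two Wiener functionals. -/
lemma integral_mul (hW : IsAbstractWienerSpace ι μ) {h k : H} {f g : X → ℝ}
    (hf : IsWienerFunctional ι μ h f) (hg : IsWienerFunctional ι μ k g) :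
    ∫ x, f x * g x ∂μ = inner ℝ h k := by
  have h1 := (hW.isCenteredGaussian (hf.add hg))
  have hfg : Integrable (fun x ↦ f x * g x) μ :=
    ((hW.isCenteredGaussian hf).memLp (p := 2) (by simp)).integrable_mul
      ((hW.isCenteredGaussian hg).memLp (p := 2) (by simp))
  have hf2 : Integrable (fun x ↦ f x ^ 2) μ :=
    ((hW.isCenteredGaussian hf).memLp (p := 2) (by simp)).integrable_sq
  have hg2 : Integrable (fun x ↦ g x ^ 2) μ :=
    ((hW.isCenteredGaussian hg).memLp (p := 2) (by simp)).integrable_sq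
  have h2 : ∫ x, (f x + g x) ^ 2 ∂μ
      = ∫ x, f x ^ 2 ∂μ + 2 * ∫ x, f x * g x ∂μ + ∫ x, g x ^ 2 ∂μ := by
    have h3 : Integrable (fun x ↦ f x ^ 2 + 2 * (f x * g x)) μ := hf2.add (hfg.const_mul 2)
    rw [← integral_const_mul, ← integral_add hf2 (hfg.const_mul 2), ← integral_add h3 hg2]
    congr 1
    ext x
    ring
  rw [h1.integral_sq, (hW.isCenteredGaussian hf).integral_sq,
    (hW.isCenteredGaussian hg).integral_sq, norm_add_sq_real] at h2
  linarith

end IsAbstractWienerSpace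
end WienerFunctional

set_option linter.unusedSectionVars false

lemma integral_mul_le_sqrt_mul_sqrt {Ω : Type*} [MeasurableSpace Ω] {P : Measure Ω} {f g : Ω → ℝ}
    (hf : MemLp f 2 P) (hg : MemLp g 2 P) :
    ∫ x, f x * g x ∂P ≤ √(∫ x, f x ^ 2 ∂P) * √(∫ x, g x ^ 2 ∂P) := by
  have h := integral_mul_norm_le_Lp_mul_Lq (μ := P) (f := f) (g := g) (p := 2) (q := 2)
    Real.HolderConjugate.two_two (by simpa using hf) (by simpa using hg)
  simp only [Real.norm_eq_abs, ← abs_mul, Real.rpow_ofNat, sq_abs, ← Real.sqrt_eq_rpow] at h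
  exact (integral_mono (hf.integrable_mul hg) (hf.integrable_mul hg).abs
    fun x ↦ le_abs_self _).trans h

/-! ### Coisometries of `H` and a.e. linear maps of `X`. -/

section Extension

variable {X H : Type*} [NormedAddCommGroup X] [NormedSpace ℝ X] [MeasurableSpace X]
  [NormedAddCommGroup H] [InnerProductSpace ℝ H] {ι : H →L[ℝ] X} {μ : Measure X}
  [CompleteSpace X] [SecondCountableTopology X] [BorelSpace X] [CompleteSpace H]
  {S : H →L[ℝ] H} {T : X → X}

open ContinuousLinearMap in
lemma norm_adjoint_of_comp_adjoint (hS : S ∘L adjoint S = ContinuousLinearMap.id ℝ H) (h : H) :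
    ‖adjoint S h‖ = ‖h‖ := by
  refine (norm_map_iff_adjoint_comp_self (adjoint S)).2 ?_ h
  rw [adjoint_adjoint, hS]
  rfl

namespace IsAELinearExtension

lemma measurable (hT : IsAELinearExtension ι μ S T) : Measurable T :=
  hT.choose_spec.1.measurable

/-- On `ι H` one has `ℓ (T (ι k)) = ⟪S* ι* ℓ, k⟫`. By uniqueness of Wiener functionals, `S` alone
thus determines `ℓ ∘ T` almost everywhere. -/
lemma isWienerFunctional_dual_comp (hT : IsAELinearExtension ι μ S T) (ℓ : StrongDual ℝ X) :
    IsWienerFunctional ι μ (ContinuousLinearMap.adjoint S (dualEmbedding ι ℓ))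
      (fun x ↦ ℓ (T x)) := by
  obtain ⟨E, hE, hι, hS⟩ := hT
  refine ⟨E, ℓ.continuous.measurable.comp hE.measurable, hE.measurableSet, hE.ae_mem, ?_, ?_, hι,
    ?_⟩
  · intro x hx y hy
    rw [hE.map_add x hx y hy, map_add]
  · intro c x hx
    rw [hE.map_smul c x hx, map_smul, smul_eq_mul]
  · intro k
    rw [hS, ContinuousLinearMap.adjoint_inner_left, inner_dualEmbedding]

/-- Since `S*` is an isometry, `ℓ ∘ T` and `ℓ` have the same variance. -/
lemma measurePreserving (hW : IsAbstractWienerSpace ι μ)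
    (hS : S ∘L ContinuousLinearMap.adjoint S = ContinuousLinearMap.id ℝ H)
    (hT : IsAELinearExtension ι μ S T) : MeasurePreserving T μ μ := by
  have := hW.isProbabilityMeasure
  refine ⟨hT.measurable, ?_⟩
  have : IsProbabilityMeasure (μ.map T) :=
    Measure.isProbabilityMeasure_map hT.measurable.aemeasurable
  refine (measure_ext_of_integral_exp_dual
    (fun ℓ ↦ (hW.isCenteredGaussian_dual ℓ).integrable_exp) fun ℓ ↦ ?_).symm
  rw [integral_map hT.measurable.aemeasurable (by fun_prop), hW.integral_exp_dual,
    (hW.isCenteredGaussian (hT.isWienerFunctional_dual_comp ℓ)).integral_exp,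
    norm_adjoint_of_comp_adjoint hS]

lemma isWienerFunctional_comp (hT : IsAELinearExtension ι μ S T) (hTμ : MeasurePreserving T μ μ)
    {h : H} {g : X → ℝ} (hg : IsWienerFunctional ι μ h g) :
    IsWienerFunctional ι μ (ContinuousLinearMap.adjoint S h) (fun x ↦ g (T x)) := by
  obtain ⟨E, hE, hι, hS⟩ := hT
  obtain ⟨F, hF⟩ := hg
  have hE0 : T 0 = 0 := by simpa using hE.map_smul 0 0 E.zero_mem
  -- Linearity of the composite holds on `E ∩ T⁻¹ F`, which has full measure because `T` preserves
  -- `μ`.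
  let G : Submodule ℝ X :=
    { carrier := {x | x ∈ E ∧ T x ∈ F}
      add_mem' := by
        rintro x y ⟨hx, hx'⟩ ⟨hy, hy'⟩
        exact ⟨E.add_mem hx hy, by rw [hE.map_add x hx y hy]; exact F.add_mem hx' hy'⟩
      zero_mem' := ⟨E.zero_mem, by rw [hE0]; exact F.zero_mem⟩
      smul_mem' := by
        rintro c x ⟨hx, hx'⟩
        exact ⟨E.smul_mem c hx, by rw [hE.map_smul c x hx]; exact F.smul_mem c hx'⟩ }
  refine ⟨G, hF.measurable.comp hE.measurable,
    hE.measurableSet.inter (hE.measurable hF.measurableSet), ?_, ?_, ?_, ?_, ?_⟩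
  · filter_upwards [hE.ae_mem, hTμ.quasiMeasurePreserving.ae hF.ae_mem] with x h1 h2 using ⟨h1, h2⟩
  · intro x hx y hy
    rw [hE.map_add x hx.1 y hy.1, hF.map_add _ hx.2 _ hy.2]
  · intro c x hx
    rw [hE.map_smul c x hx.1, hF.map_smul c _ hx.2]
  · exact fun k ↦ ⟨hι k, by rw [hS]; exact hF.embedding_mem _⟩
  · intro k
    rw [hS, hF.apply_embedding, ContinuousLinearMap.adjoint_inner_left]

lemma isWienerFunctional_iterate (hT : IsAELinearExtension ι μ S T)
    (hTμ : MeasurePreserving T μ μ) {h : H} {g : X → ℝ} (hg : IsWienerFunctional ι μ h g) (N : ℕ) :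
    IsWienerFunctional ι μ ((ContinuousLinearMap.adjoint S ^ N) h) (fun x ↦ g (T^[N] x)) := by
  induction N with
  | zero => simpa using hg
  | succ N ih =>
    simpa [pow_succ', Function.iterate_succ_apply] using hT.isWienerFunctional_comp hTμ ih

end IsAELinearExtension

/-- Lindelöf, applied to the cover of `X ∖ {0}` by the open sets `{ℓ ≠ 0}`. -/
lemma exists_countable_separating_dual (X : Type*) [NormedAddCommGroup X] [NormedSpace ℝ X]
    [SecondCountableTopology X] :
    ∃ D : Set (StrongDual ℝ X), D.Countable ∧ ∀ x y : X, (∀ ℓ ∈ D, ℓ x = ℓ y) → x = y := by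
  obtain ⟨D, hD, hU⟩ := TopologicalSpace.isOpen_iUnion_countable
    (fun ℓ : StrongDual ℝ X ↦ {x : X | ℓ x ≠ 0})
    (fun ℓ ↦ isOpen_ne_fun ℓ.continuous continuous_const)
  refine ⟨D, hD, fun x y hxy ↦ ?_⟩
  by_contra hne
  obtain ⟨ℓ, hℓ⟩ := exists_dual_ne_zero (sub_ne_zero.2 hne)
  have : x - y ∈ ⋃ ℓ ∈ D, {x : X | ℓ x ≠ 0} := by
    rw [hU]
    exact Set.mem_iUnion.2 ⟨ℓ, hℓ⟩
  obtain ⟨m, hm, hm'⟩ := Set.mem_iUnion₂.1 this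
  exact hm' (by rw [map_sub, hxy m hm, sub_self])

/-- Wiener functionals are jointly Gaussian. -/
lemma IsAbstractWienerSpace.isCenteredGaussian_dual_pi (hW : IsAbstractWienerSpace ι μ)
    {κ : Type*} [Fintype κ] [DecidableEq κ] {h : κ → H} {f : κ → X → ℝ}
    (hf : ∀ i, IsWienerFunctional ι μ (h i) (f i)) (L : StrongDual ℝ (κ → ℝ)) :
    IsCenteredGaussian μ (fun x ↦ L (fun i ↦ f i x)) ‖∑ i, L (Pi.single i 1) • h i‖ := by
  have hL (x : X) : L (fun i ↦ f i x) = ∑ i, L (Pi.single i 1) * f i x := by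
    conv_lhs => rw [← ContinuousLinearMap.coe_coe, LinearMap.pi_apply_eq_sum_univ]
    refine Finset.sum_congr rfl fun i _ ↦ ?_
    have h1 : (fun j ↦ if i = j then (1 : ℝ) else 0) = Pi.single i 1 := by
      ext j
      simp [Pi.single_apply, eq_comm]
    rw [smul_eq_mul, mul_comm, h1]
    rfl
  simp_rw [hL]
  exact hW.isCenteredGaussian
    (IsWienerFunctional.sum _ fun i _ ↦ (hf i).const_mul (L (Pi.single i 1)))

/-- Families of Wiener functionals with the same covariances have the same law. -/
lemma IsAbstractWienerSpace.map_eq_map_of_norm_eq (hW : IsAbstractWienerSpace ι μ) {κ : Type*}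
    {h k : κ → H} {f g : κ → X → ℝ} (hf : ∀ i, IsWienerFunctional ι μ (h i) (f i))
    (hg : ∀ i, IsWienerFunctional ι μ (k i) (g i))
    (hhk : ∀ (s : Finset κ) (c : κ → ℝ), ‖∑ i ∈ s, c i • h i‖ = ‖∑ i ∈ s, c i • k i‖) :
    μ.map (fun x i ↦ f i x) = μ.map (fun x i ↦ g i x) := by
  classical
  have := hW.isProbabilityMeasure
  have hfm : Measurable fun x i ↦ f i x := measurable_pi_lambda _ fun i ↦ (hf i).measurable
  have hgm : Measurable fun x i ↦ g i x := measurable_pi_lambda _ fun i ↦ (hg i).measurable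
  have : IsProbabilityMeasure (μ.map fun x i ↦ f i x) :=
    Measure.isProbabilityMeasure_map hfm.aemeasurable
  have : IsProbabilityMeasure (μ.map fun x i ↦ g i x) :=
    Measure.isProbabilityMeasure_map hgm.aemeasurable
  refine IsProjectiveLimit.unique (P := fun J ↦ (μ.map fun x i ↦ f i x).map J.restrict)
    (fun _ ↦ rfl) fun J ↦ ?_
  have hexp {h : κ → H} {f : κ → X → ℝ} (hf : ∀ i, IsWienerFunctional ι μ (h i) (f i))
      (L : StrongDual ℝ (J → ℝ)) :
      IsCenteredGaussian μ (fun x ↦ L (fun i : J ↦ f i x))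
        ‖∑ i : J, L (Pi.single i 1) • h i‖ :=
    hW.isCenteredGaussian_dual_pi (fun i : J ↦ hf i) L
  have hJ : Measurable (J.restrict (π := fun _ ↦ ℝ)) := Finset.measurable_restrict J
  change (μ.map fun x i ↦ g i x).map J.restrict = (μ.map fun x i ↦ f i x).map J.restrict
  rw [Measure.map_map hJ hfm, Measure.map_map hJ hgm]
  have hJf := (hJ.comp hfm).aemeasurable (μ := μ)
  have hJg := (hJ.comp hgm).aemeasurable (μ := μ)
  have : IsProbabilityMeasure (μ.map (J.restrict ∘ fun x i ↦ f i x)) :=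
    Measure.isProbabilityMeasure_map hJf
  have : IsProbabilityMeasure (μ.map (J.restrict ∘ fun x i ↦ g i x)) :=
    Measure.isProbabilityMeasure_map hJg
  refine measure_ext_of_integral_exp_dual (fun L ↦ ?_) fun L ↦ ?_
  · rw [integrable_map_measure (by fun_prop) hJg]
    exact (hexp hg L).integrable_exp
  · rw [integral_map hJg (by fun_prop), integral_map hJf (by fun_prop)]
    refine (hexp hg L).integral_exp.trans (Eq.trans ?_ (hexp hf L).integral_exp.symm)
    have h1 (h : κ → H) : ∑ i : J, L (Pi.single i 1) • h i
        = ∑ i ∈ J, (if hi : i ∈ J then L (Pi.single ⟨i, hi⟩ 1) else 0) • h i := by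
      rw [← Finset.sum_attach J]
      refine Finset.sum_congr rfl fun i _ ↦ ?_
      simp
    rw [h1 h, h1 k, hhk]

/-- A coisometry of `H` has a measurable a.e. linear extension to `X`. -/
lemma exists_isAELinearExtension (hW : IsAbstractWienerSpace ι μ)
    (hS : S ∘L ContinuousLinearMap.adjoint S = ContinuousLinearMap.id ℝ H) :
    ∃ T : X → X, IsAELinearExtension ι μ S T := by
  have := hW.isProbabilityMeasure
  obtain ⟨D, hD, hsep⟩ := exists_countable_separating_dual X
  have : Countable D := hD.to_subtype
  -- The point `T x` must satisfy `ℓ (T x) = w ℓ x` for `ℓ` in `D`, that is, `φ (T x) = Ψ x`. As an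
  -- injective Borel map on a Polish space, `φ` has a measurable left inverse `ρ`, and `T = ρ ∘ Ψ`.
  -- Such a point exists for a.e. `x` because `Ψ` and `φ` have the same law, `S*` being isometric.
  let φ : X → D → ℝ := fun x ℓ ↦ (ℓ : StrongDual ℝ X) x
  have hφm : Measurable φ := measurable_pi_lambda _ fun ℓ ↦ ℓ.1.continuous.measurable
  have hφi : Function.Injective φ := fun x y hxy ↦ hsep x y fun ℓ hℓ ↦ congrFun hxy ⟨ℓ, hℓ⟩
  have : PolishSpace X := inferInstance
  have hφ : MeasurableEmbedding φ := hφm.measurableEmbedding hφi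
  obtain ⟨ρ, hρm, hρ⟩ := hφ.exists_measurable_extend measurable_id (fun _ ↦ ⟨(0 : X)⟩)
  choose w hw using fun ℓ : D ↦ hW.exists_isWienerFunctional
    (ContinuousLinearMap.adjoint S (dualEmbedding ι (ℓ : StrongDual ℝ X)))
  choose F hF using hw
  let Ψ : X → D → ℝ := fun x ℓ ↦ w ℓ x
  have hΨm : Measurable Ψ := measurable_pi_lambda _ fun ℓ ↦ (hF ℓ).measurable
  have hlaw : μ.map Ψ = μ.map φ := by
    refine hW.map_eq_map_of_norm_eq (fun ℓ : D ↦ ⟨F ℓ, hF ℓ⟩)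
      (fun ℓ : D ↦ IsWienerFunctional.dual (ι := ι) (μ := μ) (ℓ : StrongDual ℝ X)) fun s c ↦ ?_
    simp_rw [← map_smul (ContinuousLinearMap.adjoint S)]
    rw [← map_sum, norm_adjoint_of_comp_adjoint hS]
  have hrange : ∀ᵐ x ∂μ, Ψ x ∈ Set.range φ := by
    have h1 : ∀ᵐ y ∂(μ.map φ), y ∈ Set.range φ :=
      (ae_map_iff (p := fun y ↦ y ∈ Set.range φ) hφm.aemeasurable hφ.measurableSet_range).2
        (ae_of_all _ fun x ↦ ⟨x, rfl⟩)
    rw [← hlaw] at h1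
    exact (ae_map_iff (p := fun y ↦ y ∈ Set.range φ) hΨm.aemeasurable
      hφ.measurableSet_range).1 h1
  have hρφ (x : X) : ρ (φ x) = x := congrFun hρ x
  have hT {x z : X} (h : φ z = Ψ x) : ρ (Ψ x) = z := by rw [← h, hρφ]
  have hadd {x y a b : X} (hx : ∀ ℓ, x ∈ F ℓ) (hy : ∀ ℓ, y ∈ F ℓ) (ha : φ a = Ψ x)
      (hb : φ b = Ψ y) : φ (a + b) = Ψ (x + y) := by
    ext ℓ
    have h1 := congrFun ha ℓ
    have h2 := congrFun hb ℓ
    simp only [φ, Ψ] at h1 h2 ⊢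
    rw [(hF ℓ).map_add x (hx ℓ) y (hy ℓ), map_add, h1, h2]
  have hsmul (c : ℝ) {x a : X} (hx : ∀ ℓ, x ∈ F ℓ) (ha : φ a = Ψ x) : φ (c • a) = Ψ (c • x) := by
    ext ℓ
    have h1 := congrFun ha ℓ
    simp only [φ, Ψ] at h1 ⊢
    rw [(hF ℓ).map_smul c x (hx ℓ), map_smul, h1, smul_eq_mul]
  let E : Submodule ℝ X :=
    { carrier := {x | (∀ ℓ, x ∈ F ℓ) ∧ Ψ x ∈ Set.range φ}
      add_mem' := by
        rintro x y ⟨hx, a, ha⟩ ⟨hy, b, hb⟩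
        exact ⟨fun ℓ ↦ (F ℓ).add_mem (hx ℓ) (hy ℓ), a + b, hadd hx hy ha hb⟩
      zero_mem' := by
        refine ⟨fun ℓ ↦ (F ℓ).zero_mem, 0, ?_⟩
        ext ℓ
        simpa [φ, Ψ] using ((hF ℓ).map_smul 0 0 (F ℓ).zero_mem).symm
      smul_mem' := by
        rintro c x ⟨hx, a, ha⟩
        exact ⟨fun ℓ ↦ (F ℓ).smul_mem c (hx ℓ), c • a, hsmul c hx ha⟩ }
  have hι (h : H) : φ (ι (S h)) = Ψ (ι h) := by
    ext ℓ
    simp only [φ, Ψ]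
    rw [(hF ℓ).apply_embedding, ContinuousLinearMap.adjoint_inner_left, inner_dualEmbedding]
  refine ⟨ρ ∘ Ψ, E, ⟨hρm.comp hΨm, ?_, ?_, ?_, ?_⟩, fun h ↦ ?_, fun h ↦ hT (hι h)⟩
  · have : (E : Set X) = (⋂ ℓ, (F ℓ : Set X)) ∩ Ψ ⁻¹' Set.range φ := by
      ext x
      simp [E]
    rw [this]
    exact (MeasurableSet.iInter fun ℓ ↦ (hF ℓ).measurableSet).inter
      (hΨm hφ.measurableSet_range)
  · filter_upwards [ae_all_iff.2 fun ℓ ↦ (hF ℓ).ae_mem, hrange] with x h1 h2 using ⟨h1, h2⟩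
  · rintro x ⟨hx, a, ha⟩ y ⟨hy, b, hb⟩
    simp only [Function.comp_apply]
    rw [hT ha, hT hb, hT (hadd hx hy ha hb)]
  · rintro c x ⟨hx, a, ha⟩
    simp only [Function.comp_apply]
    rw [hT ha, hT (hsmul c hx ha)]
  · exact ⟨fun ℓ ↦ (hF ℓ).embedding_mem h, _, hι h⟩

/-! ### Measure-preserving a.e. linear maps are extensions of coisometries -/

/-- The law of `x + ι h` is absolutely continuous, so some `x` has both `x` and `x + ι h` in `E`;
subtract. -/
lemma IsAbstractWienerSpace.embedding_mem (hW : IsAbstractWienerSpace ι μ) {E : Submodule ℝ X}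
    (hE : MeasurableSet (E : Set X)) (hEμ : ∀ᵐ x ∂μ, x ∈ E) (h : H) : ι h ∈ E := by
  have := hW.isProbabilityMeasure
  obtain ⟨g, -, -, hcm⟩ := hW.exists_map_add_eq_withDensity h
  have hmt : Measurable fun x ↦ x + ι h := measurable_id.add_const _
  have h1 : ∀ᵐ x ∂μ.map (· + ι h), x ∈ E := by
    rw [hcm]
    exact (withDensity_absolutelyContinuous μ _).ae_le hEμ
  replace h1 := (ae_map_iff (p := fun x ↦ x ∈ E) hmt.aemeasurable hE).1 h1
  obtain ⟨x, hx, hx'⟩ := (hEμ.and h1).exists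
  simpa using E.sub_mem hx' hx

/-- The left side is the mean of `ℓ (T (x + ι h))`, which the Cameron-Martin formula writes as an
integral of `ℓ ∘ T` against a density. Cauchy-Schwarz concludes: the density has `L²` norm `exp
(‖h‖² / 2)`, and `ℓ ∘ T` has the law of `ℓ`. -/
lemma IsAELinearOn.dual_apply_embedding_le (hW : IsAbstractWienerSpace ι μ) {E : Submodule ℝ X}
    (hT : IsAELinearOn μ T E) (hTμ : MeasurePreserving T μ μ) (ℓ : StrongDual ℝ X) (h : H) :
    ℓ (T (ι h)) ≤ Real.exp (‖h‖ ^ 2 / 2) * ‖dualEmbedding ι ℓ‖ := by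
  have := hW.isProbabilityMeasure
  obtain ⟨g, -, hgl, hcm⟩ := hW.exists_map_add_eq_withDensity h
  have hmt : Measurable fun x ↦ x + ι h := measurable_id.add_const _
  have hh := hW.embedding_mem hT.measurableSet hT.ae_mem h
  have hℓT : IsCenteredGaussian μ (fun x ↦ ℓ (T x)) ‖dualEmbedding ι ℓ‖ := by
    have h1 := hW.isCenteredGaussian_dual ℓ
    refine ⟨ℓ.continuous.measurable.comp hT.measurable, ?_⟩
    rw [← h1.2]
    conv_rhs => rw [← hTμ.map_eq]
    rw [Measure.map_map h1.1 hT.measurable]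
    rfl
  have hdm : Measurable fun x ↦ Real.exp (g x - ‖h‖ ^ 2 / 2) := (hgl.1.sub_const _).exp
  have hd2 (x : X) : Real.exp (g x - ‖h‖ ^ 2 / 2) ^ 2
      = Real.exp (2 * g x) * Real.exp (-‖h‖ ^ 2) := by
    rw [← Real.exp_nat_mul, ← Real.exp_add]
    congr 1
    push_cast
    ring
  have hdL : MemLp (fun x ↦ Real.exp (g x - ‖h‖ ^ 2 / 2)) 2 μ := by
    rw [memLp_two_iff_integrable_sq hdm.aestronglyMeasurable]
    simp_rw [hd2]
    exact (hgl.integrable_exp_mul 2).mul_const _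
  have e1 : ∫ x, ℓ (T (x + ι h)) ∂μ = ℓ (T (ι h)) := by
    have : ∫ x, ℓ (T (x + ι h)) ∂μ = ∫ x, (ℓ (T x) + ℓ (T (ι h))) ∂μ := by
      refine integral_congr_ae ?_
      filter_upwards [hT.ae_mem] with x hx
      rw [hT.map_add x hx _ hh, _root_.map_add]
    rw [this, integral_add ((hℓT.memLp (p := 1) (by simp)).integrable le_rfl)
      (integrable_const _), hℓT.integral_eq_zero]
    simp
  have e2 : ∫ x, ℓ (T (x + ι h)) ∂μ = ∫ x, Real.exp (g x - ‖h‖ ^ 2 / 2) * ℓ (T x) ∂μ := by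
    have h3 := integral_map (μ := μ) hmt.aemeasurable (f := fun x ↦ ℓ (T x))
      hℓT.1.aestronglyMeasurable
    rw [← h3, hcm, integral_withDensity_eq_integral_toReal_smul
      hdm.ennreal_ofReal (ae_of_all _ fun _ ↦ ENNReal.ofReal_lt_top)]
    simp_rw [ENNReal.toReal_ofReal (Real.exp_pos _).le, smul_eq_mul]
  rw [← e1, e2]
  refine (integral_mul_le_sqrt_mul_sqrt hdL (hℓT.memLp (by simp))).trans (le_of_eq ?_)
  rw [hℓT.integral_sq, Real.sqrt_sq (norm_nonneg _)]
  congr 1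
  simp_rw [hd2]
  rw [integral_mul_const, hgl.mgf_eq, ← Real.exp_add, ← Real.exp_half]
  congr 1
  ring

/-- A measure-preserving a.e. linear map of `X` is an extension of an operator `S` on `H` such that
`S S* = I`. -/
lemma IsMeasurePreservingAELinear.exists_isAELinearExtension (hW : IsAbstractWienerSpace ι μ)
    (hT : IsMeasurePreservingAELinear μ T) :
    ∃ S : H →L[ℝ] H, S ∘L ContinuousLinearMap.adjoint S = ContinuousLinearMap.id ℝ H ∧
      IsAELinearExtension ι μ S T := by
  obtain ⟨⟨E, hE⟩, hTμ⟩ := hT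
  have hι := hW.embedding_mem hE.measurableSet hE.ae_mem
  choose S₀ hS₀n hS₀ using fun h : H ↦ exists_mem_of_forall_dual_le (ι := ι) (y := T (ι h))
    (Real.exp_pos (‖h‖ ^ 2 / 2)).le fun ℓ ↦ hE.dual_apply_embedding_le hW hTμ ℓ h
  let S₁ : H →ₗ[ℝ] H :=
    { toFun := S₀
      map_add' := fun x y ↦ hW.injective (by
        rw [map_add, hS₀, hS₀, hS₀, map_add, hE.map_add _ (hι x) _ (hι y)])
      map_smul' := fun c x ↦ hW.injective (by
        rw [map_smul, hS₀, hS₀, map_smul, hE.map_smul _ _ (hι x)]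
        rfl) }
  -- The exponential bound is used on unit vectors only, and homogeneity does the rest.
  have hS₁ : ∃ C, ∀ x, ‖S₁ x‖ ≤ C * ‖x‖ := by
    refine ⟨Real.exp (1 / 2), fun x ↦ ?_⟩
    by_cases hx : x = 0
    · simp [hx]
    have hx' : ‖x‖ ≠ 0 := norm_ne_zero_iff.2 hx
    have h1 : ‖S₁ (‖x‖⁻¹ • x)‖ ≤ Real.exp (1 / 2) := by
      have := hS₀n (‖x‖⁻¹ • x)
      rwa [norm_smul, norm_inv, norm_norm, inv_mul_cancel₀ hx', one_pow] at this
    rw [map_smul, norm_smul, norm_inv, norm_norm] at h1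
    rwa [inv_mul_le_iff₀ (by positivity), mul_comm] at h1
  let S : H →L[ℝ] H := S₁.mkContinuousOfExistsBound hS₁
  have hext : IsAELinearExtension ι μ S T := ⟨E, hE, hι, fun h ↦ (hS₀ h).symm⟩
  refine ⟨S, ?_, hext⟩
  -- On the dense range of `ι*` this compares the variances of `ℓ ∘ T` and of `ℓ`.
  have hn : ∀ h : H, ‖ContinuousLinearMap.adjoint S h‖ = ‖h‖ := by
    refine (dense_range_dualEmbedding hW.injective).induction ?_
      (isClosed_eq (by fun_prop) (by fun_prop))
    rintro _ ⟨ℓ, rfl⟩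
    have h1 := (hW.isCenteredGaussian (hext.isWienerFunctional_dual_comp ℓ)).integral_sq
    have h2 := (hW.isCenteredGaussian_dual ℓ).integral_sq
    have h3 := integral_map (μ := μ) hE.measurable.aemeasurable (f := fun x ↦ ℓ x ^ 2)
      (by fun_prop)
    rw [hTμ.map_eq] at h3
    rw [← h3, h2] at h1
    exact ((sq_eq_sq₀ (norm_nonneg _) (norm_nonneg _)).1 h1).symm
  have := (ContinuousLinearMap.norm_map_iff_adjoint_comp_self (ContinuousLinearMap.adjoint S)).1 hn
  rwa [ContinuousLinearMap.adjoint_adjoint] at this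

end Extension

set_option linter.unusedSectionVars false

/-! ## Almost sure upper bounds -/

/-- A Borel-Cantelli lemma for events with polynomially decaying probabilities. -/
lemma ae_eventually_notMem_of_le_rpow {Ω : Type*} [MeasurableSpace Ω] {P : Measure Ω}
    [IsFiniteMeasure P] {s : ℕ → Set Ω} {C p : ℝ} (hp : 1 < p)
    (h : ∀ᶠ N : ℕ in atTop, P.real (s N) ≤ C * ((N : ℝ) ^ p)⁻¹) :
    ∀ᵐ x ∂P, ∀ᶠ N in atTop, x ∉ s N := by
  have hs : Summable fun N ↦ P.real (s N) :=
    Summable.of_norm_bounded_eventually_nat ((Real.summable_nat_rpow_inv.2 hp).mul_left C)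
      (h.mono fun N hN ↦ by rwa [Real.norm_of_nonneg measureReal_nonneg])
  refine ae_eventually_notMem ?_
  have h1 (N : ℕ) : P (s N) = ENNReal.ofReal (P.real (s N)) := by simp
  simp_rw [h1]
  exact hs.tsum_ofReal_ne_top

lemma exp_neg_mul_log_eq (N : ℕ) (hN : 1 ≤ N) (p : ℝ) :
    Real.exp (-(p * Real.log N)) = ((N : ℝ) ^ p)⁻¹ := by
  have : (0 : ℝ) < N := by exact_mod_cast hN
  rw [Real.rpow_def_of_pos this, ← Real.exp_neg, mul_comm]

lemma sq_mul_sqrt_two_log (N : ℕ) (c : ℝ) :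
    (c * √(2 * Real.log N)) ^ 2 = c ^ 2 * (2 * Real.log N) := by
  rw [mul_pow, Real.sq_sqrt (mul_nonneg zero_le_two (Real.log_natCast_nonneg N))]

lemma IsCenteredGaussian.tail_abs {Ω : Type*} [MeasurableSpace Ω] {P : Measure Ω}
    [IsProbabilityMeasure P] {g : Ω → ℝ} {τ σ : ℝ} (hg : IsCenteredGaussian P g τ)
    (hτ : |τ| ≤ σ) {t : ℝ} (ht : 0 ≤ t) :
    P.real {x | t ≤ |g x|} ≤ 2 * Real.exp (-t ^ 2 / (2 * σ ^ 2)) := by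
  have key {g : Ω → ℝ} (hg : IsCenteredGaussian P g τ) :
      P.real {x | t ≤ g x} ≤ Real.exp (-t ^ 2 / (2 * σ ^ 2)) :=
    hg.tail (sq_le_sq.2 (hτ.trans (le_abs_self σ))) ht
  have hneg : IsCenteredGaussian P (fun x ↦ -g x) τ := by
    have := hg.const_mul (-1)
    simpa [IsCenteredGaussian] using this
  have hsub : {x | t ≤ |g x|} ⊆ {x | t ≤ g x} ∪ {x | t ≤ -g x} :=
    fun x hx ↦ le_abs.1 (show t ≤ |g x| from hx)
  have := (measureReal_mono hsub).trans (measureReal_union_le (μ := P) _ _)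
  linarith [key hg, key hneg]

/-- The exceptional events have probability at most `2 N^(-p)` with `p > 1`. Only the first
Borel-Cantelli lemma is involved, so the joint law of the `g N` is irrelevant. -/
lemma ae_eventually_abs_le {Ω : Type*} [MeasurableSpace Ω] {P : Measure Ω}
    [IsProbabilityMeasure P] {g : ℕ → Ω → ℝ} {τ : ℕ → ℝ} {σ σ' : ℝ}
    (hg : ∀ N, IsCenteredGaussian P (g N) (τ N)) (hτ : ∀ N, |τ N| ≤ σ) (hσ : σ < σ') :
    ∀ᵐ x ∂P, ∀ᶠ N : ℕ in atTop, |g N x| ≤ σ' * √(2 * Real.log N) := by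
  have hσ0 : 0 ≤ σ := (abs_nonneg _).trans (hτ 0)
  -- The midpoint replaces `σ`, which may be 0 and could not be divided by.
  set ρ := (σ + σ') / 2 with hρ
  have hρ0 : 0 < ρ := by linarith
  have hρ' : ρ < σ' := by linarith
  have h1 : ∀ᵐ x ∂P, ∀ᶠ N : ℕ in atTop, x ∉ {x | σ' * √(2 * Real.log N) ≤ |g N x|} := by
    refine ae_eventually_notMem_of_le_rpow (C := 2) (p := σ' ^ 2 / ρ ^ 2) ?_ ?_
    · rw [one_lt_div (by positivity)]
      gcongr
    · filter_upwards [eventually_ge_atTop 1] with N hN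
      refine ((hg N).tail_abs ((hτ N).trans (by linarith : σ ≤ ρ)) (by
        have := hρ0.trans hρ'; positivity)).trans (le_of_eq ?_)
      rw [← exp_neg_mul_log_eq N hN, sq_mul_sqrt_two_log]
      congr 2
      field_simp
  filter_upwards [h1] with x hx
  filter_upwards [hx] with N hN
  exact (not_le.1 hN).le

/-! ## Fernique's theorem for distances to subspaces -/

section Fernique

variable {X : Type*} [NormedAddCommGroup X] [NormedSpace ℝ X] [MeasurableSpace X]
  [SecondCountableTopology X] [BorelSpace X] {μ : Measure X}

lemma secondCountableTopology_quotient (F : Submodule ℝ X) : SecondCountableTopology (X ⧸ F) :=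
  F.isOpenQuotientMap_mkQ.isQuotientMap.secondCountableTopology F.isOpenQuotientMap_mkQ.isOpenMap

/-- Fernique's theorem for the quotient seminorms. -/
lemma exists_fernique_quotient [IsProbabilityMeasure μ]
    (hrot : (μ.prod μ).map (ContinuousLinearMap.rotation (-(Real.pi / 4))) = μ.prod μ) :
    ∃ K M : ℝ, 0 < K ∧ 0 ≤ M ∧ ∀ (F : Submodule ℝ X) (a : ℝ), 0 < a →
      ENNReal.ofReal (3 / 4) ≤ μ {x | ‖F.mkQ x‖ ≤ a} →
      ∀ t : ℝ, 0 ≤ t → μ.real {x | t ≤ ‖F.mkQ x‖} ≤ M * Real.exp (-(K / a ^ 2 * t ^ 2)) := by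
  -- Any level strictly between 1/2 and 1 would do. The constants depend on this level only, so the
  -- rate `K / a²` can be made large by choosing `F` with small `a`.
  set c := ENNReal.ofReal (3 / 4) with hc
  have hc1 : c < 1 := by
    rw [hc, ← ENNReal.ofReal_one]
    exact (ENNReal.ofReal_lt_ofReal_iff (by norm_num)).2 (by norm_num)
  have hc2 : 2⁻¹ < c := by
    have : (2 : ENNReal)⁻¹ = ENNReal.ofReal (1 / 2) := by
      rw [one_div, ENNReal.ofReal_inv_of_pos (by norm_num)]
      simp
    rw [this]
    exact (ENNReal.ofReal_lt_ofReal_iff (by norm_num)).2 (by norm_num)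
  have hc3 : (c / (1 - c)).toReal = 3 := by
    rw [ENNReal.toReal_div, ENNReal.toReal_sub_of_le hc1.le ENNReal.one_ne_top, hc,
      ENNReal.toReal_ofReal (by norm_num), ENNReal.toReal_one]
    norm_num
  set C : ENNReal := .ofReal (Real.exp (Fernique.logRatio c))
    + ∑' n, .ofReal (Real.exp (-2⁻¹ * Real.log (c / (1 - c)).toReal * 2 ^ n)) with hC
  have hCtop : C ≠ ⊤ := by
    refine ENNReal.add_ne_top.2 ⟨ENNReal.ofReal_ne_top, ?_⟩
    refine Summable.tsum_ofReal_ne_top <|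
      Real.summable_exp_nat_mul_of_ge ?_ (fun i ↦ mod_cast (Nat.lt_pow_self (by simp)).le)
    rw [hc3]
    exact mul_neg_of_neg_of_pos (by norm_num) (Real.log_pos (by norm_num))
  refine ⟨Fernique.logRatio c, C.toReal, Fernique.logRatio_pos hc2 hc1, ENNReal.toReal_nonneg,
    fun F a ha hF t ht ↦ ?_⟩
  have := secondCountableTopology_quotient F
  let : MeasurableSpace (X ⧸ F) := borel _
  have : BorelSpace (X ⧸ F) := ⟨rfl⟩
  let q : X →L[ℝ] X ⧸ F := F.mkQL
  have hq : Measurable q := q.continuous.measurable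
  have : IsProbabilityMeasure (μ.map q) := Measure.isProbabilityMeasure_map hq.aemeasurable
  -- Rotations commute with the linear map `q × q`, so the image measure inherits the invariance.
  have hrot' : ((μ.map q).prod (μ.map q)).map (ContinuousLinearMap.rotation (-(Real.pi / 4)))
      = (μ.map q).prod (μ.map q) := by
    rw [Measure.map_prod_map μ μ hq hq]
    conv_rhs => rw [← hrot]
    rw [Measure.map_map (by fun_prop) (by fun_prop), Measure.map_map (by fun_prop) (by fun_prop)]
    congr 1
  have hcμ : c ≤ μ.map q {y | ‖y‖ ≤ a} := by
    rw [Measure.map_apply hq (measurableSet_le (by fun_prop) (by fun_prop))]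
    exact hF
  have hint := lintegral_exp_mul_sq_norm_le_of_map_rotation_eq_self hrot' hcμ hc2
  rw [← hC, lintegral_map (by fun_prop) hq] at hint
  have hmarkov := mul_meas_ge_le_lintegral (μ := μ)
    (f := fun x ↦ ENNReal.ofReal (Real.exp (Fernique.logRatio c * a⁻¹ ^ 2 * ‖q x‖ ^ 2)))
    (by fun_prop) (ENNReal.ofReal (Real.exp (Fernique.logRatio c * a⁻¹ ^ 2 * t ^ 2)))
  have hK := (Fernique.logRatio_pos hc2 hc1).le
  have hsub : {x | t ≤ ‖F.mkQ x‖} ⊆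
      {x | ENNReal.ofReal (Real.exp (Fernique.logRatio c * a⁻¹ ^ 2 * t ^ 2))
        ≤ ENNReal.ofReal (Real.exp (Fernique.logRatio c * a⁻¹ ^ 2 * ‖q x‖ ^ 2))} := by
    intro x (hx : t ≤ ‖q x‖)
    refine ENNReal.ofReal_le_ofReal (Real.exp_le_exp.2 ?_)
    gcongr
  have h1 := ENNReal.toReal_mono hCtop
    (((mul_le_mul_right (measure_mono hsub) _).trans hmarkov).trans hint)
  rw [ENNReal.toReal_mul, ENNReal.toReal_ofReal (Real.exp_pos _).le, mul_comm,
    ← le_div_iff₀ (Real.exp_pos _), div_eq_mul_inv, ← Real.exp_neg] at h1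
  refine h1.trans (le_of_eq ?_)
  rw [inv_pow, div_eq_mul_inv]

/-- Finite unions of `a`-balls around a dense sequence exhaust `X`, and each such ball lies within
`a` of the span of the centers. -/
lemma exists_finiteDimensional_norm_mkQ_le [IsProbabilityMeasure μ] {a : ℝ} (ha : 0 < a) :
    ∃ F : Submodule ℝ X, FiniteDimensional ℝ F ∧
      ENNReal.ofReal (3 / 4) ≤ μ {x | ‖F.mkQ x‖ ≤ a} := by
  let u := TopologicalSpace.denseSeq X
  let F : ℕ → Submodule ℝ X := fun n ↦ Submodule.span ℝ (u '' Set.Iio n)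
  have hmem {n i : ℕ} (hi : i < n) : u i ∈ F n := Submodule.subset_span ⟨i, hi, rfl⟩
  let s : ℕ → Set X := fun n ↦ {x | ∃ i < n, ‖x - u i‖ ≤ a}
  have hs : Monotone s := fun m n hmn x ⟨i, hi, hx⟩ ↦ ⟨i, hi.trans_le hmn, hx⟩
  have hU : ⋃ n, s n = Set.univ := by
    refine Set.eq_univ_of_forall fun x ↦ ?_
    obtain ⟨i, hi⟩ := (TopologicalSpace.denseRange_denseSeq X).exists_dist_lt x ha
    exact Set.mem_iUnion.2 ⟨i + 1, i, i.lt_succ_self, by rw [← dist_eq_norm]; exact hi.le⟩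
  have hlim := tendsto_measure_iUnion_atTop (μ := μ) hs
  rw [hU, measure_univ] at hlim
  have h1 : ENNReal.ofReal (3 / 4) < 1 := by
    rw [← ENNReal.ofReal_one]
    exact (ENNReal.ofReal_lt_ofReal_iff (by norm_num)).2 (by norm_num)
  obtain ⟨n, hn⟩ := (hlim.eventually (lt_mem_nhds h1)).exists
  refine ⟨F n, FiniteDimensional.span_of_finite ℝ ((Set.finite_Iio n).image u),
    hn.le.trans (measure_mono ?_)⟩
  rintro x ⟨i, hi, hx⟩
  have : (F n).mkQ x = (F n).mkQ (x - u i) := by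
    rw [map_sub, (Submodule.mkQ_apply _ (u i)).trans
      ((Submodule.Quotient.mk_eq_zero _).2 (hmem hi)), sub_zero]
  change ‖(F n).mkQ x‖ ≤ a
  rw [this]
  exact (Submodule.Quotient.norm_mk_le _ _).trans hx

/-- If a sequence is bounded, and asymptotically as close as we want to finite-dimensional
subspaces, then it is relatively compact. -/
lemma isCompact_closure_range_of_eventually_norm_mkQ_lt [CompleteSpace X] {y : ℕ → X} {R : ℝ}
    (hR : ∀ᶠ N in atTop, ‖y N‖ ≤ R)
    (h : ∀ ε : ℝ, 0 < ε → ∃ F : Submodule ℝ X, FiniteDimensional ℝ F ∧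
      ∀ᶠ N in atTop, ‖F.mkQ (y N)‖ < ε) : IsCompact (closure (Set.range y)) := by
  refine TotallyBounded.isCompact_of_isClosed (TotallyBounded.closure ?_) isClosed_closure
  rw [Metric.totallyBounded_iff]
  intro ε hε
  obtain ⟨F, hFd, hF⟩ := h (ε / 2) (half_pos hε)
  obtain ⟨N₀, hN₀⟩ := eventually_atTop.1 (hR.and hF)
  have : ProperSpace F := FiniteDimensional.proper ℝ F
  have hK : TotallyBounded ((↑) '' Metric.closedBall (0 : F) (R + ε / 2) : Set X) :=
    ((isCompact_closedBall (0 : F) (R + ε / 2)).image continuous_subtype_val).totallyBounded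
  obtain ⟨t, ht, hcov⟩ := Metric.totallyBounded_iff.1 hK (ε / 2) (half_pos hε)
  refine ⟨t ∪ y '' Set.Iio N₀, ht.union ((Set.finite_Iio N₀).image y), ?_⟩
  rintro _ ⟨N, rfl⟩
  by_cases hN : N < N₀
  · exact Set.mem_biUnion (Or.inr ⟨N, hN, rfl⟩) (Metric.mem_ball_self hε)
  · obtain ⟨h1, h2⟩ := hN₀ N (not_lt.1 hN)
    -- Removing a small representative `m` of the class leaves a bounded vector of `F`, and balls of
    -- `F` are compact.
    obtain ⟨m, hm, hmε⟩ := QuotientAddGroup.norm_lt_iff.1 h2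
    have hf : y N - m ∈ F := by
      have := (Submodule.Quotient.eq F).1 hm.symm
      exact this
    have hfn : ‖y N - m‖ ≤ R + ε / 2 := (norm_sub_le _ _).trans (by linarith)
    have hfK : y N - m ∈ ((↑) '' Metric.closedBall (0 : F) (R + ε / 2) : Set X) :=
      ⟨⟨y N - m, hf⟩, by simpa using hfn, rfl⟩
    obtain ⟨z, hz, hz'⟩ := Set.mem_iUnion₂.1 (hcov hfK)
    refine Set.mem_biUnion (Or.inl hz) ?_
    rw [Metric.mem_ball] at hz' ⊢
    calc dist (y N) z ≤ dist (y N) (y N - m) + dist (y N - m) z := dist_triangle _ _ _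
      _ < ε := by
        rw [dist_eq_norm (y N), sub_sub_cancel]
        linarith

end Fernique

lemma tendsto_sqrt_two_log_atTop : Tendsto (fun N : ℕ ↦ √(2 * Real.log N)) atTop atTop :=
  Real.tendsto_sqrt_atTop.comp
    ((Real.tendsto_log_atTop.comp tendsto_natCast_atTop_atTop).const_mul_atTop two_pos)

/-- Almost surely, the sequence `(2 log N)^{-1/2} T^N x` is relatively compact. -/
lemma IsAbstractWienerSpace.ae_isCompact_closure {X H : Type*}
    [NormedAddCommGroup X] [NormedSpace ℝ X] [MeasurableSpace X]
    [NormedAddCommGroup H] [InnerProductSpace ℝ H] {ι : H →L[ℝ] X} {μ : Measure X}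
    [CompleteSpace X] [SecondCountableTopology X] [BorelSpace X] [CompleteSpace H]
    (hW : IsAbstractWienerSpace ι μ) {T : X → X} (hT : MeasurePreserving T μ μ) :
    ∀ᵐ x ∂μ, IsCompact
      (closure (Set.range fun N : ℕ ↦ (√(2 * Real.log N))⁻¹ • T^[N] x)) := by
  have := hW.isGaussian
  have : IsProbabilityMeasure μ := hW.isProbabilityMeasure
  obtain ⟨K, M, hK, hM, hfer⟩ := exists_fernique_quotient (μ := μ)
    (IsGaussian.map_rotation_eq_self_of_forall_strongDual_eq_zero hW.centered (-(Real.pi / 4)))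
  have hmp (N : ℕ) (s : Set X) (hs : MeasurableSet s) : μ.real (T^[N] ⁻¹' s) = μ.real s := by
    rw [measureReal_def, (hT.iterate N).measure_preimage hs.nullMeasurableSet, measureReal_def]
  have hmeas (F : Submodule ℝ X) (t : ℝ) : MeasurableSet {x | t ≤ ‖F.mkQ x‖} :=
    (isClosed_le continuous_const (F.mkQL.continuous.norm)).measurableSet
  -- The condition on `a` makes the Fernique tail at `ε √(2 log N)` at most `M N^(-2)`, which is
  -- summable.
  have key (F : Submodule ℝ X) (a ε : ℝ) (ha : 0 < a) (hε : 0 < ε)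
      (hF : ENNReal.ofReal (3 / 4) ≤ μ {x | ‖F.mkQ x‖ ≤ a}) (h : a ^ 2 ≤ K * ε ^ 2) :
      ∀ᵐ x ∂μ, ∀ᶠ N : ℕ in atTop, ‖F.mkQ ((√(2 * Real.log N))⁻¹ • T^[N] x)‖ < ε := by
    have h1 : ∀ᵐ x ∂μ, ∀ᶠ N : ℕ in atTop,
        x ∉ T^[N] ⁻¹' {x | ε * √(2 * Real.log N) ≤ ‖F.mkQ x‖} := by
      refine ae_eventually_notMem_of_le_rpow (C := M) (p := 2) one_lt_two ?_
      filter_upwards [eventually_ge_atTop 1] with N hN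
      rw [hmp N _ (hmeas F _)]
      refine (hfer F a ha hF _ (by positivity)).trans ?_
      rw [← exp_neg_mul_log_eq N hN, sq_mul_sqrt_two_log]
      refine mul_le_mul_of_nonneg_left (Real.exp_le_exp.2 ?_) hM
      have hl := Real.log_natCast_nonneg N
      have : 1 ≤ K / a ^ 2 * ε ^ 2 := by
        rw [div_mul_eq_mul_div, one_le_div (by positivity)]
        exact h
      nlinarith
    filter_upwards [h1] with x hx
    filter_upwards [hx, tendsto_sqrt_two_log_atTop.eventually_gt_atTop 0] with N hN hN0
    have h2 : ‖F.mkQ (T^[N] x)‖ < ε * √(2 * Real.log N) := not_le.1 hN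
    rw [map_smul, norm_smul, norm_inv, Real.norm_of_nonneg hN0.le, inv_mul_lt_iff₀ hN0, mul_comm]
    exact h2
  have hfd : ∀ᵐ x ∂μ, ∀ n : ℕ, ∃ F : Submodule ℝ X, FiniteDimensional ℝ F ∧
      ∀ᶠ N : ℕ in atTop, ‖F.mkQ ((√(2 * Real.log N))⁻¹ • T^[N] x)‖ < 1 / ((n : ℝ) + 1) := by
    refine ae_all_iff.2 fun n ↦ ?_
    have hε : (0 : ℝ) < 1 / ((n : ℝ) + 1) := by positivity
    obtain ⟨F, hFd, hF⟩ := exists_finiteDimensional_norm_mkQ_le (μ := μ)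
      (a := √K * (1 / ((n : ℝ) + 1))) (by positivity)
    filter_upwards [key F _ _ (by positivity) hε hF (by rw [mul_pow, Real.sq_sqrt hK.le])] with x hx
    exact ⟨F, hFd, hx⟩
  -- For boundedness take `F = ⊥` and a large `a`: the quotient norm is then the norm.
  have hbd : ∃ R : ℝ, ∀ᵐ x ∂μ, ∀ᶠ N : ℕ in atTop, ‖(√(2 * Real.log N))⁻¹ • T^[N] x‖ ≤ R := by
    have hs : Monotone fun n : ℕ ↦ {x : X | ‖(⊥ : Submodule ℝ X).mkQ x‖ ≤ (n : ℝ) + 1} :=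
      fun m n hmn x (hx : ‖(⊥ : Submodule ℝ X).mkQ x‖ ≤ (m : ℝ) + 1) ↦
        hx.trans (add_le_add_left (Nat.cast_le.2 hmn) 1)
    have hU : ⋃ n : ℕ, {x : X | ‖(⊥ : Submodule ℝ X).mkQ x‖ ≤ (n : ℝ) + 1} = Set.univ := by
      refine Set.eq_univ_of_forall fun x ↦ ?_
      obtain ⟨n, hn⟩ := exists_nat_ge ‖(⊥ : Submodule ℝ X).mkQ x‖
      exact Set.mem_iUnion.2 ⟨n, hn.trans (by linarith)⟩
    have hlim := tendsto_measure_iUnion_atTop (μ := μ) hs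
    rw [hU, measure_univ] at hlim
    have h1 : ENNReal.ofReal (3 / 4) < 1 := by
      rw [← ENNReal.ofReal_one]
      exact (ENNReal.ofReal_lt_ofReal_iff (by norm_num)).2 (by norm_num)
    obtain ⟨n, hn⟩ := (hlim.eventually (lt_mem_nhds h1)).exists
    refine ⟨((n : ℝ) + 1) / √K, ?_⟩
    have := key ⊥ ((n : ℝ) + 1) (((n : ℝ) + 1) / √K) (by positivity) (by positivity) hn.le
      (by rw [div_pow, Real.sq_sqrt hK.le]; field_simp; rfl)
    filter_upwards [this] with x hx
    filter_upwards [hx] with N hN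
    obtain ⟨m, hm, hmε⟩ := QuotientAddGroup.norm_lt_iff.1 hN
    have h2 : m - (√(2 * Real.log N))⁻¹ • T^[N] x ∈ (⊥ : Submodule ℝ X) :=
      (Submodule.Quotient.eq ⊥).1 hm
    rw [← sub_eq_zero.1 ((Submodule.mem_bot ℝ).1 h2)]
    exact hmε.le
  obtain ⟨R, hR⟩ := hbd
  filter_upwards [hfd, hR] with x hx hxR
  refine isCompact_closure_range_of_eventually_norm_mkQ_lt hxR fun ε hε ↦ ?_
  obtain ⟨n, hn⟩ := exists_nat_one_div_lt hε
  obtain ⟨F, hFd, hF⟩ := hx n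
  exact ⟨F, hFd, hF.mono fun N hN ↦ hN.trans hn⟩

/-! ## Concentration of the maximum of a Gaussian vector -/

section Softmax

variable {κ : Type*} [Fintype κ]

/-- The smooth approximation `β⁻¹ log ∑ exp (β xⱼ)` of the maximum. -/
noncomputable def softmax (β : ℝ) (x : κ → ℝ) : ℝ := β⁻¹ * Real.log (∑ j, Real.exp (β * x j))

/-- The gradient of `softmax`. -/
noncomputable def softmaxWeight (β : ℝ) (x : κ → ℝ) (j : κ) : ℝ :=
  Real.exp (β * x j) / ∑ i, Real.exp (β * x i)

variable [Nonempty κ] {β : ℝ} {x y : κ → ℝ}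

lemma sum_exp_pos (β : ℝ) (x : κ → ℝ) : 0 < ∑ j, Real.exp (β * x j) :=
  Finset.sum_pos (fun _ _ ↦ Real.exp_pos _) Finset.univ_nonempty

lemma softmaxWeight_nonneg (j : κ) : 0 ≤ softmaxWeight β x j :=
  div_nonneg (Real.exp_pos _).le (sum_exp_pos β x).le

lemma sum_softmaxWeight (β : ℝ) (x : κ → ℝ) : ∑ j, softmaxWeight β x j = 1 := by
  simp_rw [softmaxWeight]
  rw [← Finset.sum_div, div_self (sum_exp_pos β x).ne']

lemma continuous_softmaxWeight (β : ℝ) (j : κ) :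
    Continuous fun x : κ → ℝ ↦ softmaxWeight β x j := by
  unfold softmaxWeight
  exact Continuous.div (by fun_prop) (by fun_prop) fun x ↦ (sum_exp_pos β x).ne'

lemma continuous_softmax (β : ℝ) : Continuous fun x : κ → ℝ ↦ softmax β x := by
  unfold softmax
  exact continuous_const.mul (Continuous.log (by fun_prop) fun x ↦ (sum_exp_pos β x).ne')

lemma le_softmax (hβ : 0 < β) (j : κ) : x j ≤ softmax β x := by
  rw [softmax, inv_mul_eq_div, le_div_iff₀ hβ, Real.le_log_iff_exp_le (sum_exp_pos β x), mul_comm]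
  exact Finset.single_le_sum (f := fun j ↦ Real.exp (β * x j)) (fun _ _ ↦ (Real.exp_pos _).le)
    (Finset.mem_univ j)

lemma softmax_le (hβ : 0 < β) {a : ℝ} (hx : ∀ j, x j ≤ a) :
    softmax β x ≤ a + Real.log (Fintype.card κ) / β := by
  have hc : (0 : ℝ) < Fintype.card κ := by exact_mod_cast Fintype.card_pos
  have h1 : ∑ j, Real.exp (β * x j) ≤ Fintype.card κ * Real.exp (β * a) := by
    have : ∑ _j : κ, Real.exp (β * a) = Fintype.card κ * Real.exp (β * a) := by simp
    rw [← this]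
    gcongr with j
    exact hx j
  have h2 := Real.log_le_log (sum_exp_pos β x) h1
  rw [Real.log_mul hc.ne' (Real.exp_pos _).ne', Real.log_exp] at h2
  rw [softmax, inv_mul_eq_div, div_le_iff₀ hβ, add_mul, div_mul_cancel₀ _ hβ.ne']
  linarith

lemma hasDerivAt_softmax_rotation (hβ : β ≠ 0) (x y : κ → ℝ) (θ : ℝ) :
    HasDerivAt (fun θ ↦ softmax β (ContinuousLinearMap.rotation θ (x, y)).1)
      (∑ j, softmaxWeight β (ContinuousLinearMap.rotation θ (x, y)).1 j *
        (ContinuousLinearMap.rotation θ (x, y)).2 j) θ := by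
  simp only [ContinuousLinearMap.rotation_apply, Pi.add_apply, Pi.smul_apply, smul_eq_mul, softmax,
    softmaxWeight]
  have h1 (j : κ) : HasDerivAt (fun θ ↦ Real.exp (β * (Real.cos θ * x j + Real.sin θ * y j)))
      (Real.exp (β * (Real.cos θ * x j + Real.sin θ * y j)) *
        (β * (-Real.sin θ * x j + Real.cos θ * y j))) θ :=
    ((((Real.hasDerivAt_cos θ).mul_const _).add
      ((Real.hasDerivAt_sin θ).mul_const _)).const_mul β).exp
  have h2 := ((HasDerivAt.fun_sum fun j (_ : j ∈ Finset.univ) ↦ h1 j).log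
    (sum_exp_pos β fun j ↦ Real.cos θ * x j + Real.sin θ * y j).ne').const_mul β⁻¹
  refine h2.congr_deriv ?_
  rw [Finset.sum_div, Finset.mul_sum]
  refine Finset.sum_congr rfl fun j _ ↦ ?_
  field_simp

/-- The Maurey-Pisier interpolation inequality. -/
lemma exp_softmax_sub_le (hβ : β ≠ 0) (c : ℝ) (x y : κ → ℝ) :
    Real.exp (c * (softmax β y - softmax β x)) ≤ (Real.pi / 2)⁻¹ * ∫ θ in (0)..(Real.pi / 2),
      ∑ j, softmaxWeight β (ContinuousLinearMap.rotation θ (x, y)).1 j *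
        Real.exp (c * (Real.pi / 2) * (ContinuousLinearMap.rotation θ (x, y)).2 j) := by
  have hπ : 0 < Real.pi / 2 := by positivity
  set R : ℝ → (κ → ℝ) × (κ → ℝ) := fun θ ↦ ContinuousLinearMap.rotation θ (x, y) with hR
  have hRc : Continuous R := by
    simp only [hR, ContinuousLinearMap.rotation_apply]
    fun_prop
  have hR1 : Continuous fun θ ↦ (R θ).1 := hRc.fst
  have hR2 (j : κ) : Continuous fun θ ↦ (R θ).2 j := (continuous_apply j).comp hRc.snd
  have hw (j : κ) : Continuous fun θ ↦ softmaxWeight β (R θ).1 j :=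
    (continuous_softmaxWeight β j).comp hR1
  set G : ℝ → ℝ := fun θ ↦ ∑ j, softmaxWeight β (R θ).1 j * (R θ).2 j with hG
  have hGc : Continuous G := by fun_prop
  have hint : ∫ θ in (0)..(Real.pi / 2), G θ = softmax β y - softmax β x := by
    rw [intervalIntegral.integral_eq_sub_of_hasDerivAt
      (fun θ _ ↦ hasDerivAt_softmax_rotation hβ x y θ) (hGc.intervalIntegrable _ _)]
    simp [ContinuousLinearMap.rotation_apply]
  set A := c * (softmax β y - softmax β x) with hA
  set f : ℝ → ℝ := fun θ ↦ ∑ j, softmaxWeight β (R θ).1 j *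
    Real.exp (c * (Real.pi / 2) * (R θ).2 j) with hf
  have hfc : Continuous f := by fun_prop
  -- This replaces Jensen's inequality for the integral over `θ`: the tangent line of `exp` at `A`
  -- integrates to exactly `exp A * (π / 2)`. Finite Jensen with the softmax weights handles the
  -- sum.
  have hpt (θ : ℝ) : Real.exp A * (c * (Real.pi / 2) * G θ - A + 1) ≤ f θ := by
    calc Real.exp A * (c * (Real.pi / 2) * G θ - A + 1)
        ≤ Real.exp A * Real.exp (c * (Real.pi / 2) * G θ - A) := by
          gcongr
          exact Real.add_one_le_exp _
      _ = Real.exp (∑ j, softmaxWeight β (R θ).1 j • (c * (Real.pi / 2) * (R θ).2 j)) := by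
          rw [← Real.exp_add, add_sub_cancel, hG, Finset.mul_sum]
          congr 1
          refine Finset.sum_congr rfl fun j _ ↦ ?_
          rw [smul_eq_mul]
          ring
      _ ≤ f θ := by
          have := convexOn_exp.map_sum_le (t := Finset.univ)
            (w := fun j ↦ softmaxWeight β (R θ).1 j)
            (p := fun j ↦ c * (Real.pi / 2) * (R θ).2 j)
            (fun j _ ↦ softmaxWeight_nonneg j) (sum_softmaxWeight β _) (fun _ _ ↦ Set.mem_univ _)
          simpa [hf] using this
  have hmono := intervalIntegral.integral_mono_on (μ := volume) hπ.le
    ((by fun_prop : Continuous fun θ ↦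
      Real.exp A * (c * (Real.pi / 2) * G θ - A + 1)).intervalIntegrable _ _)
    (hfc.intervalIntegrable _ _) (fun θ (_ : θ ∈ Set.Icc 0 (Real.pi / 2)) ↦ hpt θ)
  have hlhs : ∫ θ in (0)..(Real.pi / 2), Real.exp A * (c * (Real.pi / 2) * G θ - A + 1)
      = Real.exp A * (Real.pi / 2) := by
    rw [intervalIntegral.integral_const_mul]
    congr 1
    have h1 : ∀ θ, c * (Real.pi / 2) * G θ - A + 1 = c * (Real.pi / 2) * G θ + (1 - A) :=
      fun θ ↦ by ring
    simp_rw [h1]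
    rw [intervalIntegral.integral_add
      ((hGc.intervalIntegrable _ _).const_mul _) intervalIntegrable_const,
      intervalIntegral.integral_const_mul, hint, intervalIntegral.integral_const, smul_eq_mul, hA]
    ring
  rw [hlhs] at hmono
  rw [le_inv_mul_iff₀ hπ, mul_comm]
  exact hmono

/-- The integrand of the Maurey-Pisier inequality. -/
noncomputable def softmaxKernel (β d : ℝ) (z : (κ → ℝ) × (κ → ℝ)) : ℝ :=
  ∑ j, softmaxWeight β z.1 j * Real.exp (d * z.2 j)

lemma softmaxKernel_nonneg (β d : ℝ) (z : (κ → ℝ) × (κ → ℝ)) : 0 ≤ softmaxKernel β d z :=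
  Finset.sum_nonneg fun _ _ ↦ mul_nonneg (softmaxWeight_nonneg _) (Real.exp_pos _).le

lemma continuous_softmaxKernel (β d : ℝ) : Continuous (softmaxKernel (κ := κ) β d) := by
  unfold softmaxKernel
  refine continuous_finsetSum _ fun j _ ↦
    ((continuous_softmaxWeight β j).comp continuous_fst).mul ?_
  fun_prop

lemma continuous_softmaxKernel_rotation (β d : ℝ) :
    Continuous fun p : ℝ × ((κ → ℝ) × (κ → ℝ)) ↦
      softmaxKernel β d (ContinuousLinearMap.rotation p.1 p.2) := by
  refine (continuous_softmaxKernel β d).comp ?_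
  simp only [ContinuousLinearMap.rotation_apply]
  fun_prop

lemma continuous_softmaxKernel_rotation_left (β d : ℝ) (z : (κ → ℝ) × (κ → ℝ)) :
    Continuous fun θ ↦ softmaxKernel β d (ContinuousLinearMap.rotation θ z) := by
  refine (continuous_softmaxKernel β d).comp ?_
  simp only [ContinuousLinearMap.rotation_apply]
  fun_prop

/-- The weights involve the first copy only and the exponentials the second only, so the integral
factors. As the weights sum to 1, the number of coordinates disappears from the bound. -/
lemma lintegral_softmaxKernel {ν : Measure (κ → ℝ)} [IsProbabilityMeasure ν]
    (hν : ∀ j, IsCenteredGaussian ν (fun x ↦ x j) 1) (β d : ℝ) :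
    ∫⁻ z, ENNReal.ofReal (softmaxKernel β d z) ∂(ν.prod ν)
      = ENNReal.ofReal (Real.exp (d ^ 2 / 2)) := by
  have h1 (z : (κ → ℝ) × (κ → ℝ)) : ENNReal.ofReal (softmaxKernel β d z)
      = ∑ j, ENNReal.ofReal (softmaxWeight β z.1 j) *
        ENNReal.ofReal (Real.exp (d * z.2 j)) := by
    rw [softmaxKernel, ENNReal.ofReal_sum_of_nonneg fun j _ ↦
      mul_nonneg (softmaxWeight_nonneg j) (Real.exp_pos _).le]
    exact Finset.sum_congr rfl fun j _ ↦ ENNReal.ofReal_mul (softmaxWeight_nonneg j)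
  simp_rw [h1]
  have hwm (j : κ) : Measurable fun x : κ → ℝ ↦ ENNReal.ofReal (softmaxWeight β x j) :=
    (continuous_softmaxWeight β j).measurable.ennreal_ofReal
  have hem (j : κ) : Measurable fun y : κ → ℝ ↦ ENNReal.ofReal (Real.exp (d * y j)) :=
    by fun_prop
  have hterm (j : κ) : Measurable fun z : (κ → ℝ) × (κ → ℝ) ↦
      ENNReal.ofReal (softmaxWeight β z.1 j) * ENNReal.ofReal (Real.exp (d * z.2 j)) :=
    ((hwm j).comp measurable_fst).mul ((hem j).comp measurable_snd)
  rw [lintegral_finsetSum _ fun j _ ↦ hterm j]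
  have h2 (j : κ) : ∫⁻ y, ENNReal.ofReal (Real.exp (d * y j)) ∂ν
      = ENNReal.ofReal (Real.exp (d ^ 2 / 2)) := by
    rw [← ofReal_integral_eq_lintegral_ofReal ((hν j).integrable_exp_mul d)
      (ae_of_all _ fun _ ↦ (Real.exp_pos _).le), (hν j).mgf_eq]
    simp
  have h3 (j : κ) : ∫⁻ z, ENNReal.ofReal (softmaxWeight β z.1 j) *
      ENNReal.ofReal (Real.exp (d * z.2 j)) ∂(ν.prod ν)
      = (∫⁻ x, ENNReal.ofReal (softmaxWeight β x j) ∂ν) *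
        ENNReal.ofReal (Real.exp (d ^ 2 / 2)) := by
    rw [lintegral_prod_mul (hwm j).aemeasurable (hem j).aemeasurable, h2]
  simp_rw [h3]
  rw [← Finset.sum_mul, ← lintegral_finsetSum _ fun j _ ↦ hwm j]
  simp_rw [← ENNReal.ofReal_sum_of_nonneg fun j _ ↦ softmaxWeight_nonneg j, sum_softmaxWeight]
  simp

/-- Gaussian concentration for the smooth maximum. -/
lemma lintegral_exp_softmax_sub_le {ν : Measure (κ → ℝ)} [IsProbabilityMeasure ν]
    (hrot : ∀ θ, (ν.prod ν).map (ContinuousLinearMap.rotation θ) = ν.prod ν)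
    (hν : ∀ j, IsCenteredGaussian ν (fun x ↦ x j) 1) (hβ : β ≠ 0) (c : ℝ) :
    ∫⁻ z, ENNReal.ofReal (Real.exp (c * (softmax β z.2 - softmax β z.1))) ∂(ν.prod ν)
      ≤ ENNReal.ofReal (Real.exp ((c * (Real.pi / 2)) ^ 2 / 2)) := by
  have hπ : 0 < Real.pi / 2 := by positivity
  set d := c * (Real.pi / 2) with hd
  calc ∫⁻ z, ENNReal.ofReal (Real.exp (c * (softmax β z.2 - softmax β z.1))) ∂(ν.prod ν)
      ≤ ∫⁻ z, ENNReal.ofReal (Real.pi / 2)⁻¹ * (∫⁻ θ in Set.Ioc 0 (Real.pi / 2),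
          ENNReal.ofReal (softmaxKernel β d (ContinuousLinearMap.rotation θ z))) ∂(ν.prod ν) := by
        refine lintegral_mono fun z ↦ ?_
        have hc : Continuous fun θ ↦ softmaxKernel β d (ContinuousLinearMap.rotation θ z) :=
          continuous_softmaxKernel_rotation_left β d z
        have hle : Real.exp (c * (softmax β z.2 - softmax β z.1)) ≤ (Real.pi / 2)⁻¹ *
            ∫ θ in (0)..(Real.pi / 2), softmaxKernel β d (ContinuousLinearMap.rotation θ z) :=
          exp_softmax_sub_le hβ c z.1 z.2
        rw [intervalIntegral.integral_of_le hπ.le] at hle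
        have hi : Integrable (fun θ ↦ softmaxKernel β d (ContinuousLinearMap.rotation θ z))
          (volume.restrict (Set.Ioc 0 (Real.pi / 2))) := hc.integrableOn_Ioc
        rw [← ofReal_integral_eq_lintegral_ofReal hi
            (ae_of_all _ fun _ ↦ softmaxKernel_nonneg β d _),
          ← ENNReal.ofReal_mul (inv_nonneg.2 hπ.le)]
        exact ENNReal.ofReal_le_ofReal hle
    _ = ENNReal.ofReal (Real.pi / 2)⁻¹ * ∫⁻ θ in Set.Ioc 0 (Real.pi / 2),
          ∫⁻ z, ENNReal.ofReal (softmaxKernel β d (ContinuousLinearMap.rotation θ z))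
            ∂(ν.prod ν) := by
        rw [lintegral_const_mul' _ _ ENNReal.ofReal_ne_top, lintegral_lintegral_swap]
        have h := (continuous_softmaxKernel_rotation (κ := κ) β d).comp continuous_swap
        exact h.measurable.ennreal_ofReal.aemeasurable
    _ = ENNReal.ofReal (Real.pi / 2)⁻¹ * ∫⁻ _θ in Set.Ioc 0 (Real.pi / 2),
          ENNReal.ofReal (Real.exp (d ^ 2 / 2)) := by
        congr 1
        -- Rotation invariance makes the inner integral independent of `θ`.
        refine lintegral_congr fun θ ↦ ?_
        rw [← lintegral_softmaxKernel hν β d]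
        exact MeasurePreserving.lintegral_comp
          ⟨(ContinuousLinearMap.continuous _).measurable, hrot θ⟩
          (continuous_softmaxKernel β d).measurable.ennreal_ofReal
    _ = ENNReal.ofReal (Real.exp (d ^ 2 / 2)) := by
        rw [setLIntegral_const, Real.volume_Ioc, sub_zero, mul_comm, mul_assoc,
          ← ENNReal.ofReal_mul hπ.le, mul_inv_cancel₀ hπ.ne', ENNReal.ofReal_one, mul_one]

/-- Gaussian concentration for the maximum. -/
lemma measureReal_forall_le_mul_exists_le {ν : Measure (κ → ℝ)} [IsProbabilityMeasure ν]
    (hrot : ∀ θ, (ν.prod ν).map (ContinuousLinearMap.rotation θ) = ν.prod ν)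
    (hν : ∀ j, IsCenteredGaussian ν (fun x ↦ x j) 1) (a : ℝ) {t : ℝ} (ht : 0 < t) :
    ν.real {x | ∀ j, x j ≤ a} * ν.real {x | ∃ j, a + t ≤ x j}
      ≤ Real.exp (-(t ^ 2 / (2 * Real.pi ^ 2))) := by
  set l := Real.log (Fintype.card κ) with hl
  have hl0 : 0 ≤ l := Real.log_natCast_nonneg _
  -- Chosen so that the softmax error `l / β` is at most `t / 2`; the `+ 1` keeps `β` positive when
  -- there is a single coordinate.
  set β := 2 * (l + 1) / t with hβ
  have hβ0 : 0 < β := by positivity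
  -- Minimizes the Chernoff exponent `(c π / 2)² / 2 - c t / 2`.
  set c := 2 * t / Real.pi ^ 2 with hc
  have hc0 : 0 < c := by positivity
  have hmain := lintegral_exp_softmax_sub_le hrot hν hβ0.ne' c
  have hfm : Measurable fun z : (κ → ℝ) × (κ → ℝ) ↦
      ENNReal.ofReal (Real.exp (c * (softmax β z.2 - softmax β z.1))) := by
    have := (continuous_softmax (κ := κ) β).measurable
    fun_prop
  have hmarkov := mul_meas_ge_le_lintegral (μ := ν.prod ν) hfm
    (ENNReal.ofReal (Real.exp (c * (t / 2))))
  have hsub : {x : κ → ℝ | ∀ j, x j ≤ a} ×ˢ {x : κ → ℝ | ∃ j, a + t ≤ x j} ⊆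
      {z | ENNReal.ofReal (Real.exp (c * (t / 2)))
        ≤ ENNReal.ofReal (Real.exp (c * (softmax β z.2 - softmax β z.1)))} := by
    rintro ⟨x, y⟩ ⟨hx, j, hj⟩
    refine ENNReal.ofReal_le_ofReal (Real.exp_le_exp.2 (mul_le_mul_of_nonneg_left ?_ hc0.le))
    have h1 : softmax β x ≤ a + l / β := softmax_le hβ0 hx
    have h2 : y j ≤ softmax β y := le_softmax hβ0 j
    have h3 : l / β ≤ t / 2 := by
      rw [div_le_iff₀ hβ0, hβ]
      field_simp
      linarith
    simp only at h1 h2 ⊢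
    linarith
  have h1 := ENNReal.toReal_mono ENNReal.ofReal_ne_top
    (((mul_le_mul_right (measure_mono hsub) _).trans hmarkov).trans hmain)
  rw [Measure.prod_prod, ENNReal.toReal_mul, ENNReal.toReal_mul,
    ENNReal.toReal_ofReal (Real.exp_pos _).le, ENNReal.toReal_ofReal (Real.exp_pos _).le,
    mul_comm, ← le_div_iff₀ (Real.exp_pos _), ← Real.exp_sub] at h1
  refine h1.trans (le_of_eq ?_)
  congr 1
  rw [hc]
  field_simp
  ring

end Softmax

/-! ## Lower bounds for the maximum of weakly correlated Gaussian variables -/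

section SecondMoment

variable {Ω : Type*} [MeasurableSpace Ω] {P : Measure Ω}

/-- The density is at least its value at `u + 1` on `[u, u + 1]`, and `√(2π) ≤ 3`. -/
lemma IsCenteredGaussian.le_measureReal_le [IsProbabilityMeasure P] {g : Ω → ℝ}
    (hg : IsCenteredGaussian P g 1) {u : ℝ} (hu : 0 ≤ u) :
    Real.exp (-(u + 1) ^ 2 / 2) / 3 ≤ P.real {x | u ≤ g x} := by
  have h1 : P.real {x | u ≤ g x} = (gaussianReal 0 1).real (Set.Ici u) := by
    have h2 := hg.2
    rw [one_pow, Real.toNNReal_one] at h2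
    rw [← h2, map_measureReal_apply hg.1 measurableSet_Ici]
    rfl
  rw [h1]
  have h2 : ENNReal.ofReal (Real.exp (-(u + 1) ^ 2 / 2) / 3) ≤ gaussianReal 0 1 (Set.Ici u) := by
    calc ENNReal.ofReal (Real.exp (-(u + 1) ^ 2 / 2) / 3)
        = ∫⁻ _x in Set.Icc u (u + 1), ENNReal.ofReal (Real.exp (-(u + 1) ^ 2 / 2) / 3) := by
          simp
      _ ≤ ∫⁻ x in Set.Icc u (u + 1), gaussianPDF 0 1 x := by
          refine setLIntegral_mono' measurableSet_Icc fun x hx ↦ ENNReal.ofReal_le_ofReal ?_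
          rw [gaussianPDFReal, div_eq_inv_mul]
          have h3 : (√(2 * Real.pi * (1 : NNReal)))⁻¹ ≥ (3 : ℝ)⁻¹ := by
            refine inv_anti₀ (by positivity) ?_
            rw [NNReal.coe_one, mul_one, Real.sqrt_le_left (by norm_num)]
            nlinarith [Real.pi_lt_four, Real.pi_lt_d2]
          refine mul_le_mul h3 (Real.exp_le_exp.2 ?_) (Real.exp_pos _).le (by positivity)
          have h4 : 0 ≤ x := hu.trans hx.1
          have h5 := hx.2
          rw [NNReal.coe_one]
          nlinarith
      _ = gaussianReal 0 1 (Set.Icc u (u + 1)) := (gaussianReal_apply 0 one_ne_zero _).symm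
      _ ≤ gaussianReal 0 1 (Set.Ici u) := measure_mono Set.Icc_subset_Ici_self
  exact (ENNReal.ofReal_le_iff_le_toReal (measure_ne_top _ _)).1 h2

/-- The Chung-Erdős inequality. -/
lemma sq_sum_measureReal_le {κ : Type*} [Fintype κ] [IsProbabilityMeasure P] {A : κ → Set Ω}
    (hA : ∀ i, MeasurableSet (A i)) :
    (∑ i, P.real (A i)) ^ 2 ≤ P.real (⋃ i, A i) * ∑ i, ∑ j, P.real (A i ∩ A j) := by
  set M := ∑ i, P.real (A i) with hM
  set Q := ∑ i, ∑ j, P.real (A i ∩ A j) with hQ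
  have hAi (i : κ) : Integrable ((A i).indicator (1 : Ω → ℝ)) P :=
    (integrable_const 1).indicator (hA i)
  have hAij (i j : κ) : Integrable ((A i ∩ A j).indicator (1 : Ω → ℝ)) P :=
    (integrable_const 1).indicator ((hA i).inter (hA j))
  have hU : MeasurableSet (⋃ i, A i) := MeasurableSet.iUnion hA
  -- With `n` the number of events that occur, `2 c n - c² n² ≤ 1` on the union, and both sides
  -- vanish off it once 1 is replaced by the indicator. The optimal `c` is `M / Q`.
  have key (c : ℝ) : 2 * c * M - c ^ 2 * Q ≤ P.real (⋃ i, A i) := by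
    calc 2 * c * M - c ^ 2 * Q
        = ∫ x, (2 * c * ∑ i, (A i).indicator (1 : Ω → ℝ) x -
            c ^ 2 * ∑ i, ∑ j, (A i ∩ A j).indicator (1 : Ω → ℝ) x) ∂P := by
          rw [integral_sub, integral_const_mul, integral_const_mul,
            integral_finsetSum _ fun i _ ↦ hAi i, integral_finsetSum]
          · simp_rw [integral_finsetSum _ fun j _ ↦ hAij _ j]
            simp_rw [integral_indicator_one (hA _), integral_indicator_one ((hA _).inter (hA _))]
            rw [hM, hQ]
          · exact fun i _ ↦ integrable_finsetSum _ fun j _ ↦ hAij i j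
          · exact (integrable_finsetSum _ fun i _ ↦ hAi i).const_mul _
          · exact (integrable_finsetSum _ fun i _ ↦ integrable_finsetSum _
              fun j _ ↦ hAij i j).const_mul _
      _ ≤ ∫ x, (⋃ i, A i).indicator (1 : Ω → ℝ) x ∂P := by
          refine integral_mono (((integrable_finsetSum _ fun i _ ↦ hAi i).const_mul _).sub
            ((integrable_finsetSum _ fun i _ ↦ integrable_finsetSum _
              fun j _ ↦ hAij i j).const_mul _)) ((integrable_const 1).indicator hU) fun x ↦ ?_
          have h1 : ∑ i, ∑ j, (A i ∩ A j).indicator (1 : Ω → ℝ) x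
              = (∑ i, (A i).indicator (1 : Ω → ℝ) x) ^ 2 := by
            rw [sq, Finset.sum_mul_sum]
            simp_rw [Set.inter_indicator_one, Pi.mul_apply]
          simp only [h1]
          by_cases hx : x ∈ ⋃ i, A i
          · rw [Set.indicator_of_mem hx, Pi.one_apply]
            nlinarith [sq_nonneg (1 - c * ∑ i, (A i).indicator (1 : Ω → ℝ) x)]
          · have h2 (i : κ) : (A i).indicator (1 : Ω → ℝ) x = 0 :=
              Set.indicator_of_notMem (fun h ↦ hx (Set.mem_iUnion.2 ⟨i, h⟩)) _
            rw [Set.indicator_of_notMem hx]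
            simp [h2]
      _ = P.real (⋃ i, A i) := integral_indicator_one hU
  have hQ0 : 0 ≤ Q := Finset.sum_nonneg fun i _ ↦ Finset.sum_nonneg fun j _ ↦ measureReal_nonneg
  have hP0 : 0 ≤ P.real (⋃ i, A i) := measureReal_nonneg
  rcases hQ0.eq_or_lt with h0 | h0
  · have h1 : ∀ i, P.real (A i) = 0 := by
      intro i
      have h2 := (Finset.sum_eq_zero_iff_of_nonneg
        (fun i _ ↦ Finset.sum_nonneg fun j _ ↦ measureReal_nonneg)).1 (hQ.symm.trans h0.symm) i
          (Finset.mem_univ i)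
      simpa using (Finset.sum_eq_zero_iff_of_nonneg (fun j _ ↦ measureReal_nonneg)).1 h2 i
        (Finset.mem_univ i)
    simp [hM, h1, ← h0]
  · have h1 := key (M / Q)
    have h2 : 2 * (M / Q) * M - (M / Q) ^ 2 * Q = M ^ 2 / Q := by
      field_simp
      ring
    rwa [h2, div_le_iff₀ h0] at h1

variable {κ : Type*} [Fintype κ] [Nonempty κ] [IsProbabilityMeasure P] {w : κ → Ω → ℝ}
  {τ : κ → κ → ℝ} {δ : ℝ}

/-- Chung-Erdős, where a joint exceedance forces `w i + w j ≥ 2 u` for a variable of variance at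
most `2 + 2 δ`. The resulting lower bound on the probability may be tiny; concentration will
compensate for that. -/
lemma one_le_measureReal_exists_le_mul (hw : ∀ i, IsCenteredGaussian P (w i) 1)
    (hτ : ∀ i j, i ≠ j → IsCenteredGaussian P (fun x ↦ w i x + w j x) (τ i j))
    (hδ0 : 0 ≤ δ) (hδ : ∀ i j, i ≠ j → τ i j ^ 2 ≤ 2 + 2 * δ) {u : ℝ} (hu : 0 ≤ u) :
    1 ≤ P.real {x | ∃ j, u ≤ w j x} * (3 * Real.exp ((u + 1) ^ 2 / 2) / Fintype.card κ +
      9 * Real.exp ((u + 1) ^ 2 - u ^ 2 / (1 + δ))) := by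
  set n : ℝ := (Fintype.card κ : ℝ) with hn
  have hn0 : 0 < n := Nat.cast_pos.2 Fintype.card_pos
  set A : κ → Set Ω := fun i ↦ {x | u ≤ w i x} with hA
  have hAm (i : κ) : MeasurableSet (A i) := measurableSet_le measurable_const (hw i).1
  set q := Real.exp (-(u + 1) ^ 2 / 2) / 3 with hq
  have hq0 : 0 < q := by positivity
  set r := Real.exp (-(u ^ 2 / (1 + δ))) with hr
  have hU : {x | ∃ j, u ≤ w j x} = ⋃ i, A i := by
    ext x
    simp [hA]
  have h1 := sq_sum_measureReal_le (P := P) hAm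
  rw [← hU] at h1
  set M := ∑ i, P.real (A i) with hM
  have hMq : n * q ≤ M := by
    have h2 : ∑ _i : κ, q = n * q := by simp [hn]
    rw [← h2]
    exact Finset.sum_le_sum fun i _ ↦ (hw i).le_measureReal_le hu
  have hM0 : 0 < M := (mul_pos hn0 hq0).trans_le hMq
  have hpair (i j : κ) (hij : i ≠ j) : P.real (A i ∩ A j) ≤ r := by
    calc P.real (A i ∩ A j) ≤ P.real {x | 2 * u ≤ w i x + w j x} :=
          measureReal_mono fun x hx ↦ by
            have h2 : u ≤ w i x := hx.1
            have h3 : u ≤ w j x := hx.2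
            change 2 * u ≤ w i x + w j x
            linarith
      _ ≤ Real.exp (-(2 * u) ^ 2 / (2 * (2 + 2 * δ))) :=
          (hτ i j hij).tail (hδ i j hij) (by positivity)
      _ = r := by
          rw [hr]
          congr 1
          field_simp
  have hsum : ∑ i, ∑ j, P.real (A i ∩ A j) ≤ M + n ^ 2 * r := by
    classical
    calc ∑ i, ∑ j, P.real (A i ∩ A j)
        ≤ ∑ i, ∑ j, ((if i = j then P.real (A i) else 0) + r) := by
          refine Finset.sum_le_sum fun i _ ↦ Finset.sum_le_sum fun j _ ↦ ?_
          have hr0 : 0 ≤ r := (Real.exp_pos _).le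
          split_ifs with h
          · subst h
            rw [Set.inter_self]
            linarith
          · linarith [hpair i j h]
      _ = M + n ^ 2 * r := by
          simp only [Finset.sum_add_distrib, Finset.sum_ite_eq, Finset.mem_univ, if_true,
            Finset.sum_const, Finset.card_univ, nsmul_eq_mul, hM, hn]
          ring
  set p := P.real {x | ∃ j, u ≤ w j x} with hp
  have hp0 : 0 ≤ p := measureReal_nonneg
  have h2 : M ^ 2 ≤ p * (M + n ^ 2 * r) := h1.trans (mul_le_mul_of_nonneg_left hsum hp0)
  have h3 : 1 ≤ p * (1 / M + n ^ 2 * r / M ^ 2) := by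
    have h4 : p * (1 / M + n ^ 2 * r / M ^ 2) = p * (M + n ^ 2 * r) / M ^ 2 := by
      field_simp
    rwa [h4, one_le_div (by positivity)]
  refine h3.trans (mul_le_mul_of_nonneg_left (add_le_add ?_ ?_) hp0)
  · calc 1 / M ≤ 1 / (n * q) := one_div_le_one_div_of_le (mul_pos hn0 hq0) hMq
      _ = 3 * Real.exp ((u + 1) ^ 2 / 2) / n := by
        rw [hq, neg_div, Real.exp_neg]
        field_simp
  · calc n ^ 2 * r / M ^ 2 ≤ n ^ 2 * r / (n * q) ^ 2 := by gcongr
      _ = 9 * Real.exp ((u + 1) ^ 2 - u ^ 2 / (1 + δ)) := by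
        have h5 : q ^ 2 = Real.exp (-(u + 1) ^ 2) / 9 := by
          rw [hq, div_pow, ← Real.exp_nat_mul]
          norm_num
          ring_nf
        rw [mul_pow, h5, hr, sub_eq_add_neg, Real.exp_add, Real.exp_neg ((u + 1) ^ 2)]
        field_simp

end SecondMoment

section MaxLower

variable {X H : Type*} [NormedAddCommGroup X] [NormedSpace ℝ X] [CompleteSpace X]
  [SecondCountableTopology X] [MeasurableSpace X] [BorelSpace X]
  [NormedAddCommGroup H] [InnerProductSpace ℝ H] [CompleteSpace H]
  {ι : H →L[ℝ] X} {μ : Measure X}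

/-- Concentration bounds `P(max ≤ a) P(max ≥ a + t)`, and the second moment bound supplies a lower
bound for the second factor. Correlations need only be bounded above. -/
lemma IsAbstractWienerSpace.measureReal_forall_le_le (hW : IsAbstractWienerSpace ι μ)
    {κ : Type*} [Fintype κ] [Nonempty κ] {h : κ → H} {w : κ → X → ℝ}
    (hw : ∀ i, IsWienerFunctional ι μ (h i) (w i)) (h1 : ∀ i, ‖h i‖ = 1) {δ : ℝ} (hδ0 : 0 ≤ δ)
    (hδ : ∀ i j, i ≠ j → inner ℝ (h i) (h j) ≤ δ) {a t : ℝ} (ht : 0 < t) (hat : 0 ≤ a + t) :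
    μ.real {x | ∀ j, w j x ≤ a} ≤ Real.exp (-(t ^ 2 / (2 * Real.pi ^ 2))) *
      (3 * Real.exp ((a + t + 1) ^ 2 / 2) / Fintype.card κ +
        9 * Real.exp ((a + t + 1) ^ 2 - (a + t) ^ 2 / (1 + δ))) := by
  classical
  have := hW.isProbabilityMeasure
  have hwm : Measurable fun x j ↦ w j x := measurable_pi_lambda _ fun j ↦ (hw j).measurable
  set ν := μ.map fun x j ↦ w j x with hν
  have : IsProbabilityMeasure ν := Measure.isProbabilityMeasure_map hwm.aemeasurable
  have hdual (L : StrongDual ℝ (κ → ℝ)) :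
      IsCenteredGaussian ν L ‖∑ i, L (Pi.single i 1) • h i‖ := by
    have h2 := hW.isCenteredGaussian_dual_pi hw L
    exact ⟨by fun_prop, by rw [hν, Measure.map_map (by fun_prop) hwm]; exact h2.2⟩
  have hG : IsGaussian ν := isGaussian_of_map_eq_gaussianReal fun L ↦ ⟨_, _, (hdual L).2⟩
  have hrot (θ : ℝ) := IsGaussian.map_rotation_eq_self_of_forall_strongDual_eq_zero (μ := ν)
    (fun L ↦ (hdual L).integral_eq_zero) θ
  have hcoord (j : κ) : IsCenteredGaussian ν (fun x ↦ x j) 1 := by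
    refine ⟨measurable_pi_apply j, ?_⟩
    rw [hν, Measure.map_map (measurable_pi_apply j) hwm]
    have h2 := hW.isCenteredGaussian (hw j)
    rw [h1 j] at h2
    exact h2.2
  have hconc := measureReal_forall_le_mul_exists_le hrot hcoord a ht
  have hA : MeasurableSet {x : κ → ℝ | ∀ j, x j ≤ a} := by
    simp only [Set.ofPred_forall]
    exact MeasurableSet.iInter fun j ↦ measurableSet_le (measurable_pi_apply j) measurable_const
  have hB : MeasurableSet {x : κ → ℝ | ∃ j, a + t ≤ x j} := by
    simp only [Set.ofPred_exists]
    exact MeasurableSet.iUnion fun j ↦ measurableSet_le measurable_const (measurable_pi_apply j)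
  rw [hν, map_measureReal_apply hwm hA, map_measureReal_apply hwm hB] at hconc
  have hsec := one_le_measureReal_exists_le_mul (P := μ) (w := w)
    (τ := fun i j ↦ ‖h i + h j‖) (δ := δ) (fun i ↦ by
      have h2 := hW.isCenteredGaussian (hw i)
      rwa [h1 i] at h2) (fun i j _ ↦ hW.isCenteredGaussian ((hw i).add (hw j))) hδ0
    (fun i j hij ↦ by
      rw [norm_add_sq_real, h1, h1]
      linarith [hδ i j hij]) hat
  set B := 3 * Real.exp ((a + t + 1) ^ 2 / 2) / Fintype.card κ +
        9 * Real.exp ((a + t + 1) ^ 2 - (a + t) ^ 2 / (1 + δ)) with hBdef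
  have hB0 : 0 ≤ B := by positivity
  calc μ.real {x | ∀ j, w j x ≤ a}
      ≤ μ.real {x | ∀ j, w j x ≤ a} * (μ.real {x | ∃ j, a + t ≤ w j x} * B) :=
        le_mul_of_one_le_right measureReal_nonneg hsec
    _ = μ.real {x | ∀ j, w j x ≤ a} * μ.real {x | ∃ j, a + t ≤ w j x} * B := by ring
    _ ≤ _ := mul_le_mul_of_nonneg_right hconc hB0

end MaxLower

/-! ## Lower bound along the orbit -/

/-- Put `L = √(2 log n)`, so that `n = exp (L² / 2)`. Concentration gains at least `ε² L² / 20` in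
the exponent, the correlation level `δ = ε² / 40` costs at most `ε² L² / 40`, and the remaining
terms grow at most linearly in `L`. -/
lemma tendsto_maximum_bound {ε : ℝ} (hε : 0 < ε) (hε1 : ε ≤ 1) :
    Tendsto (fun n : ℕ ↦ Real.exp (-((ε * √(2 * Real.log n)) ^ 2 / (2 * Real.pi ^ 2))) *
      (3 * Real.exp (((1 - 2 * ε) * √(2 * Real.log n) + ε * √(2 * Real.log n) + 1) ^ 2 / 2) / n +
        9 * Real.exp (((1 - 2 * ε) * √(2 * Real.log n) + ε * √(2 * Real.log n) + 1) ^ 2 -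
          ((1 - 2 * ε) * √(2 * Real.log n) + ε * √(2 * Real.log n)) ^ 2 / (1 + ε ^ 2 / 40))))
      atTop (𝓝 0) := by
  have hlim : Tendsto (fun L : ℝ ↦ 12 * Real.exp (L * (-(ε ^ 2 / 40) * L + 2) + 1)) atTop
      (𝓝 0) := by
    rw [show (0 : ℝ) = 12 * 0 by simp]
    refine (Real.tendsto_exp_atBot.comp (tendsto_atBot_add_const_right _ _ ?_)).const_mul _
    refine tendsto_id.atTop_mul_atBot₀ (tendsto_atBot_add_const_right _ _ ?_)
    exact (tendsto_const_mul_atBot_of_neg (by nlinarith [sq_pos_of_pos hε])).2 tendsto_id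
  refine squeeze_zero' (Eventually.of_forall fun n ↦ by positivity) ?_
    (hlim.comp tendsto_sqrt_two_log_atTop)
  filter_upwards [eventually_ge_atTop 1] with n hn
  have hn0 : (0 : ℝ) < n := by exact_mod_cast hn
  have hlog : 0 ≤ Real.log n := Real.log_natCast_nonneg n
  simp only [Function.comp_apply]
  set L := √(2 * Real.log n) with hL
  have hL0 : 0 ≤ L := Real.sqrt_nonneg _
  have hnL : (n : ℝ) = Real.exp (L ^ 2 / 2) := by
    rw [hL, Real.sq_sqrt (by positivity), mul_div_cancel_left₀ _ two_ne_zero, Real.exp_log hn0]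
  rw [hnL, show (1 - 2 * ε) * L + ε * L = (1 - ε) * L by ring, mul_add, mul_div_assoc,
    ← Real.exp_sub, mul_left_comm, ← Real.exp_add, mul_left_comm, ← Real.exp_add]
  have h0 : -((ε * L) ^ 2 / (2 * Real.pi ^ 2)) ≤ -(ε ^ 2 * L ^ 2 / 20) := by
    rw [mul_pow]
    refine neg_le_neg (div_le_div_of_nonneg_left (by positivity) (by positivity) ?_)
    nlinarith [Real.pi_lt_d2, Real.pi_pos]
  have hεL : ε * L ≤ L := by nlinarith
  have h1 : -((ε * L) ^ 2 / (2 * Real.pi ^ 2)) + (((1 - ε) * L + 1) ^ 2 / 2 - L ^ 2 / 2)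
      ≤ L * (-(ε ^ 2 / 40) * L + 2) + 1 := by
    have h2 : ((1 - ε) * L + 1) ^ 2 = L ^ 2 - ε * (2 - ε) * L ^ 2 + 2 * (L - ε * L) + 1 := by ring
    have h3 : 0 ≤ ε * (2 - ε) * L ^ 2 := by
      have : 0 ≤ 2 - ε := by linarith
      positivity
    have h4 : 0 ≤ ε ^ 2 * L ^ 2 := by positivity
    have h5 : 0 ≤ ε * L := by positivity
    nlinarith
  have h2 : -((ε * L) ^ 2 / (2 * Real.pi ^ 2)) +
      (((1 - ε) * L + 1) ^ 2 - ((1 - ε) * L) ^ 2 / (1 + ε ^ 2 / 40))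
      ≤ L * (-(ε ^ 2 / 40) * L + 2) + 1 := by
    have h3 : ((1 - ε) * L) ^ 2 * (1 - ε ^ 2 / 40) ≤ ((1 - ε) * L) ^ 2 / (1 + ε ^ 2 / 40) := by
      rw [le_div_iff₀ (by positivity), mul_assoc]
      refine mul_le_of_le_one_right (sq_nonneg _) ?_
      nlinarith [sq_nonneg (ε ^ 2)]
    have h4 : ((1 - ε) * L) ^ 2 ≤ L ^ 2 := by
      refine pow_le_pow_left₀ (mul_nonneg (by linarith) hL0) ?_ 2
      nlinarith
    have h5 : ((1 - ε) * L) ^ 2 * ε ^ 2 ≤ L ^ 2 * ε ^ 2 :=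
      mul_le_mul_of_nonneg_right h4 (sq_nonneg _)
    have h6 : 0 ≤ ε * L := by positivity
    nlinarith
  have h3 := Real.exp_le_exp.2 h1
  have h4 := Real.exp_le_exp.2 h2
  linarith

section Orbit

set_option linter.unusedSectionVars false

variable {X H : Type*} [NormedAddCommGroup X] [NormedSpace ℝ X] [CompleteSpace X]
  [SecondCountableTopology X] [MeasurableSpace X] [BorelSpace X]
  [NormedAddCommGroup H] [InnerProductSpace ℝ H] [CompleteSpace H]
  {ι : H →L[ℝ] X} {μ : Measure X}

/-- The event of lying in all `s n` with `n ≥ m` is contained in each of them, so its probability is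
0; neither summability nor independence is needed. -/
lemma ae_frequently_of_tendsto_measureReal_zero {Ω : Type*} [MeasurableSpace Ω] {P : Measure Ω}
    [IsFiniteMeasure P] {s : ℕ → Set Ω} (hs : Tendsto (fun n ↦ P.real (s n)) atTop (𝓝 0)) :
    ∀ᵐ x ∂P, ∃ᶠ n in atTop, x ∉ s n := by
  simp_rw [frequently_atTop]
  refine ae_all_iff.2 fun m ↦ ?_
  rw [ae_iff]
  have h1 : {x | ¬ ∃ n ≥ m, x ∉ s n} = ⋂ n ≥ m, s n := by
    ext x
    simp
  rw [h1, ← measureReal_eq_zero_iff]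
  refine le_antisymm (ge_of_tendsto hs ?_) measureReal_nonneg
  filter_upwards [eventually_ge_atTop m] with n hn
  exact measureReal_mono (Set.biInter_subset_of_mem hn)

lemma pow_apply_inner_pow_apply {V : H →L[ℝ] H} (hV : ∀ h, ‖V h‖ = ‖h‖) (x y : H) (m n : ℕ) :
    inner ℝ ((V ^ (m + n)) x) ((V ^ m) y) = inner ℝ ((V ^ n) x) y := by
  have h1 : ∀ a b, inner ℝ (V a) (V b) = (inner ℝ a b : ℝ) :=
    LinearMap.norm_map_iff_inner_map_map (𝕜 := ℝ) V |>.1 hV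
  induction m with
  | zero => simp
  | succ m ih =>
    rw [show m + 1 + n = (m + n) + 1 by ring, pow_succ', pow_succ', mul_apply_eq_comp,
      mul_apply_eq_comp, h1, ih]

lemma norm_pow_apply {V : H →L[ℝ] H} (hV : ∀ h, ‖V h‖ = ‖h‖) (n : ℕ) (x : H) :
    ‖(V ^ n) x‖ = ‖x‖ := by
  induction n with
  | zero => simp
  | succ n ih => rw [pow_succ', mul_apply_eq_comp, hV, ih]

lemma IsAELinearExtension.ae_frequently_le (hW : IsAbstractWienerSpace ι μ) {S : H →L[ℝ] H}
    (hS : S ∘L ContinuousLinearMap.adjoint S = ContinuousLinearMap.id ℝ H) {T : X → X}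
    (hT : IsAELinearExtension ι μ S T) {h : H} {g : X → ℝ} (hg : IsWienerFunctional ι μ h g)
    (hh : ‖h‖ = 1)
    (hmix : Tendsto (fun N : ℕ ↦ (inner ℝ ((ContinuousLinearMap.adjoint S ^ N) h) h : ℝ)) atTop
      (𝓝 0)) {ε : ℝ} (hε : 0 < ε) (hε1 : ε ≤ 1 / 3) :
    ∀ᵐ x ∂μ, ∃ᶠ N : ℕ in atTop, (1 - 3 * ε) * √(2 * Real.log N) ≤ g (T^[N] x) := by
  have := hW.isProbabilityMeasure
  have hTμ := hT.measurePreserving hW hS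
  set V := ContinuousLinearMap.adjoint S with hV
  have hVn : ∀ h, ‖V h‖ = ‖h‖ := norm_adjoint_of_comp_adjoint hS
  have hδ0 : (0 : ℝ) < ε ^ 2 / 40 := by positivity
  obtain ⟨m, hm⟩ := eventually_atTop.1 (hmix.eventually_le_const hδ0)
  have hm' : ∀ k ≥ m + 1, (inner ℝ ((V ^ k) h) h : ℝ) ≤ ε ^ 2 / 40 := fun k hk ↦ hm k (by omega)
  set M := m + 1 with hM
  -- Times spaced by `M` have correlations at most `ε² / 40`. Starting at `n` makes the times tend
  -- to infinity with `n`.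
  set A : ℕ → Set X := fun n ↦
    {x | ∀ j : Fin n, g (T^[n + j * M] x) ≤ (1 - 2 * ε) * √(2 * Real.log n)} with hA
  have hAlim : Tendsto (fun n ↦ μ.real (A n)) atTop (𝓝 0) := by
    refine squeeze_zero' (Eventually.of_forall fun n ↦ measureReal_nonneg) ?_
      (tendsto_maximum_bound hε (by linarith))
    filter_upwards [eventually_ge_atTop 2] with n hn
    have : Nonempty (Fin n) := ⟨⟨0, by omega⟩⟩
    have hL : 0 < √(2 * Real.log n) := by
      have : 0 < Real.log n := Real.log_pos (by exact_mod_cast hn)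
      positivity
    have h1 := hW.measureReal_forall_le_le
      (fun j : Fin n ↦ hT.isWienerFunctional_iterate hTμ hg (n + j * M))
      (fun j ↦ (norm_pow_apply hVn _ _).trans hh) hδ0.le (fun i j hij ↦ ?_)
      (a := (1 - 2 * ε) * √(2 * Real.log n)) (mul_pos hε hL) (by nlinarith)
    · simpa only [Fintype.card_fin] using h1
    · have key {i j : Fin n} (hij : i < j) :
          inner ℝ ((V ^ (n + j * M)) h) ((V ^ (n + i * M)) h) ≤ ε ^ 2 / 40 := by
        obtain ⟨d, hd⟩ := Nat.exists_eq_add_of_lt (Fin.lt_def.1 hij)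
        have h2 : n + (j : ℕ) * M = n + i * M + (d + 1) * M := by rw [hd]; ring
        rw [h2, pow_apply_inner_pow_apply hVn]
        exact hm' _ (Nat.le_mul_of_pos_left _ (by omega))
      rcases lt_or_gt_of_ne hij with h2 | h2
      · rw [real_inner_comm]
        exact key h2
      · exact key h2
  -- The sampled times are at most `n (M + 1)`, so the normalization at such a time exceeds that at
  -- `n` by a bounded amount, which the third `ε` absorbs.
  have hev : ∀ᶠ n : ℕ in atTop,
      (1 - 3 * ε) * √(2 * Real.log (M + 1)) ≤ ε * √(2 * Real.log n) :=
    (tendsto_sqrt_two_log_atTop.const_mul_atTop hε).eventually_ge_atTop _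
  filter_upwards [ae_frequently_of_tendsto_measureReal_zero hAlim] with x hx
  rw [frequently_atTop]
  intro N₀
  obtain ⟨n, hxn, hn, hn0⟩ := (hx.and_eventually
    (hev.and ((eventually_ge_atTop N₀).and (eventually_ge_atTop 1)))).exists
  obtain ⟨j, hj⟩ : ∃ j : Fin n, (1 - 2 * ε) * √(2 * Real.log n) < g (T^[n + j * M] x) := by
    simpa [hA] using hxn
  refine ⟨n + j * M, hn0.1.trans (Nat.le_add_right _ _), le_trans ?_ hj.le⟩
  have hn1 : (0 : ℝ) < n := by exact_mod_cast hn0.2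
  have h1 : √(2 * Real.log ((n + j * M : ℕ) : ℝ))
      ≤ √(2 * Real.log n) + √(2 * Real.log (M + 1)) := by
    have h2 : Real.log ((n + j * M : ℕ) : ℝ) ≤ Real.log n + Real.log (M + 1) := by
      rw [← Real.log_mul hn1.ne' (by positivity)]
      refine Real.log_le_log (Nat.cast_pos.2 (Nat.add_pos_left hn0.2 _)) ?_
      have h3 : n + j * M ≤ n * (M + 1) := by
        have := Nat.mul_le_mul_right M j.2.le
        linarith
      exact_mod_cast h3
    have h3 : 0 ≤ Real.log n := Real.log_natCast_nonneg n
    have h4 : 0 ≤ Real.log ((M : ℝ) + 1) := Real.log_nonneg (by simp)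
    refine Real.sqrt_le_iff.2 ⟨by positivity, ?_⟩
    have h5 := Real.sq_sqrt (by positivity : 0 ≤ 2 * Real.log n)
    have h6 := Real.sq_sqrt (by positivity : 0 ≤ 2 * Real.log ((M : ℝ) + 1))
    nlinarith [mul_nonneg (Real.sqrt_nonneg (2 * Real.log n))
      (Real.sqrt_nonneg (2 * Real.log ((M : ℝ) + 1)))]
  have h2 := mul_le_mul_of_nonneg_left h1 (by linarith : 0 ≤ 1 - 3 * ε)
  linarith

end Orbit

/-! ## Strassen's law for mixing coisometries -/

section StrassenForward

set_option linter.unusedSectionVars false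

variable {X H : Type*} [NormedAddCommGroup X] [NormedSpace ℝ X] [CompleteSpace X]
  [SecondCountableTopology X] [MeasurableSpace X] [BorelSpace X]
  [NormedAddCommGroup H] [InnerProductSpace ℝ H] [CompleteSpace H]
  {ι : H →L[ℝ] X} {μ : Measure X} {S : H →L[ℝ] H} {T : X → X}

lemma isClosed_strassenLimitSet (T : X → X) (x : X) : IsClosed (strassenLimitSet T x) :=
  isClosed_setOfPred_clusterPt

lemma strassenLimitSet_subset_closure_range (T : X → X) (x : X) :
    strassenLimitSet T x ⊆ closure (Set.range fun N : ℕ ↦ (√(2 * Real.log N))⁻¹ • T^[N] x) :=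
  fun _ hy ↦ isClosed_closure.mem_of_mapClusterPt hy
    (Eventually.of_forall fun N ↦ subset_closure ⟨N, rfl⟩)

lemma eventually_sqrt_two_log_pos : ∀ᶠ N : ℕ in atTop, 0 < √(2 * Real.log N) :=
  tendsto_sqrt_two_log_atTop.eventually_gt_atTop 0

lemma IsAELinearExtension.isCenteredGaussian_iterate (hW : IsAbstractWienerSpace ι μ)
    (hS : S ∘L ContinuousLinearMap.adjoint S = ContinuousLinearMap.id ℝ H)
    (hT : IsAELinearExtension ι μ S T) {h : H} {g : X → ℝ} (hg : IsWienerFunctional ι μ h g)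
    (N : ℕ) : IsCenteredGaussian μ (fun x ↦ g (T^[N] x)) ‖h‖ := by
  have h1 := hW.isCenteredGaussian (hT.isWienerFunctional_iterate (hT.measurePreserving hW hS) hg N)
  rwa [norm_pow_apply (norm_adjoint_of_comp_adjoint hS)] at h1

lemma IsAELinearExtension.ae_forall_dual_le (hW : IsAbstractWienerSpace ι μ)
    (hS : S ∘L ContinuousLinearMap.adjoint S = ContinuousLinearMap.id ℝ H)
    (hT : IsAELinearExtension ι μ S T) (ℓ : StrongDual ℝ X) :
    ∀ᵐ x ∂μ, ∀ y ∈ strassenLimitSet T x, ℓ y ≤ ‖dualEmbedding ι ℓ‖ := by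
  have := hW.isProbabilityMeasure
  have h1 (k : ℕ) : ∀ᵐ x ∂μ, ∀ᶠ N : ℕ in atTop,
      |ℓ (T^[N] x)| ≤ (‖dualEmbedding ι ℓ‖ + 1 / ((k : ℝ) + 1)) * √(2 * Real.log N) :=
    ae_eventually_abs_le
      (fun N ↦ hT.isCenteredGaussian_iterate hW hS (IsWienerFunctional.dual ℓ) N)
      (fun N ↦ (abs_of_nonneg (norm_nonneg _)).le) (lt_add_of_pos_right _ Nat.one_div_pos_of_nat)
  filter_upwards [ae_all_iff.2 h1] with x hx y hy
  refine le_of_forall_pos_lt_add fun ε hε ↦ ?_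
  obtain ⟨k, hk⟩ := exists_nat_one_div_lt hε
  have h2 : IsClosed {y | ℓ y ≤ ‖dualEmbedding ι ℓ‖ + 1 / ((k : ℝ) + 1)} :=
    isClosed_le ℓ.continuous continuous_const
  have h3 := h2.mem_of_mapClusterPt hy (by
    filter_upwards [hx k, eventually_sqrt_two_log_pos] with N hN hN0
    rw [map_smul, smul_eq_mul, inv_mul_le_iff₀ hN0, mul_comm]
    exact (le_abs_self _).trans hN)
  exact (show ℓ y ≤ _ from h3).trans_lt (by linarith)

/-- The null set of the bound depends on `ℓ`. By Lindelöf, countably many of the open half-spaces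
`{‖ι* ℓ‖ < ℓ y}` already cover their union, which contains every point off the ball. -/
lemma IsAELinearExtension.ae_strassenLimitSet_subset (hW : IsAbstractWienerSpace ι μ)
    (hS : S ∘L ContinuousLinearMap.adjoint S = ContinuousLinearMap.id ℝ H)
    (hT : IsAELinearExtension ι μ S T) :
    ∀ᵐ x ∂μ, strassenLimitSet T x ⊆ ι '' Metric.closedBall (0 : H) 1 := by
  obtain ⟨D, hD, hU⟩ := TopologicalSpace.isOpen_iUnion_countable
    (fun ℓ : StrongDual ℝ X ↦ {y : X | ‖dualEmbedding ι ℓ‖ < ℓ y})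
    (fun ℓ ↦ isOpen_lt continuous_const ℓ.continuous)
  have h1 := (ae_ball_iff hD).2 fun ℓ (_ : ℓ ∈ D) ↦ hT.ae_forall_dual_le hW hS ℓ
  filter_upwards [h1] with x hx y hy
  have h2 (ℓ : StrongDual ℝ X) : ℓ y ≤ 1 * ‖dualEmbedding ι ℓ‖ := by
    rw [one_mul]
    by_contra! h
    have h3 : y ∈ ⋃ ℓ : StrongDual ℝ X, {y : X | ‖dualEmbedding ι ℓ‖ < ℓ y} :=
      Set.mem_iUnion.2 ⟨ℓ, h⟩
    rw [← hU] at h3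
    obtain ⟨ℓ', hℓ', h4⟩ := Set.mem_iUnion₂.1 h3
    exact (not_le.2 h4) (hx ℓ' hℓ' y hy)
  obtain ⟨h, hh, rfl⟩ := exists_mem_of_forall_dual_le zero_le_one h2
  exact ⟨h, by simpa using hh, rfl⟩

/-- Compactness turns the frequent lower bound on `ℓ` into a limit point `ι z` with `‖z‖ ≤ 1` and
`⟪h, z⟫` nearly 1. Then `‖z - h‖² ≤ 2 - 2 ⟪h, z⟫` is small, and the limit set is closed. -/
lemma IsAELinearExtension.ae_dualEmbedding_mem (hW : IsAbstractWienerSpace ι μ)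
    (hS : S ∘L ContinuousLinearMap.adjoint S = ContinuousLinearMap.id ℝ H)
    (hT : IsAELinearExtension ι μ S T)
    (hmix : ∀ x y : H, Tendsto (fun N : ℕ ↦ (inner ℝ ((S ^ N) x) y : ℝ)) atTop (𝓝 0))
    {ℓ : StrongDual ℝ X} (hℓ : ‖dualEmbedding ι ℓ‖ = 1) :
    ∀ᵐ x ∂μ, ι (dualEmbedding ι ℓ) ∈ strassenLimitSet T x := by
  set h := dualEmbedding ι ℓ with hh
  have hmix' : Tendsto (fun N : ℕ ↦ (inner ℝ ((ContinuousLinearMap.adjoint S ^ N) h) h : ℝ)) atTop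
      (𝓝 0) := by
    refine (hmix h h).congr fun N ↦ ?_
    rw [← ContinuousLinearMap.star_eq_adjoint, ← star_pow, ContinuousLinearMap.star_eq_adjoint,
      ContinuousLinearMap.adjoint_inner_left, real_inner_comm]
  -- The shift by 3 respects the requirement `ε ≤ 1 / 3`.
  have hε0 (k : ℕ) : (0 : ℝ) < 1 / ((k : ℝ) + 3) := by positivity
  have h1 (k : ℕ) := hT.ae_frequently_le hW hS (IsWienerFunctional.dual ℓ) hℓ hmix'
    (hε0 k) (one_div_le_one_div_of_le (by norm_num) (by linarith [(Nat.cast_nonneg k : (0:ℝ) ≤ k)]))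
  filter_upwards [ae_all_iff.2 h1, hT.ae_strassenLimitSet_subset hW hS,
    hW.ae_isCompact_closure (hT.measurePreserving hW hS)] with x hx hsub hK
  have h2 (k : ℕ) : ∃ z : H, ‖z - h‖ ^ 2 ≤ 6 * (1 / ((k : ℝ) + 3)) ∧
      ι z ∈ strassenLimitSet T x := by
    have h3 : IsClosed {y : X | 1 - 3 * (1 / ((k : ℝ) + 3)) ≤ ℓ y} :=
      isClosed_le continuous_const ℓ.continuous
    obtain ⟨y, hy, hyx⟩ := (hK.inter_right h3).exists_mapClusterPt_of_frequently (l := atTop)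
      (f := fun N : ℕ ↦ (√(2 * Real.log N))⁻¹ • T^[N] x) (by
        refine ((hx k).and_eventually eventually_sqrt_two_log_pos).mono fun N hN ↦
          ⟨subset_closure ⟨N, rfl⟩, ?_⟩
        rw [Set.mem_ofPred_eq, map_smul, smul_eq_mul, le_inv_mul_iff₀ hN.2, mul_comm]
        exact hN.1)
    obtain ⟨z, hz, rfl⟩ := hsub hyx
    refine ⟨z, ?_, hyx⟩
    have hz1 : ‖z‖ ≤ 1 := by simpa using hz
    have h4 : 1 - 3 * (1 / ((k : ℝ) + 3)) ≤ inner ℝ h z := by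
      rw [hh, inner_dualEmbedding]
      exact hy.2
    rw [norm_sub_sq_real, real_inner_comm, hℓ]
    nlinarith [norm_nonneg z]
  choose z hz hzx using h2
  have h3 : Tendsto z atTop (𝓝 h) := by
    rw [tendsto_iff_norm_sub_tendsto_zero]
    have h4 : Tendsto (fun k ↦ ‖z k - h‖ ^ 2) atTop (𝓝 0) := by
      refine squeeze_zero (fun k ↦ sq_nonneg _) hz ?_
      have h5 := (tendsto_one_div_add_atTop_nhds_zero_nat (𝕜 := ℝ)).comp (tendsto_add_atTop_nat 2)
      have h6 := h5.const_mul 6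
      rw [mul_zero] at h6
      refine h6.congr fun k ↦ ?_
      simp only [Function.comp_apply]
      push_cast
      ring_nf
    have h7 := (Real.continuous_sqrt.tendsto 0).comp h4
    simpa [Function.comp_def, Real.sqrt_sq (norm_nonneg _)] using h7
  exact (isClosed_strassenLimitSet T x).mem_of_tendsto ((ι.continuous.tendsto h).comp h3)
    (Eventually.of_forall hzx)

/-- Separability of `X` yields one null set valid for a countable dense family of points, and
closedness of the limit set does the rest. -/
lemma IsAELinearExtension.ae_image_sphere_subset (hW : IsAbstractWienerSpace ι μ)
    (hS : S ∘L ContinuousLinearMap.adjoint S = ContinuousLinearMap.id ℝ H)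
    (hT : IsAELinearExtension ι μ S T)
    (hmix : ∀ x y : H, Tendsto (fun N : ℕ ↦ (inner ℝ ((S ^ N) x) y : ℝ)) atTop (𝓝 0)) :
    ∀ᵐ x ∂μ, ∀ h : H, ‖h‖ = 1 → ι h ∈ strassenLimitSet T x := by
  set D : Set X := (fun ℓ ↦ ι (dualEmbedding ι ℓ)) '' {ℓ | ‖dualEmbedding ι ℓ‖ = 1} with hD
  obtain ⟨D₀, hD₀, hc, hDc⟩ :=
    (TopologicalSpace.IsSeparable.of_separableSpace D).exists_countable_dense_subset
  have h1 : ∀ᵐ x ∂μ, ∀ y ∈ D₀, y ∈ strassenLimitSet T x := by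
    refine (ae_ball_iff hc).2 fun y hy ↦ ?_
    obtain ⟨ℓ, hℓ, rfl⟩ := hD₀ hy
    exact hT.ae_dualEmbedding_mem hW hS hmix hℓ
  filter_upwards [h1] with x hx h hh
  have h2 : D ⊆ strassenLimitSet T x :=
    hDc.trans (closure_minimal hx (isClosed_strassenLimitSet T x))
  obtain ⟨ℓ, hℓ⟩ := exists_seq_dualEmbedding hW.injective h
    (b := fun k : ℕ ↦ 1 / ((k : ℝ) + 1)) (fun k ↦ Nat.one_div_pos_of_nat)
  have h3 : Tendsto (fun k ↦ dualEmbedding ι (ℓ k)) atTop (𝓝 h) := by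
    rw [tendsto_iff_norm_sub_tendsto_zero]
    exact squeeze_zero (fun _ ↦ norm_nonneg _) (fun k ↦ (hℓ k).le)
      tendsto_one_div_add_atTop_nhds_zero_nat
  have h4 : Tendsto (fun k ↦ ‖dualEmbedding ι (ℓ k)‖⁻¹ • dualEmbedding ι (ℓ k)) atTop (𝓝 h) := by
    have h5 := (h3.norm.inv₀ (by rw [hh]; exact one_ne_zero)).smul h3
    rwa [hh, inv_one, one_smul] at h5
  have h6 : ∀ᶠ k in atTop, ‖dualEmbedding ι (ℓ k)‖ ≠ 0 :=
    h3.norm.eventually_ne (by rw [hh]; exact one_ne_zero)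
  refine (isClosed_strassenLimitSet T x).mem_of_tendsto ((ι.continuous.tendsto h).comp h4) ?_
  filter_upwards [h6] with k hk
  refine h2 ⟨‖dualEmbedding ι (ℓ k)‖⁻¹ • ℓ k, ?_, ?_⟩
  · rw [Set.mem_ofPred_eq, map_smul, norm_smul, norm_inv, norm_norm, inv_mul_cancel₀ hk]
  · simp

/-- A coisometry of `H` whose powers tend weakly to zero satisfies Strassen's law. -/
theorem IsAELinearExtension.hasStrassenLaw (hW : IsAbstractWienerSpace ι μ)
    (hS : S ∘L ContinuousLinearMap.adjoint S = ContinuousLinearMap.id ℝ H)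
    (hT : IsAELinearExtension ι μ S T)
    (hmix : ∀ x y : H, Tendsto (fun N : ℕ ↦ (inner ℝ ((S ^ N) x) y : ℝ)) atTop (𝓝 0)) :
    HasStrassenLaw ι μ T := by
  filter_upwards [hT.ae_image_sphere_subset hW hS hmix, hT.ae_strassenLimitSet_subset hW hS,
    hW.ae_isCompact_closure (hT.measurePreserving hW hS)] with x hx hsub hK
  refine hsub.antisymm ?_
  rintro _ ⟨h, hh, rfl⟩
  have hh1 : ‖h‖ ≤ 1 := by simpa using hh
  have hC : IsCompact (strassenLimitSet T x) := hK.of_isClosed_subset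
    (isClosed_strassenLimitSet T x) (strassenLimitSet_subset_closure_range T x)
  -- Without unit vectors the ball is `{0}`, and compactness provides at least one limit point.
  rcases subsingleton_or_nontrivial H with hH | hH
  · obtain ⟨y, -, hy⟩ := hK.exists_mapClusterPt_of_frequently (l := atTop)
      (f := fun N : ℕ ↦ (√(2 * Real.log N))⁻¹ • T^[N] x)
      (Frequently.of_forall fun N ↦ subset_closure ⟨N, rfl⟩)
    obtain ⟨z, -, rfl⟩ := hsub hy
    rwa [Subsingleton.elim h z]
  obtain ⟨e, he⟩ := exists_norm_eq H zero_le_one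
  set V := ContinuousLinearMap.adjoint S with hV
  have hweak (y : H) : Tendsto (fun N : ℕ ↦ (inner ℝ y ((V ^ N) e) : ℝ)) atTop (𝓝 0) := by
    refine (hmix y e).congr fun N ↦ ?_
    rw [hV, ← ContinuousLinearMap.star_eq_adjoint, ← star_pow,
      ContinuousLinearMap.star_eq_adjoint, ContinuousLinearMap.adjoint_inner_right]
  -- The vector `V^N e` tends weakly to 0, hence is asymptotically orthogonal to `h`. So `h + c •
  -- V^N e` has norm tending to 1 and tends weakly to `h`; compactness of the limit set in `X` turns
  -- weak into strong convergence along a subsequence.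
  set c := √(1 - ‖h‖ ^ 2) with hc
  have hc2 : c ^ 2 = 1 - ‖h‖ ^ 2 := Real.sq_sqrt (by nlinarith [norm_nonneg h])
  set u : ℕ → H := fun N ↦ h + c • (V ^ N) e with hu
  have hun : Tendsto (fun N ↦ ‖u N‖) atTop (𝓝 1) := by
    have h1 (N : ℕ) : ‖u N‖ = √(1 + 2 * c * inner ℝ h ((V ^ N) e)) := by
      rw [← Real.sqrt_sq (norm_nonneg (u N)), hu, norm_add_sq_real, norm_smul,
        norm_pow_apply (norm_adjoint_of_comp_adjoint hS), he, inner_smul_right, mul_one,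
        Real.norm_eq_abs, sq_abs, hc2]
      ring_nf
    simp_rw [h1]
    have h2 := ((hweak h).const_mul (2 * c)).const_add 1
    rw [mul_zero, add_zero] at h2
    have h3 := (Real.continuous_sqrt.tendsto 1).comp h2
    rwa [Real.sqrt_one] at h3
  have hu0 : ∀ᶠ N in atTop, ‖u N‖ ≠ 0 := hun.eventually_ne one_ne_zero
  obtain ⟨y, hyC, hy⟩ := hC.exists_mapClusterPt_of_frequently (l := atTop)
    (f := fun N : ℕ ↦ ι (‖u N‖⁻¹ • u N)) (hu0.frequently.mono fun N hN ↦ hx _ (by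
      rw [norm_smul, norm_inv, norm_norm, inv_mul_cancel₀ hN]))
  have hyh : y = ι h := by
    refine eq_of_forall_dual_eq fun ℓ ↦ ?_
    have h1 : Tendsto (fun N ↦ ℓ (ι (‖u N‖⁻¹ • u N))) atTop (𝓝 (ℓ (ι h))) := by
      have h2 := (hun.inv₀ one_ne_zero).mul
        (((hweak (dualEmbedding ι ℓ)).const_mul c).const_add (ℓ (ι h)))
      rw [mul_zero, add_zero, inv_one, one_mul] at h2
      refine h2.congr fun N ↦ ?_
      simp only [hu, map_smul, map_add, smul_eq_mul, inner_dualEmbedding]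
    have h3 : MapClusterPt (ℓ y) atTop (fun N ↦ ℓ (ι (‖u N‖⁻¹ • u N))) :=
      hy.continuousAt_comp ℓ.continuous.continuousAt
    exact eq_of_nhds_neBot (NeBot.mono h3 (inf_le_inf_left _ h1))
  rwa [← hyh]

end StrassenForward

/-! ## Isometries without weak mixing have a compact intertwiner -/

section Intertwiner

set_option linter.unusedSectionVars false

variable {H : Type*} [NormedAddCommGroup H] [InnerProductSpace ℝ H] [CompleteSpace H]

lemma inner_pow_apply (S : H →L[ℝ] H) (k : ℕ) (x y : H) :
    (inner ℝ ((S ^ k) x) y : ℝ) = inner ℝ x ((ContinuousLinearMap.adjoint S ^ k) y) := by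
  rw [← ContinuousLinearMap.star_eq_adjoint, ← star_pow, ContinuousLinearMap.star_eq_adjoint,
    ContinuousLinearMap.adjoint_inner_right]

lemma exists_tendsto_ultrafilter_of_abs_le (U : Ultrafilter ℕ) {f : ℕ → ℝ} {C : ℝ}
    (hf : ∀ N, |f N| ≤ C) : ∃ a, Tendsto f U (𝓝 a) := by
  obtain ⟨a, -, ha⟩ := (isCompact_Icc (a := -C) (b := C)).ultrafilter_le_nhds (U.map f)
    (by
      rw [Ultrafilter.coe_map]
      exact tendsto_principal.2 (Eventually.of_forall fun N ↦ abs_le.1 (hf N)))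
  exact ⟨a, ha⟩

/-- The quadratic mean of `⟪V ^ k y, ·⟫` over `1 ≤ k ≤ N`, polarized. -/
noncomputable def orbitForm (V : H →L[ℝ] H) (y : H) (N : ℕ) (u v : H) : ℝ :=
  (N : ℝ)⁻¹ * ∑ k ∈ Finset.Icc 1 N, inner ℝ ((V ^ k) y) u * inner ℝ ((V ^ k) y) v

variable {V : H →L[ℝ] H} {y : H}

lemma orbitForm_add_left (N : ℕ) (u u' v : H) :
    orbitForm V y N (u + u') v = orbitForm V y N u v + orbitForm V y N u' v := by
  simp only [orbitForm, inner_add_right, add_mul, Finset.sum_add_distrib, mul_add]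

lemma orbitForm_smul_left (N : ℕ) (c : ℝ) (u v : H) :
    orbitForm V y N (c • u) v = c * orbitForm V y N u v := by
  simp only [orbitForm, inner_smul_right, Finset.mul_sum]
  exact Finset.sum_congr rfl fun _ _ ↦ by ring

lemma orbitForm_comm (N : ℕ) (u v : H) : orbitForm V y N u v = orbitForm V y N v u := by
  simp only [orbitForm, mul_comm]

lemma inv_mul_sum_Icc_le {f : ℕ → ℝ} {C : ℝ} (hC : 0 ≤ C) (hf : ∀ k, f k ≤ C) (N : ℕ) :
    (N : ℝ)⁻¹ * ∑ k ∈ Finset.Icc 1 N, f k ≤ C := by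
  have h1 : ∑ k ∈ Finset.Icc 1 N, f k ≤ N * C := by
    simpa using Finset.sum_le_card_nsmul (Finset.Icc 1 N) f C fun k _ ↦ hf k
  rcases Nat.eq_zero_or_pos N with rfl | hN
  · simpa using hC
  · rwa [inv_mul_le_iff₀ (Nat.cast_pos.2 hN)]

lemma abs_orbitForm_le (hV : ∀ h, ‖V h‖ = ‖h‖) (N : ℕ) (u v : H) :
    |orbitForm V y N u v| ≤ ‖y‖ ^ 2 * ‖u‖ * ‖v‖ := by
  rw [orbitForm, abs_mul, abs_of_nonneg (by positivity : (0 : ℝ) ≤ (N : ℝ)⁻¹)]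
  refine (mul_le_mul_of_nonneg_left (Finset.abs_sum_le_sum_abs _ _) (by positivity)).trans
    (inv_mul_sum_Icc_le (by positivity) (fun k ↦ ?_) N)
  have h1 := abs_real_inner_le_norm ((V ^ k) y) u
  have h2 := abs_real_inner_le_norm ((V ^ k) y) v
  rw [norm_pow_apply hV] at h1 h2
  rw [abs_mul]
  calc _ ≤ (‖y‖ * ‖u‖) * (‖y‖ * ‖v‖) := mul_le_mul h1 h2 (abs_nonneg _) (by positivity)
    _ = _ := by ring

lemma orbitForm_self_nonneg (N : ℕ) (u : H) : 0 ≤ orbitForm V y N u u :=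
  mul_nonneg (by positivity) (Finset.sum_nonneg fun _ _ ↦ mul_self_nonneg _)

lemma orbitForm_sq_le (N : ℕ) (u v : H) :
    orbitForm V y N u v ^ 2 ≤ orbitForm V y N u u * orbitForm V y N v v := by
  have h1 := Finset.sum_mul_sq_le_sq_mul_sq (Finset.Icc 1 N)
    (fun k ↦ (inner ℝ ((V ^ k) y) u : ℝ)) (fun k ↦ (inner ℝ ((V ^ k) y) v : ℝ))
  have h2 := mul_le_mul_of_nonneg_left h1 (sq_nonneg (N : ℝ)⁻¹)
  simp only [sq (inner ℝ _ _ : ℝ)] at h2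
  simp only [orbitForm]
  calc _ = (N : ℝ)⁻¹ ^ 2 * (∑ k ∈ Finset.Icc 1 N,
        inner ℝ ((V ^ k) y) u * inner ℝ ((V ^ k) y) v) ^ 2 := by ring
    _ ≤ _ := h2
    _ = _ := by ring

/-- Bessel's inequality for each `V^k y`; this bounds the trace of the limit form. -/
lemma sum_orbitForm_le (hV : ∀ h, ‖V h‖ = ‖h‖) (N : ℕ) {n : ℕ} {e : Fin n → H}
    (he : Orthonormal ℝ e) : ∑ i, orbitForm V y N (e i) (e i) ≤ ‖y‖ ^ 2 := by
  simp only [orbitForm]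
  rw [← Finset.mul_sum, Finset.sum_comm]
  refine inv_mul_sum_Icc_le (sq_nonneg _) (fun k ↦ ?_) N
  have h1 := he.sum_inner_products_le (x := (V ^ k) y) (s := Finset.univ)
  rw [norm_pow_apply hV] at h1
  refine le_trans (le_of_eq (Finset.sum_congr rfl fun i _ ↦ ?_)) h1
  rw [Real.norm_eq_abs, sq_abs, real_inner_comm, sq]

/-- Applying `V*` to both arguments shifts the summation index by one, so only two boundary terms
remain, divided by `N`. -/
lemma tendsto_orbitForm_adjoint_sub (hV : ∀ h, ‖V h‖ = ‖h‖) (u v : H) :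
    Tendsto (fun N ↦ orbitForm V y N (ContinuousLinearMap.adjoint V u)
      (ContinuousLinearMap.adjoint V v) - orbitForm V y N u v) atTop (𝓝 0) := by
  set C := ‖y‖ ^ 2 * ‖u‖ * ‖v‖ with hC
  have hb (k : ℕ) : |inner ℝ ((V ^ k) y) u * inner ℝ ((V ^ k) y) v| ≤ C := by
    have h1 := abs_real_inner_le_norm ((V ^ k) y) u
    have h2 := abs_real_inner_le_norm ((V ^ k) y) v
    rw [norm_pow_apply hV] at h1 h2
    rw [abs_mul]
    calc _ ≤ (‖y‖ * ‖u‖) * (‖y‖ * ‖v‖) := mul_le_mul h1 h2 (abs_nonneg _) (by positivity)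
      _ = _ := by rw [hC]; ring
  have hlim : Tendsto (fun N : ℕ ↦ (N : ℝ)⁻¹ * (2 * C)) atTop (𝓝 0) := by
    simpa using tendsto_inv_atTop_nhds_zero_nat.mul_const (2 * C)
  refine squeeze_zero_norm (fun N ↦ ?_) hlim
  set f : ℕ → ℝ := fun k ↦ inner ℝ ((V ^ k) y) u * inner ℝ ((V ^ k) y) v with hf
  have h1 : orbitForm V y N (ContinuousLinearMap.adjoint V u) (ContinuousLinearMap.adjoint V v)
      - orbitForm V y N u v = (N : ℝ)⁻¹ * (f (N + 1) - f 1) := by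
    simp only [orbitForm, ContinuousLinearMap.adjoint_inner_right]
    rw [← mul_sub, ← Finset.sum_sub_distrib]
    congr 1
    have h2 : ∀ k ∈ Finset.Icc 1 N, inner ℝ (V ((V ^ k) y)) u * inner ℝ (V ((V ^ k) y)) v -
        inner ℝ ((V ^ k) y) u * inner ℝ ((V ^ k) y) v = f (k + 1) - f k := fun k _ ↦ by
      simp only [hf, pow_succ', mul_apply_eq_comp]
    rw [Finset.sum_congr rfl h2]
    induction N with
    | zero => simp
    | succ N ih =>
      rw [Finset.sum_Icc_succ_top (by omega), ih fun k hk ↦ h2 k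
        (Finset.Icc_subset_Icc_right (Nat.le_succ N) hk)]
      ring
  rw [h1, norm_mul, norm_inv, Real.norm_natCast, Real.norm_eq_abs]
  refine mul_le_mul_of_nonneg_left ?_ (by positivity)
  calc |f (N + 1) - f 1| ≤ |f (N + 1)| + |f 1| := abs_sub _ _
    _ ≤ 2 * C := by linarith [hb (N + 1), hb 1]

/-- If the isometry `V` is not weakly mixing, then it commutes with a nonzero positive operator of
finite trace. -/
lemma exists_commuting_trace_class (hV : ∀ h, ‖V h‖ = ‖h‖) {x y : H}
    (hxy : ¬ Tendsto (fun N : ℕ ↦ (N : ℝ)⁻¹ * ∑ k ∈ Finset.Icc 1 N, |inner ℝ x ((V ^ k) y)|)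
      atTop (𝓝 0)) :
    ∃ A : H →L[ℝ] H, A x ≠ 0 ∧ (∀ u, A (V u) = V (A u)) ∧
      (∀ u, ‖A u‖ ^ 2 ≤ ‖y‖ ^ 2 * inner ℝ (A u) u) ∧
      ∀ (n : ℕ) (e : Fin n → H), Orthonormal ℝ e → ∑ i, inner ℝ (A (e i)) (e i) ≤ ‖y‖ ^ 2 := by
  obtain ⟨ε, hε, hfreq⟩ : ∃ ε > 0, ∃ᶠ N : ℕ in atTop,
      ε ≤ (N : ℝ)⁻¹ * ∑ k ∈ Finset.Icc 1 N, |inner ℝ x ((V ^ k) y)| := by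
    by_contra! h
    refine hxy (Metric.tendsto_nhds.2 fun ε hε ↦ ?_)
    filter_upwards [h ε hε] with N hN
    rw [Real.dist_0_eq_abs, abs_of_nonneg (by positivity)]
    exact hN
  have := frequently_iff_neBot.1 hfreq
  -- Along an ultrafilter the bounded forms converge for all pairs of arguments at once, and this
  -- one keeps the means above `ε`.
  obtain ⟨U, hU⟩ := Ultrafilter.exists_le (atTop ⊓ 𝓟 {N : ℕ |
    ε ≤ (N : ℝ)⁻¹ * ∑ k ∈ Finset.Icc 1 N, |inner ℝ x ((V ^ k) y)|})
  have hUtop : (U : Filter ℕ) ≤ atTop := hU.trans inf_le_left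
  have hUε : ∀ᶠ N : ℕ in U, ε ≤ (N : ℝ)⁻¹ * ∑ k ∈ Finset.Icc 1 N, |inner ℝ x ((V ^ k) y)| :=
    le_principal_iff.1 (hU.trans inf_le_right)
  choose B hB using fun u v ↦ exists_tendsto_ultrafilter_of_abs_le U
    (fun N ↦ abs_orbitForm_le (y := y) hV N u v)
  have hcomm (u v : H) : B u v = B v u :=
    tendsto_nhds_unique (hB u v) (by simpa only [orbitForm_comm] using hB v u)
  have hadd (u u' v : H) : B (u + u') v = B u v + B u' v :=
    tendsto_nhds_unique (hB _ v) (by simpa only [orbitForm_add_left] using (hB u v).add (hB u' v))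
  have hsmul (c : ℝ) (u v : H) : B (c • u) v = c * B u v :=
    tendsto_nhds_unique (hB _ v) (by simpa only [orbitForm_smul_left] using (hB u v).const_mul c)
  have hbound (u v : H) : |B u v| ≤ ‖y‖ ^ 2 * ‖u‖ * ‖v‖ :=
    le_of_tendsto (hB u v).abs (Eventually.of_forall fun N ↦ abs_orbitForm_le hV N u v)
  let B' : H →L[ℝ] H →L[ℝ] ℝ := LinearMap.mkContinuous₂
    (LinearMap.mk₂ ℝ B hadd hsmul (fun u v v' ↦ by rw [hcomm, hadd, hcomm v, hcomm v'])
      (fun c u v ↦ by rw [hcomm, hsmul, hcomm v, smul_eq_mul])) (‖y‖ ^ 2) hbound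
  let A : H →L[ℝ] H := InnerProductSpace.continuousLinearMapOfBilin (𝕜 := ℝ) B'
  have hA (u v : H) : inner ℝ (A u) v = B u v :=
    InnerProductSpace.continuousLinearMapOfBilin_apply (𝕜 := ℝ) B' u v
  have hadj (u v : H) : B (ContinuousLinearMap.adjoint V u) (ContinuousLinearMap.adjoint V v)
      = B u v := by
    have h1 := (hB (ContinuousLinearMap.adjoint V u) (ContinuousLinearMap.adjoint V v)).sub (hB u v)
    exact sub_eq_zero.1 (tendsto_nhds_unique h1
      ((tendsto_orbitForm_adjoint_sub hV u v).mono_left hUtop))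
  have hVV (u : H) : ContinuousLinearMap.adjoint V (V u) = u := by
    have h1 := (ContinuousLinearMap.norm_map_iff_adjoint_comp_self V).1 hV
    exact congrArg (fun W : H →L[ℝ] H ↦ W u) h1
  refine ⟨A, fun h0 ↦ ?_, fun u ↦ ?_, fun u ↦ ?_, fun n e he ↦ ?_⟩
  -- The square of a mean is at most the mean of the squares.
  · have h1 : ε ^ 2 ≤ B x x := by
      refine ge_of_tendsto (hB x x) (hUε.mono fun N hN ↦ ?_)
      have h2 : ((N : ℝ)⁻¹ * ∑ k ∈ Finset.Icc 1 N, |inner ℝ x ((V ^ k) y)|) ^ 2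
          ≤ orbitForm V y N x x := by
        have h3 := sq_sum_le_card_mul_sum_sq (s := Finset.Icc 1 N)
          (f := fun k ↦ |(inner ℝ x ((V ^ k) y) : ℝ)|)
        rw [Nat.card_Icc, Nat.add_sub_cancel] at h3
        simp only [sq_abs] at h3
        rw [mul_pow]
        refine (mul_le_mul_of_nonneg_left h3 (sq_nonneg _)).trans (le_of_eq ?_)
        simp only [orbitForm, real_inner_comm x, ← sq]
        rcases Nat.eq_zero_or_pos N with rfl | hN0
        · simp
        · have : (N : ℝ) ≠ 0 := by positivity
          field_simp
      exact (pow_le_pow_left₀ hε.le hN 2).trans h2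
    rw [← hA, h0, inner_zero_left] at h1
    exact (not_le.2 (by positivity)) h1
  -- `⟪A V u, v⟫ = B (V u) v = B (V* V u) (V* v) = B u (V* v) = ⟪V A u, v⟫`.
  · refine ext_inner_right ℝ fun v ↦ ?_
    rw [hA, ← hadj, hVV, ← hA, ContinuousLinearMap.adjoint_inner_right]
  · rw [hA]
    -- Cauchy-Schwarz for the positive form, with second argument `A u`.
    have h1 : B u (A u) ^ 2 ≤ B u u * (‖y‖ ^ 2 * ‖A u‖ * ‖A u‖) := by
      refine le_of_tendsto_of_tendsto ((hB u (A u)).pow 2) ((hB u u).mul_const _)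
        (Eventually.of_forall fun N ↦ (orbitForm_sq_le N u (A u)).trans ?_)
      exact mul_le_mul_of_nonneg_left ((le_abs_self _).trans (abs_orbitForm_le hV N _ _))
        (orbitForm_self_nonneg N u)
    have h2 : 0 ≤ B u u := ge_of_tendsto (hB u u)
      (Eventually.of_forall fun N ↦ orbitForm_self_nonneg N u)
    rw [← hA u (A u), real_inner_self_eq_norm_sq] at h1
    rcases eq_or_ne (A u) 0 with h3 | h3
    · rw [h3, norm_zero, zero_pow two_ne_zero]
      exact mul_nonneg (sq_nonneg _) h2
    · have h4 : 0 < ‖A u‖ ^ 2 := by positivity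
      refine le_of_mul_le_mul_right ?_ h4
      linarith
  · simp_rw [hA]
    exact le_of_tendsto (tendsto_finsetSum _ fun i _ ↦ hB (e i) (e i))
      (Eventually.of_forall fun N ↦ sum_orbitForm_le hV N he)

/-- Otherwise orthonormal families of any length with `⟪A e, e⟫ ≥ ε` could be built one vector at a
time, against the trace bound. This stands in for the spectral theorem. -/
lemma exists_orthonormal_forall_inner_le {A : H →L[ℝ] H} {C : ℝ}
    (hA : ∀ (n : ℕ) (e : Fin n → H), Orthonormal ℝ e → ∑ i, inner ℝ (A (e i)) (e i) ≤ C)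
    {ε : ℝ} (hε : 0 < ε) :
    ∃ (n : ℕ) (e : Fin n → H), Orthonormal ℝ e ∧
      ∀ u, (∀ i, inner ℝ (e i) u = (0 : ℝ)) → inner ℝ (A u) u ≤ ε * ‖u‖ ^ 2 := by
  by_contra! h
  have key (n : ℕ) : ∃ e : Fin n → H, Orthonormal ℝ e ∧ ∀ i, ε ≤ inner ℝ (A (e i)) (e i) := by
    induction n with
    | zero => exact ⟨Fin.elim0, ⟨fun i ↦ i.elim0, fun i ↦ i.elim0⟩, fun i ↦ i.elim0⟩
    | succ n ih =>
      obtain ⟨e, he, heε⟩ := ih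
      obtain ⟨u, hu, hAu⟩ := h n e he
      have hu0 : u ≠ 0 := by
        rintro rfl
        simp at hAu
      have hun : 0 < ‖u‖ := norm_pos_iff.2 hu0
      refine ⟨Fin.cons (‖u‖⁻¹ • u) e, ⟨fun i ↦ ?_, fun i j hij ↦ ?_⟩, fun i ↦ ?_⟩
      · refine Fin.cases ?_ (fun i ↦ ?_) i
        · rw [Fin.cons_zero, norm_smul, norm_inv, norm_norm, inv_mul_cancel₀ hun.ne']
        · rw [Fin.cons_succ, he.1]
      · induction i using Fin.cases with
        | zero =>
          induction j using Fin.cases with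
          | zero => exact absurd rfl hij
          | succ j =>
            rw [Fin.cons_zero, Fin.cons_succ, real_inner_comm, inner_smul_right, hu, mul_zero]
        | succ i =>
          induction j using Fin.cases with
          | zero => rw [Fin.cons_zero, Fin.cons_succ, inner_smul_right, hu, mul_zero]
          | succ j =>
            rw [Fin.cons_succ, Fin.cons_succ]
            exact he.2 fun h ↦ hij (by rw [h])
      · refine Fin.cases ?_ (fun i ↦ ?_) i
        · rw [Fin.cons_zero, map_smul, inner_smul_left, inner_smul_right]
          simp only [conj_trivial]
          rw [← mul_assoc, ← mul_inv, ← sq, ← div_eq_inv_mul, le_div_iff₀ (by positivity)]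
          exact hAu.le
        · rw [Fin.cons_succ]
          exact heε i
  obtain ⟨n, hn⟩ := exists_nat_gt (C / ε)
  obtain ⟨e, he, heε⟩ := key n
  have h1 : n * ε ≤ C := by
    refine le_trans ?_ (hA n e he)
    simpa using Finset.card_nsmul_le_sum Finset.univ (fun i ↦ (inner ℝ (A (e i)) (e i) : ℝ)) ε
      fun i _ ↦ heε i
  rw [div_lt_iff₀ hε] at hn
  exact (not_lt.2 h1) hn

end Intertwiner

/-! ### Strassen's law forces weak mixing on `H`. -/

section Converse

set_option linter.unusedSectionVars false

variable {X H : Type*} [NormedAddCommGroup X] [NormedSpace ℝ X] [CompleteSpace X]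
  [SecondCountableTopology X] [MeasurableSpace X] [BorelSpace X]
  [NormedAddCommGroup H] [InnerProductSpace ℝ H] [CompleteSpace H]
  {ι : H →L[ℝ] X} {μ : Measure X} {S : H →L[ℝ] H} {T : X → X}

/-- Under Strassen's law, no nonzero vector has a precompact orbit. -/
lemma IsAELinearExtension.eq_zero_of_orbit_near_finiteDimensional
    (hW : IsAbstractWienerSpace ι μ)
    (hS : S ∘L ContinuousLinearMap.adjoint S = ContinuousLinearMap.id ℝ H)
    (hT : IsAELinearExtension ι μ S T) (hlaw : HasStrassenLaw ι μ T) {z : H}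
    (hz : ∀ ε > 0, ∃ (n : ℕ) (f : Fin n → H) (c : ℕ → Fin n → ℝ) (C : ℝ),
      (∀ N i, |c N i| ≤ C) ∧
      ∀ N, ‖(ContinuousLinearMap.adjoint S ^ N) z - ∑ i, c N i • f i‖ ≤ ε) : z = 0 := by
  have := hW.isProbabilityMeasure
  have hTμ := hT.measurePreserving hW hS
  by_contra hz0
  have hzn : 0 < ‖z‖ := norm_pos_iff.2 hz0
  -- The value of `ℓ` at the limit point `ι (z / ‖z‖)` is at most `5 ε`: two for replacing `ℓ` by
  -- `g`, two for replacing `g` by the finite sum, one for the sum itself. Yet it is at least `‖z‖ -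
  -- ε = 9 ε`.
  set ε := ‖z‖ / 10 with hε
  have hε0 : 0 < ε := by positivity
  obtain ⟨n, f, c, C, hC, hc⟩ := hz ε hε0
  obtain ⟨g, hg⟩ := hW.exists_isWienerFunctional z
  choose w hw using fun i ↦ hW.exists_isWienerFunctional (f i)
  obtain ⟨ℓ, hℓ⟩ := exists_dualEmbedding_near hW.injective z hε0
  have h1 : ∀ᵐ x ∂μ, ∀ᶠ N : ℕ in atTop,
      |ℓ (T^[N] x) - g (T^[N] x)| ≤ (2 * ε) * √(2 * Real.log N) := by
    refine ae_eventually_abs_le (τ := fun _ ↦ ‖dualEmbedding ι ℓ - z‖) (σ := ε) (fun N ↦ ?_)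
      (fun N ↦ by rw [abs_norm]; exact hℓ.le) (by linarith)
    exact hT.isCenteredGaussian_iterate hW hS ((IsWienerFunctional.dual ℓ).sub hg) N
  have h2 : ∀ᵐ x ∂μ, ∀ᶠ N : ℕ in atTop,
      |g (T^[N] x) - ∑ i, c N i * w i x| ≤ (2 * ε) * √(2 * Real.log N) := by
    refine ae_eventually_abs_le (σ := ε) (fun N ↦ hW.isCenteredGaussian
      ((hT.isWienerFunctional_iterate hTμ hg N).sub
        (IsWienerFunctional.sum Finset.univ fun i _ ↦ (hw i).const_mul (c N i)))) (fun N ↦ ?_)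
      (by linarith)
    rw [abs_norm]
    exact hc N
  obtain ⟨x, hx1, hx2, hx⟩ := (h1.and (h2.and hlaw)).exists
  have h3 : ι (‖z‖⁻¹ • z) ∈ strassenLimitSet T x := by
    rw [hx]
    refine ⟨_, ?_, rfl⟩
    rw [mem_closedBall_zero_iff, norm_smul, norm_inv, norm_norm, inv_mul_cancel₀ hzn.ne']
  have h4 : ∀ᶠ N : ℕ in atTop, C * ∑ i, |w i x| ≤ ε * √(2 * Real.log N) :=
    (tendsto_sqrt_two_log_atTop.const_mul_atTop hε0).eventually_ge_atTop _
  have h5 : ℓ (ι (‖z‖⁻¹ • z)) ≤ 5 * ε := by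
    have h6 : IsClosed {y | ℓ y ≤ 5 * ε} := isClosed_le ℓ.continuous continuous_const
    refine h6.mem_of_mapClusterPt h3 ?_
    filter_upwards [hx1, hx2, h4, eventually_sqrt_two_log_pos] with N hN1 hN2 hN4 hN0
    rw [map_smul, smul_eq_mul, inv_mul_le_iff₀ hN0]
    have h7 : |∑ i, c N i * w i x| ≤ C * ∑ i, |w i x| := by
      refine (Finset.abs_sum_le_sum_abs _ _).trans ?_
      rw [Finset.mul_sum]
      refine Finset.sum_le_sum fun i _ ↦ ?_
      rw [abs_mul]
      exact mul_le_mul_of_nonneg_right (hC N i) (abs_nonneg _)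
    linarith [le_abs_self (ℓ (T^[N] x) - g (T^[N] x)),
      le_abs_self (g (T^[N] x) - ∑ i, c N i * w i x), le_abs_self (∑ i, c N i * w i x)]
  have h8 : ‖z‖ - ε ≤ ℓ (ι (‖z‖⁻¹ • z)) := by
    have h9 := (abs_le.1 (abs_real_inner_le_norm (dualEmbedding ι ℓ - z) (‖z‖⁻¹ • z))).1
    rw [inner_sub_left, inner_dualEmbedding, inner_smul_right z, real_inner_self_eq_norm_sq,
      norm_smul, norm_inv, norm_norm, inv_mul_cancel₀ hzn.ne', mul_one, sq, inv_mul_cancel_left₀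
      hzn.ne'] at h9
    linarith
  linarith

/-- If the means do not tend to 0, then `V^N (A x) = A (V^N x)` stays in the image of a ball under
the trace-class intertwiner `A`, so `A x ≠ 0` has an orbit near finite-dimensional subspaces. -/
theorem IsAELinearExtension.tendsto_cesaro_of_hasStrassenLaw (hW : IsAbstractWienerSpace ι μ)
    (hS : S ∘L ContinuousLinearMap.adjoint S = ContinuousLinearMap.id ℝ H)
    (hT : IsAELinearExtension ι μ S T) (hlaw : HasStrassenLaw ι μ T) (x y : H) :
    Tendsto (fun N : ℕ ↦ (N : ℝ)⁻¹ * ∑ k ∈ Finset.Icc 1 N, |inner ℝ ((S ^ k) x) y|)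
      atTop (𝓝 0) := by
  simp_rw [inner_pow_apply S]
  by_contra hxy
  set V := ContinuousLinearMap.adjoint S with hVdef
  have hV : ∀ h, ‖V h‖ = ‖h‖ := norm_adjoint_of_comp_adjoint hS
  obtain ⟨A, hAx, hAV, hA, htr⟩ := exists_commuting_trace_class hV hxy
  refine hAx (hT.eq_zero_of_orbit_near_finiteDimensional hW hS hlaw fun ε hε ↦ ?_)
  -- The threshold makes `‖y‖² ⟪A q, q⟫ ≤ ε²` when `‖q‖ ≤ ‖x‖`; the `+ 1` avoids a zero denominator.
  obtain ⟨n, e, he, hAe⟩ := exists_orthonormal_forall_inner_le htr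
    (show 0 < ε ^ 2 / (‖y‖ ^ 2 * ‖x‖ ^ 2 + 1) by positivity)
  refine ⟨n, fun i ↦ A (e i), fun N i ↦ inner ℝ (e i) ((V ^ N) x), ‖x‖, fun N i ↦ ?_, fun N ↦ ?_⟩
  · refine (abs_real_inner_le_norm _ _).trans ?_
    rw [he.1, norm_pow_apply hV, one_mul]
  · have hAVN : (V ^ N) (A x) = A ((V ^ N) x) := by
      induction N with
      | zero => simp
      | succ N ih => rw [pow_succ', mul_apply_eq_comp, mul_apply_eq_comp, ih, hAV]
    set u := (V ^ N) x with hu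
    have hun : ‖u‖ = ‖x‖ := norm_pow_apply hV N x
    set q := u - ∑ i, (inner ℝ (e i) u : ℝ) • e i with hq
    have h1 : (V ^ N) (A x) - ∑ i, (inner ℝ (e i) u : ℝ) • A (e i) = A q := by
      rw [hAVN, hq, map_sub, map_sum]
      simp_rw [map_smul]
    rw [h1]
    have hqe (i : Fin n) : inner ℝ (e i) q = (0 : ℝ) := by
      rw [hq, inner_sub_right, he.inner_right_fintype, sub_self]
    have hqn : ‖q‖ ≤ ‖x‖ := by
      have h2 : inner ℝ q q = (inner ℝ q u : ℝ) := by
        conv_lhs => rw [hq, inner_sub_right, inner_sum]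
        simp_rw [← hq, inner_smul_right, real_inner_comm _ q, hqe]
        simp
      have h3 := real_inner_le_norm q u
      rw [← h2, real_inner_self_eq_norm_sq, hun, sq] at h3
      rcases (norm_nonneg q).eq_or_lt with h4 | h4
      · rw [← h4]
        exact norm_nonneg x
      · exact le_of_mul_le_mul_left h3 h4
    refine abs_le_of_sq_le_sq' ?_ hε.le |>.2
    calc ‖A q‖ ^ 2 ≤ ‖y‖ ^ 2 * inner ℝ (A q) q := hA q
      _ ≤ ‖y‖ ^ 2 * (ε ^ 2 / (‖y‖ ^ 2 * ‖x‖ ^ 2 + 1) * ‖x‖ ^ 2) := by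
        refine mul_le_mul_of_nonneg_left ((hAe q hqe).trans ?_) (sq_nonneg _)
        gcongr
      _ = ε ^ 2 * ((‖y‖ ^ 2 * ‖x‖ ^ 2) / (‖y‖ ^ 2 * ‖x‖ ^ 2 + 1)) := by ring
      _ ≤ ε ^ 2 := by
        refine mul_le_of_le_one_right (sq_nonneg _) ?_
        rw [div_le_one (by positivity)]
        linarith

end Converse

/-! ## Decay of correlations -/

section Decay

/-- The sequences that tend to zero. -/
def nullSequences : Submodule ℝ (ℕ → ℝ) where
  carrier := {a | Tendsto a atTop (𝓝 0)}
  add_mem' {a b} ha hb := by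
    have h1 : Tendsto (fun n ↦ a n + b n) atTop (𝓝 (0 + 0)) := Tendsto.add ha hb
    rw [add_zero] at h1
    exact h1
  zero_mem' := tendsto_const_nhds
  smul_mem' c a ha := by
    have h1 : Tendsto (fun n ↦ c * a n) atTop (𝓝 (c * 0)) := Tendsto.const_mul c ha
    rw [mul_zero] at h1
    exact h1

/-- The sequences that tend to zero in absolute Cesàro mean. -/
def cesaroNullSequences : Submodule ℝ (ℕ → ℝ) where
  carrier := {a | Tendsto (fun n : ℕ ↦ (n : ℝ)⁻¹ * ∑ k ∈ Finset.Icc 1 n, |a k|) atTop (𝓝 0)}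
  add_mem' {a b} ha hb := by
    have h1 := Tendsto.add ha hb
    rw [add_zero] at h1
    refine squeeze_zero (fun n ↦ by positivity) (fun n ↦ ?_) h1
    rw [← mul_add, ← Finset.sum_add_distrib]
    exact mul_le_mul_of_nonneg_left (Finset.sum_le_sum fun k _ ↦ abs_add_le _ _) (by positivity)
  zero_mem' := by simp
  smul_mem' c a ha := by
    have h1 := Tendsto.const_mul |c| ha
    rw [mul_zero] at h1
    refine h1.congr fun n ↦ ?_
    simp only [Pi.smul_apply, smul_eq_mul, abs_mul, Finset.mul_sum]
    exact Finset.sum_congr rfl fun k _ ↦ by ring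

/-- `P` is closed under uniform limits. -/
def IsUniformlyClosed (P : Submodule ℝ (ℕ → ℝ)) : Prop :=
  ∀ a : ℕ → ℝ, (∀ ε > 0, ∃ b ∈ P, ∀ n, |a n - b n| ≤ ε) → a ∈ P

lemma isUniformlyClosed_nullSequences : IsUniformlyClosed nullSequences := by
  intro a ha
  refine Metric.tendsto_nhds.2 fun ε hε ↦ ?_
  obtain ⟨b, hb, hab⟩ := ha (ε / 2) (by positivity)
  filter_upwards [Metric.tendsto_nhds.1 hb (ε / 2) (by positivity)] with n hn
  rw [Real.dist_0_eq_abs] at hn ⊢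
  have := abs_sub_abs_le_abs_sub (a n) (b n)
  linarith [hab n]

lemma isUniformlyClosed_cesaroNullSequences : IsUniformlyClosed cesaroNullSequences := by
  intro a ha
  refine Metric.tendsto_nhds.2 fun ε hε ↦ ?_
  obtain ⟨b, hb, hab⟩ := ha (ε / 2) (by positivity)
  filter_upwards [Metric.tendsto_nhds.1 hb (ε / 2) (by positivity)] with n hn
  rw [Real.dist_0_eq_abs, abs_of_nonneg (by positivity)] at hn ⊢
  have h1 := inv_mul_sum_Icc_le (f := fun k ↦ |a k| - |b k|) (C := ε / 2) (by positivity)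
    (fun k ↦ (abs_sub_abs_le_abs_sub (a k) (b k)).trans (hab k)) n
  rw [Finset.sum_sub_distrib, mul_sub] at h1
  linarith

variable {L : Type*} [NormedAddCommGroup L] [InnerProductSpace ℝ L]

/-- The correlations of `f` and `U n g`, relative to the unit vector `e`. -/
noncomputable def correlation (U : ℕ → L →L[ℝ] L) (e f g : L) (n : ℕ) : ℝ :=
  inner ℝ f (U n g) - inner ℝ f e * inner ℝ e g

variable {U : ℕ → L →L[ℝ] L} {e : L}

lemma correlation_add_left (f f' g : L) :
    correlation U e (f + f') g = correlation U e f g + correlation U e f' g := by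
  ext n
  simp only [correlation, inner_add_left, Pi.add_apply]
  ring

lemma correlation_smul_left (c : ℝ) (f g : L) :
    correlation U e (c • f) g = c • correlation U e f g := by
  ext n
  simp only [correlation, inner_smul_left, Pi.smul_apply, smul_eq_mul, conj_trivial]
  ring

lemma correlation_add_right (f g g' : L) :
    correlation U e f (g + g') = correlation U e f g + correlation U e f g' := by
  ext n
  simp only [correlation, inner_add_right, map_add, Pi.add_apply]
  ring

lemma correlation_smul_right (c : ℝ) (f g : L) :
    correlation U e f (c • g) = c • correlation U e f g := by
  ext n
  simp only [correlation, inner_smul_right, map_smul, Pi.smul_apply, smul_eq_mul]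
  ring

lemma abs_correlation_le (hU : ∀ n g, ‖U n g‖ ≤ ‖g‖) (he : ‖e‖ ≤ 1) (f g : L) (n : ℕ) :
    |correlation U e f g n| ≤ 2 * ‖f‖ * ‖g‖ := by
  have h1 : |inner ℝ f (U n g)| ≤ ‖f‖ * ‖g‖ := (abs_real_inner_le_norm _ _).trans
    (mul_le_mul_of_nonneg_left (hU n g) (norm_nonneg _))
  have h2 : |inner ℝ f e| ≤ ‖f‖ := (abs_real_inner_le_norm _ _).trans
    (mul_le_of_le_one_right (norm_nonneg _) he)
  have h3 : |inner ℝ e g| ≤ ‖g‖ := (abs_real_inner_le_norm _ _).trans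
    (mul_le_of_le_one_left (norm_nonneg _) he)
  have h4 : |inner ℝ f e * inner ℝ e g| ≤ ‖f‖ * ‖g‖ := by
    rw [abs_mul]
    exact mul_le_mul h2 h3 (abs_nonneg _) (norm_nonneg _)
  refine (abs_sub _ _).trans ?_
  linarith

/-- The vectors `f` with `β f` in `P` form a closed subspace. Uniform closedness is all that this
needs, so strong and weak mixing are treated together. -/
lemma mem_of_dense_span {P : Submodule ℝ (ℕ → ℝ)} (hP : IsUniformlyClosed P) {D : Set L}
    (hD : (Submodule.span ℝ D).topologicalClosure = ⊤) (β : L →ₗ[ℝ] ℕ → ℝ) {C : ℝ}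
    (hβ : ∀ f n, |β f n| ≤ C * ‖f‖) (h : ∀ f ∈ D, β f ∈ P) (f : L) : β f ∈ P := by
  have hC : IsClosed ((P.comap β : Submodule ℝ L) : Set L) := by
    refine isClosed_of_closure_subset fun f hf ↦ hP _ fun ε hε ↦ ?_
    obtain ⟨g, hg, hfg⟩ := Metric.mem_closure_iff.1 hf (ε / (|C| + 1)) (by positivity)
    refine ⟨β g, hg, fun n ↦ ?_⟩
    rw [← Pi.sub_apply, ← map_sub]
    refine (hβ _ n).trans ?_
    rw [dist_eq_norm, lt_div_iff₀ (by positivity)] at hfg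
    nlinarith [norm_nonneg (f - g), le_abs_self C]
  have h1 : (Submodule.span ℝ D).topologicalClosure ≤ P.comap β :=
    Submodule.topologicalClosure_minimal _ (Submodule.span_le.2 h) hC
  rw [hD] at h1
  exact h1 Submodule.mem_top

lemma correlation_mem_of_dense_span {P : Submodule ℝ (ℕ → ℝ)} (hP : IsUniformlyClosed P)
    (hU : ∀ n g, ‖U n g‖ ≤ ‖g‖) (he : ‖e‖ ≤ 1) {D : Set L}
    (hD : (Submodule.span ℝ D).topologicalClosure = ⊤)
    (h : ∀ f ∈ D, ∀ g ∈ D, correlation U e f g ∈ P) (f g : L) : correlation U e f g ∈ P := by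
  have h1 (f : L) (hf : f ∈ D) (g : L) : correlation U e f g ∈ P :=
    mem_of_dense_span hP hD
      { toFun := correlation U e f
        map_add' := correlation_add_right f
        map_smul' := fun c g ↦ correlation_smul_right c f g }
      (fun g n ↦ abs_correlation_le hU he f g n) (h f hf) g
  exact mem_of_dense_span hP hD
    { toFun := fun f ↦ correlation U e f g
      map_add' := fun f f' ↦ correlation_add_left f f' g
      map_smul' := fun c f ↦ correlation_smul_left c f g } (C := 2 * ‖g‖)
    (fun f n ↦ (abs_correlation_le hU he f g n).trans (le_of_eq (by ring)))
    (fun f hf ↦ h1 f hf g) f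

end Decay

/-! ### Decay of correlations in `L²` and ergodicity. -/

section Koopman

set_option linter.unusedSectionVars false

variable {Ω : Type*} [MeasurableSpace Ω] {P : Measure Ω} [IsProbabilityMeasure P] {T : Ω → Ω}

lemma closure_span_indicator :
    (Submodule.span ℝ {f : Lp ℝ 2 P | ∃ (s : Set Ω) (hs : MeasurableSet s),
      f = indicatorConstLp 2 hs (measure_ne_top P s) (1 : ℝ)}).topologicalClosure = ⊤ := by
  rw [Submodule.topologicalClosure_eq_top_iff, Submodule.eq_bot_iff]
  intro f hf
  rw [Submodule.mem_orthogonal] at hf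
  refine (Lp.eq_zero_iff_ae_eq_zero).2 ?_
  refine Integrable.ae_eq_zero_of_forall_setIntegral_eq_zero
    ((Lp.memLp f).integrable one_le_two) fun s hs _ ↦ ?_
  rw [← L2.inner_indicatorConstLp_one (𝕜 := ℝ) hs (measure_ne_top P s) f]
  exact hf _ (Submodule.subset_span ⟨s, hs, rfl⟩)

/-- If correlations decay for a set of functions with dense span, then they decay for all
square integrable functions. -/
lemma integral_comp_iterate_sub_mem (hT : MeasurePreserving T P P) {Q : Submodule ℝ (ℕ → ℝ)}
    (hQ : IsUniformlyClosed Q) {D : Set (Ω → ℝ)} (hD : ∀ f ∈ D, MemLp f 2 P)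
    (hdense : (Submodule.span ℝ {f : Lp ℝ 2 P | ∃ g, ∃ hg : g ∈ D,
      f = (hD g hg).toLp g}).topologicalClosure = ⊤)
    (h : ∀ f ∈ D, ∀ g ∈ D,
      (fun n ↦ ∫ x, f x * g (T^[n] x) ∂P - (∫ x, f x ∂P) * ∫ x, g x ∂P) ∈ Q)
    {f g : Ω → ℝ} (hf : MemLp f 2 P) (hg : MemLp g 2 P) :
    (fun n ↦ ∫ x, f x * g (T^[n] x) ∂P - (∫ x, f x ∂P) * ∫ x, g x ∂P) ∈ Q := by
  set U : ℕ → Lp ℝ 2 P →L[ℝ] Lp ℝ 2 P := fun n ↦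
    (Lp.compMeasurePreservingₗᵢ ℝ T^[n] (hT.iterate n)).toContinuousLinearMap with hU
  have h1m : MemLp (fun _ : Ω ↦ (1 : ℝ)) 2 P := memLp_const 1
  set e : Lp ℝ 2 P := h1m.toLp _ with he
  have hinner {f g : Ω → ℝ} (hf : MemLp f 2 P) (hg : MemLp g 2 P) :
      inner ℝ (hf.toLp f) (hg.toLp g) = ∫ x, f x * g x ∂P := by
    rw [L2.inner_def]
    refine integral_congr_ae ?_
    filter_upwards [hf.coeFn_toLp, hg.coeFn_toLp] with x hx1 hx2
    rw [hx1, hx2, real_inner_comm]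
    rfl
  have hcorr {f g : Ω → ℝ} (hf : MemLp f 2 P) (hg : MemLp g 2 P) :
      correlation U e (hf.toLp f) (hg.toLp g)
        = fun n ↦ ∫ x, f x * g (T^[n] x) ∂P - (∫ x, f x ∂P) * ∫ x, g x ∂P := by
    ext n
    have h1 : U n (hg.toLp g) = (hg.comp_measurePreserving (hT.iterate n)).toLp _ :=
      Lp.toLp_compMeasurePreserving hg (hT.iterate n)
    rw [correlation, h1, hinner, hinner, hinner]
    simp
  have hUn (n : ℕ) (g : Lp ℝ 2 P) : ‖U n g‖ ≤ ‖g‖ :=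
    (LinearIsometry.norm_map (Lp.compMeasurePreservingₗᵢ ℝ T^[n] (hT.iterate n)) g).le
  have hen : ‖e‖ ≤ 1 := by
    have h1 : ‖e‖ ^ 2 = 1 := by
      rw [← real_inner_self_eq_norm_sq, he, hinner]
      simp
    nlinarith [norm_nonneg e]
  rw [← hcorr hf hg]
  refine correlation_mem_of_dense_span hQ hUn hen hdense ?_ _ _
  rintro _ ⟨f, hf, rfl⟩ _ ⟨g, hg, rfl⟩
  rw [hcorr]
  exact h f hf g hg

lemma integral_indicator_mul_indicator_comp {A B : Set Ω} (hA : MeasurableSet A)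
    (hB : MeasurableSet B) (hT : Measurable T) (n : ℕ) :
    ∫ x, A.indicator (fun _ ↦ (1 : ℝ)) x * B.indicator (fun _ ↦ (1 : ℝ)) (T^[n] x) ∂P
      = P.real (A ∩ T^[n] ⁻¹' B) := by
  rw [← integral_indicator_one (hA.inter (hT.iterate n hB))]
  refine integral_congr_ae (ae_of_all _ fun x ↦ ?_)
  by_cases h1 : x ∈ A <;> by_cases h2 : T^[n] x ∈ B <;> simp [Set.indicator, h1, h2]

lemma IsStronglyMixing.tendsto_integral (hmix : IsStronglyMixing P T)
    (hT : MeasurePreserving T P P) {f g : Ω → ℝ} (hf : MemLp f 2 P) (hg : MemLp g 2 P) :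
    Tendsto (fun n ↦ ∫ x, f x * g (T^[n] x) ∂P - (∫ x, f x ∂P) * ∫ x, g x ∂P) atTop (𝓝 0) := by
  refine integral_comp_iterate_sub_mem hT isUniformlyClosed_nullSequences
    (D := {f | ∃ s, MeasurableSet s ∧ f = s.indicator fun _ ↦ (1 : ℝ)}) ?_ ?_ ?_ hf hg
  · rintro _ ⟨s, hs, rfl⟩
    exact memLp_indicator_const 2 hs 1 (Or.inr (measure_ne_top P s))
  · rw [eq_top_iff, ← closure_span_indicator]
    refine Submodule.topologicalClosure_mono (Submodule.span_mono ?_)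
    rintro _ ⟨s, hs, rfl⟩
    exact ⟨_, ⟨s, hs, rfl⟩, rfl⟩
  · rintro _ ⟨A, hA, rfl⟩ _ ⟨B, hB, rfl⟩
    simp_rw [integral_indicator_mul_indicator_comp hA hB hT.measurable]
    have h1 (s : Set Ω) (hs : MeasurableSet s) :
        ∫ x, s.indicator (fun _ ↦ (1 : ℝ)) x ∂P = P.real s := integral_indicator_one hs
    rw [h1 A hA, h1 B hB]
    have h2 := (hmix A B hA hB).sub_const (P.real A * P.real B)
    rwa [sub_self] at h2

/-- For an invariant set the averaged sequence is constant, so `P(s) = P(s)²`. -/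
lemma IsWeaklyMixing.ergodic (hmix : IsWeaklyMixing P T) (hT : MeasurePreserving T P P) :
    Ergodic T P := by
  refine ⟨hT, ⟨fun s hs hTs ↦ ?_⟩⟩
  have h1 (k : ℕ) : T^[k] ⁻¹' s = s := by
    induction k with
    | zero => rfl
    | succ k ih => rw [Function.iterate_succ', Set.preimage_comp, hTs, ih]
  have h2 := hmix s s hs hs
  simp_rw [h1, Set.inter_self, Finset.sum_const, Nat.card_Icc, Nat.add_sub_cancel,
    nsmul_eq_mul] at h2
  have h3 : Tendsto (fun n : ℕ ↦ (n : ℝ)⁻¹ * (n * |P.real s - P.real s * P.real s|)) atTop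
      (𝓝 |P.real s - P.real s * P.real s|) := by
    refine tendsto_const_nhds.congr' ?_
    filter_upwards [eventually_ge_atTop 1] with n hn
    rw [inv_mul_cancel_left₀ (Nat.cast_ne_zero.2 (by omega))]
  have h4 := abs_eq_zero.1 (tendsto_nhds_unique h3 h2)
  have h5 : P.real s * (1 - P.real s) = 0 := by linarith
  rw [eventuallyConst_set']
  rcases mul_eq_zero.1 h5 with h6 | h6
  · exact Or.inl (ae_eq_empty.2 ((measureReal_eq_zero_iff).1 h6))
  · right
    rw [ae_eq_univ]
    refine (measureReal_eq_zero_iff).1 ?_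
    rw [measureReal_compl hs, probReal_univ]
    exact h6

end Koopman

/-! ## Weak mixing of Gaussian automorphisms -/

section GaussianMixing

set_option linter.unusedSectionVars false

variable {X H : Type*} [NormedAddCommGroup X] [NormedSpace ℝ X] [CompleteSpace X]
  [SecondCountableTopology X] [MeasurableSpace X] [BorelSpace X]
  [NormedAddCommGroup H] [InnerProductSpace ℝ H] [CompleteSpace H]
  {ι : H →L[ℝ] X} {μ : Measure X} {S : H →L[ℝ] H} {T : X → X}

lemma mem_cesaroNullSequences_of_abs_le {a b : ℕ → ℝ} (hb : b ∈ cesaroNullSequences) {K : ℝ}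
    (hab : ∀ n, |a n| ≤ K * |b n|) : a ∈ cesaroNullSequences := by
  have h1 := Tendsto.const_mul K hb
  rw [mul_zero] at h1
  refine squeeze_zero (fun n ↦ by positivity) (fun n ↦ ?_) h1
  rw [mul_left_comm, Finset.mul_sum _ _ K]
  exact mul_le_mul_of_nonneg_left (Finset.sum_le_sum fun k _ ↦ hab k) (by positivity)

lemma abs_exp_sub_one_le_mul_exp {t R : ℝ} (ht : |t| ≤ R) :
    |Real.exp t - 1| ≤ Real.exp R * |t| := by
  have hR : 1 ≤ Real.exp R := Real.one_le_exp ((abs_nonneg t).trans ht)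
  rcases le_total 0 t with h | h
  · rw [abs_of_nonneg h] at ht ⊢
    rw [abs_of_nonneg (by linarith [Real.one_le_exp h])]
    have h1 := Real.add_one_le_exp (-t)
    have h2 : Real.exp t * Real.exp (-t) = 1 := by
      rw [← Real.exp_add, add_neg_cancel, Real.exp_zero]
    have h3 : Real.exp t * (-t + 1) ≤ 1 := by
      exact (mul_le_mul_of_nonneg_left h1 (Real.exp_pos t).le).trans h2.le
    have h4 : Real.exp t * t ≤ Real.exp R * t :=
      mul_le_mul_of_nonneg_right (Real.exp_le_exp.2 ht) h
    linarith
  · rw [abs_of_nonpos h, abs_of_nonpos (by linarith [Real.exp_le_one_iff.2 h])]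
    have h1 := Real.add_one_le_exp t
    nlinarith

lemma IsAbstractWienerSpace.memLp_exp_dual (hW : IsAbstractWienerSpace ι μ) (ℓ : StrongDual ℝ X) :
    MemLp (fun x ↦ Real.exp (ℓ x)) 2 μ := by
  rw [memLp_two_iff_integrable_sq (by fun_prop)]
  refine ((hW.isCenteredGaussian_dual ℓ).integrable_exp_mul 2).congr (ae_of_all _ fun x ↦ ?_)
  change Real.exp (2 * ℓ x) = Real.exp (ℓ x) ^ 2
  rw [two_mul, Real.exp_add, sq]

/-- If `f` is orthogonal to all exponentials, its positive and negative parts are densities of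
measures with equal Laplace transforms, hence coincide; so `f = 0`. -/
lemma IsAbstractWienerSpace.closure_span_exp_dual (hW : IsAbstractWienerSpace ι μ) :
    (Submodule.span ℝ {f : Lp ℝ 2 μ | ∃ ℓ : StrongDual ℝ X,
      f = (hW.memLp_exp_dual ℓ).toLp _}).topologicalClosure = ⊤ := by
  have := hW.isProbabilityMeasure
  rw [Submodule.topologicalClosure_eq_top_iff, Submodule.eq_bot_iff]
  intro f hf
  rw [Submodule.mem_orthogonal] at hf
  have hfm : Measurable f := (Lp.stronglyMeasurable f).measurable
  have hfi : Integrable f μ := (Lp.memLp f).integrable one_le_two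
  have hfexp (ℓ : StrongDual ℝ X) : ∫ x, f x * Real.exp (ℓ x) ∂μ = 0 := by
    have h1 := hf _ (Submodule.subset_span ⟨ℓ, rfl⟩)
    rw [L2.inner_def] at h1
    rw [← h1]
    refine integral_congr_ae ?_
    filter_upwards [(hW.memLp_exp_dual ℓ).coeFn_toLp] with x hx
    rw [hx]
    rfl
  have hint (ℓ : StrongDual ℝ X) : Integrable (fun x ↦ f x * Real.exp (ℓ x)) μ :=
    (Lp.memLp f).integrable_mul (hW.memLp_exp_dual ℓ)
  have hmax (ℓ : StrongDual ℝ X) {g : X → ℝ} (hg : Measurable g)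
      (hgi : Integrable (fun x ↦ g x * Real.exp (ℓ x)) μ) :
      Integrable (fun x ↦ (ENNReal.ofReal (g x)).toReal • Real.exp (ℓ x)) μ := by
    refine hgi.mono (by fun_prop) (ae_of_all _ fun x ↦ ?_)
    rw [smul_eq_mul, norm_mul, norm_mul]
    refine mul_le_mul_of_nonneg_right ?_ (norm_nonneg _)
    rw [ENNReal.toReal_ofReal', Real.norm_eq_abs, Real.norm_eq_abs]
    exact abs_max_le_max_abs_abs.trans (by simp)
  have : IsFiniteMeasure (μ.withDensity fun x ↦ ENNReal.ofReal (f x)) :=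
    isFiniteMeasure_withDensity_ofReal hfi.2
  have : IsFiniteMeasure (μ.withDensity fun x ↦ ENNReal.ofReal (-f x)) :=
    isFiniteMeasure_withDensity_ofReal hfi.neg.2
  have hneg (ℓ : StrongDual ℝ X) : Integrable (fun x ↦ -f x * Real.exp (ℓ x)) μ := by
    simp only [neg_mul]
    exact (hint ℓ).neg
  have heq : μ.withDensity (fun x ↦ ENNReal.ofReal (f x))
      = μ.withDensity (fun x ↦ ENNReal.ofReal (-f x)) := by
    refine measure_ext_of_integral_exp_dual (fun ℓ ↦ ?_) fun ℓ ↦ ?_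
    · rw [integrable_withDensity_iff_integrable_smul' (by fun_prop)
        (ae_of_all _ fun _ ↦ ENNReal.ofReal_lt_top)]
      exact hmax ℓ hfm (hint ℓ)
    · rw [integral_withDensity_eq_integral_toReal_smul (by fun_prop)
        (ae_of_all _ fun _ ↦ ENNReal.ofReal_lt_top),
        integral_withDensity_eq_integral_toReal_smul (by fun_prop)
        (ae_of_all _ fun _ ↦ ENNReal.ofReal_lt_top), ← sub_eq_zero,
        ← integral_sub (hmax ℓ hfm (hint ℓ)) (hmax ℓ (g := fun x ↦ -f x) hfm.neg (hneg ℓ)),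
        ← hfexp ℓ]
      refine integral_congr_ae (ae_of_all _ fun x ↦ ?_)
      simp only [smul_eq_mul, ENNReal.toReal_ofReal']
      rw [← sub_mul]
      congr 1
      rcases le_total 0 (f x) with h | h
      · rw [max_eq_left h, max_eq_right (neg_nonpos.2 h), sub_zero]
      · rw [max_eq_right h, max_eq_left (neg_nonneg.2 h), zero_sub, neg_neg]
  have hae := (withDensity_eq_iff (by fun_prop) (by fun_prop)
    (by simpa using (measure_lt_top (μ.withDensity fun x ↦ ENNReal.ofReal (f x)) Set.univ).ne)).1
    heq
  refine Lp.eq_zero_iff_ae_eq_zero.2 ?_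
  filter_upwards [hae] with x hx
  rcases le_total 0 (f x) with h | h
  · rw [ENNReal.ofReal_of_nonpos (neg_nonpos.2 h), ENNReal.ofReal_eq_zero] at hx
    exact le_antisymm hx h
  · rw [ENNReal.ofReal_of_nonpos h, eq_comm, ENNReal.ofReal_eq_zero] at hx
    exact le_antisymm h (neg_nonpos.1 hx)

/-- With `a = ι* ℓ` and `b = ι* m`, the correlation of `exp ℓ` and `exp m` is a constant times `exp
⟪S^n a, b⟫ - 1`, hence at most a constant times `|⟪S^n a, b⟫|`. Exponentials span a dense subspace.
-/
theorem IsAELinearExtension.isWeaklyMixing (hW : IsAbstractWienerSpace ι μ)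
    (hS : S ∘L ContinuousLinearMap.adjoint S = ContinuousLinearMap.id ℝ H)
    (hT : IsAELinearExtension ι μ S T)
    (hmix : ∀ x y : H, Tendsto (fun N : ℕ ↦ (N : ℝ)⁻¹ *
      ∑ k ∈ Finset.Icc 1 N, |inner ℝ ((S ^ k) x) y|) atTop (𝓝 0)) :
    IsWeaklyMixing μ T := by
  have := hW.isProbabilityMeasure
  have hTμ := hT.measurePreserving hW hS
  intro A B hA hB
  have key := integral_comp_iterate_sub_mem hTμ isUniformlyClosed_cesaroNullSequences
    (D := {f | ∃ ℓ : StrongDual ℝ X, f = fun x ↦ Real.exp (ℓ x)})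
    (by rintro _ ⟨ℓ, rfl⟩; exact hW.memLp_exp_dual ℓ) ?_ ?_
    (memLp_indicator_const 2 hA (1 : ℝ) (Or.inr (measure_ne_top μ A)))
    (memLp_indicator_const 2 hB (1 : ℝ) (Or.inr (measure_ne_top μ B)))
  · simp_rw [integral_indicator_mul_indicator_comp hA hB hTμ.measurable] at key
    have h1 (s : Set X) (hs : MeasurableSet s) :
        ∫ x, s.indicator (fun _ ↦ (1 : ℝ)) x ∂μ = μ.real s := integral_indicator_one hs
    rw [h1 A hA, h1 B hB] at key
    exact key
  · rw [eq_top_iff, ← hW.closure_span_exp_dual]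
    refine Submodule.topologicalClosure_mono (Submodule.span_mono ?_)
    rintro _ ⟨ℓ, rfl⟩
    exact ⟨_, ⟨ℓ, rfl⟩, rfl⟩
  · rintro _ ⟨ℓ, rfl⟩ _ ⟨m, rfl⟩
    set V := ContinuousLinearMap.adjoint S with hV
    set a := dualEmbedding ι ℓ with ha
    set b := dualEmbedding ι m with hb
    have hVn : ∀ h, ‖V h‖ = ‖h‖ := norm_adjoint_of_comp_adjoint hS
    have h1 : (fun k ↦ (inner ℝ ((S ^ k) a) b : ℝ)) ∈ cesaroNullSequences := hmix a b
    refine mem_cesaroNullSequences_of_abs_le h1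
      (K := Real.exp (‖a‖ ^ 2 / 2) * Real.exp (‖b‖ ^ 2 / 2) * Real.exp (‖a‖ * ‖b‖)) fun n ↦ ?_
    have h2 : ∫ x, Real.exp (ℓ x) * Real.exp (m (T^[n] x)) ∂μ
        = Real.exp (‖a‖ ^ 2 / 2) * Real.exp (‖b‖ ^ 2 / 2) * Real.exp (inner ℝ ((S ^ n) a) b) := by
      simp_rw [← Real.exp_add]
      have h3 := (hW.isCenteredGaussian ((IsWienerFunctional.dual (ι := ι) (μ := μ) ℓ).add
        (hT.isWienerFunctional_iterate hTμ (IsWienerFunctional.dual m) n))).integral_exp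
      refine h3.trans ?_
      rw [norm_add_sq_real, norm_pow_apply hVn, inner_pow_apply]
      congr 1
      ring
    rw [h2, hW.integral_exp_dual, hW.integral_exp_dual, ← mul_sub_one, abs_mul, abs_mul,
      Real.abs_exp, Real.abs_exp, mul_assoc (_ * _)]
    refine mul_le_mul_of_nonneg_left (abs_exp_sub_one_le_mul_exp ?_) (by positivity)
    rw [inner_pow_apply]
    refine (abs_real_inner_le_norm _ _).trans ?_
    rw [norm_pow_apply hVn]

/-- The inner product is itself a correlation, that of the Wiener functionals of `x` and `y`, which
are square integrable and centered. -/
theorem IsAELinearExtension.tendsto_inner_of_isStronglyMixing (hW : IsAbstractWienerSpace ι μ)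
    (hS : S ∘L ContinuousLinearMap.adjoint S = ContinuousLinearMap.id ℝ H)
    (hT : IsAELinearExtension ι μ S T) (hmix : IsStronglyMixing μ T) (x y : H) :
    Tendsto (fun N : ℕ ↦ (inner ℝ ((S ^ N) x) y : ℝ)) atTop (𝓝 0) := by
  have := hW.isProbabilityMeasure
  have hTμ := hT.measurePreserving hW hS
  obtain ⟨f, hf⟩ := hW.exists_isWienerFunctional x
  obtain ⟨g, hg⟩ := hW.exists_isWienerFunctional y
  have h1 := hmix.tendsto_integral hTμ ((hW.isCenteredGaussian hf).memLp (p := 2) (by simp))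
    ((hW.isCenteredGaussian hg).memLp (by simp))
  refine h1.congr fun n ↦ ?_
  rw [(hW.isCenteredGaussian hf).integral_eq_zero, zero_mul, sub_zero,
    hW.integral_mul hf (hT.isWienerFunctional_iterate hTμ hg n), inner_pow_apply]

end GaussianMixing

theorem proposition1p1 {X H : Type*}
    [NormedAddCommGroup X] [NormedSpace ℝ X] [CompleteSpace X] [SecondCountableTopology X]
    [MeasurableSpace X] [BorelSpace X]
    [NormedAddCommGroup H] [InnerProductSpace ℝ H] [CompleteSpace H]
    (ι : H →L[ℝ] X) (μ : Measure X) (hW : IsAbstractWienerSpace ι μ) :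
    -- operators on `H` with `S S* = I`, acting on `X` through their a.e. linear extensions
    (∀ S : H →L[ℝ] H, S ∘L ContinuousLinearMap.adjoint S = ContinuousLinearMap.id ℝ H →
      (∃ T : X → X, IsAELinearExtension ι μ S T ∧ MeasurePreserving T μ μ) ∧
      ∀ T : X → X, IsAELinearExtension ι μ S T →
        ((∀ x y : H, Tendsto (fun N : ℕ => inner ℝ ((S ^ N) x) y) atTop (𝓝 0)) →
          HasStrassenLaw ι μ T) ∧
        (HasStrassenLaw ι μ T →
          ∀ x y : H, Tendsto (fun N : ℕ => (N : ℝ)⁻¹ *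
            ∑ k ∈ Finset.Icc 1 N, |inner ℝ ((S ^ k) x) y|) atTop (𝓝 0))) ∧
    -- measure-preserving a.e. linear maps of `X`
    (∀ T : X → X, IsMeasurePreservingAELinear μ T →
      (IsStronglyMixing μ T → HasStrassenLaw ι μ T) ∧
      (HasStrassenLaw ι μ T → Ergodic T μ ∧ IsWeaklyMixing μ T)) := by
  refine ⟨fun S hS ↦ ⟨?_, fun T hT ↦ ⟨hT.hasStrassenLaw hW hS,
    hT.tendsto_cesaro_of_hasStrassenLaw hW hS⟩⟩, fun T hT ↦ ?_⟩
  · obtain ⟨T, hT⟩ := exists_isAELinearExtension hW hS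
    exact ⟨T, hT, hT.measurePreserving hW hS⟩
  · obtain ⟨S, hS, hST⟩ := hT.exists_isAELinearExtension hW
    refine ⟨fun hmix ↦ hST.hasStrassenLaw hW hS
      (hST.tendsto_inner_of_isStronglyMixing hW hS hmix), fun hlaw ↦ ?_⟩
    have := hW.isProbabilityMeasure
    have hweak := hST.isWeaklyMixing hW hS (hST.tendsto_cesaro_of_hasStrassenLaw hW hS hlaw)
    exact ⟨hweak.ergodic hT.2, hweak⟩
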